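/- **Setting.** Let $f(x)=\mu_0+\sum_{i=1}^m\Delta_i\mathbf 1_{x\ge x_i^*}$ on $[0,1]$, with change points $0<x_1^*<\dots<x_m^*<1$ and jumps $0<|\Delta_i|\le 1$. The $t$-th query at a point $x_t\in[0,1]$, chosen from past observations, returns $y_t=f(x_t)+\varepsilon_t$, where $(\varepsilon_t)$ are i.i.d., centered, with $\mathbb E[e^{\lambda\varepsilon_t}]\le e^{\lambda^2/2}$ for all $\lambda\in\mathbb R$. The pair $(f,\varepsilon)$ is the environment. The budget $\mathcal T$ of an algorithm is its total number of queries. An algorithm is $(\delta,\eta,N)$-correct if, in every environment with at least $N$ change points, with probability at least $1-\delta$ it returns $\hat x_1,\dots,\hat x_N$ for which there are $1\le i_1<\dots<i_N\le m$ with $|\hat x_l-x^*_{i_l}|\le\eta$ for all $l\le N$. Let $\vartheta_i=x_{i+1}^*-x_i^*$ for $1\le i\le m-1$, $\vartheta_0=\vartheta_m=1$, $s_i=\min(\vartheta_{i-1},\vartheta_i)$, $\mathcal E_i^2=s_i\Delta_i^2$, and let $|\Delta_{(1)}|\ge\dots\ge|\Delta_{(m)}|$ be the decreasing rearrangement of the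 jumps. Put $$H_{\mathrm{detect}}=\max_{i\le m}\mathcal E_i^{-2},\qquad H_{\mathrm{localize}}=\sum_{l=1}^N\Delta_{(l)}^{-2},\qquad \omega_1=\log H_{\mathrm{detect}},$$ $$\omega_2=\max_{i\le m}\Big\{\log\big(\max(\log\mathcal E_i^{-2},e)\big)+\log(1/s_i)\Big\},\qquad \omega_3=\log\big(N\max(\log H_{\mathrm{localize}},1)\big).$$ **Algorithm LocalizeChangePoints$(N,\delta,\eta,\delta_{\mathrm{explore}})$.** For $k=\lceil\log_2(2N)\rceil,\lceil\log_2(2N)\rceil+1,\dots$ run the following stage, with fresh samples throughout, until one stage succeeds. (Sampling $n$ times from a point yields the mean of $n$ queries there.) 1. *DetectIntervals* with $\delta'=\delta_{\mathrm{explore}}/4$, $T=2^k$: start with $\mathcal I=\emptyset$ and let $d_{\max}=\lfloor\log_2(T/\log(1/\delta'))\rfloor$. For $d=1,\dots,d_{\max}$ let $n_d=2^d$, $T_d=\lfloor T/(d_{\max}(n_d+1))\rfloor$, $\beta_d=\sqrt{\tfrac{8}{T_d}\log\tfrac{2d_{\max}(n_d+1)}{\delta'}}$ ($+\infty$ if $T_d=0$).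 Sample $T_d$ times from each $i/n_d$, $0\le i\le n_d$, with means $\hat y_i$; then for $i=1,\dots,n_d$, if $|\hat y_i-\hat y_{i-1}|>\beta_d$, remove from $\mathcal I$ every interval containing $[\frac{i-1}{n_d},\frac i{n_d}]$ and add this interval to $\mathcal I$. The stage fails if $|\mathcal I|<N$. 2. *EstimateJumps*: with $\delta'$ and $T$ as before, $M=|\mathcal I|$, $\mathcal J=\emptyset$, $\tau=0$, for $r=1,2,\dots$, as long as $|\mathcal J|<N$ and $\tau+|\mathcal I\setminus\mathcal J|2^r\le T$: sample $2^{r-1}$ times from both endpoints of each $I\in\mathcal I\setminus\mathcal J$, let $\hat\Delta(I)$ be the absolute difference of the two means, accept $I$ into $\mathcal J$ if $\hat\Delta(I)\ge\sqrt{2^{-(r-5)}\log\frac{\pi^2Mr^2}{3\delta'}}$, and increase $\tau$ by $2^r$ for each interval sampled. The stage fails if $|\mathcal J|<N$; otherwise let $J_1,\dots,J_N$ be the intervals of $\mathcal J$ with the $N$ largest estimates $\hat\Delta_1\ge\dots\ge\hat\Delta_N$, and let $T_v=\max\big(\lfloor 2^k\hat\Delta_v^{-2}/\sum_{w\le N}\hat\Delta_w^{-2}\rfloor,1\big)$.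 3. *SHB* on each $J_v=[l,r]$ with budget $T_v$: if $r-l\le2\eta$, then $c_v=(l+r)/2$. Otherwise let $d_{\max}=\lceil6\log((r-l)/\eta)\rceil$, $\tau=\lfloor T_v/(5d_{\max})\rfloor$, and start from the window $(l,r)$. For $d_{\max}$ rounds, with current window $(l_d,r_d)$ and $c_d=(l_d+r_d)/2$, sample $\tau$ times from each of $l,l_d,c_d,r_d,r$ (means $y_1,\dots,y_5$; $0$ if $\tau=0$). If $\big|\frac{y_1+y_2}2-\frac{y_4+y_5}2\big|\le\max\big(\big|\frac{y_1+y_2+y_4}3-y_5\big|,\big|y_1-\frac{y_2+y_4+y_5}3\big|\big)$, return to the parent window (the root $(l,r)$ being its own parent); else if $|y_2-y_3|\le|y_3-y_4|$, move to $(c_d,r_d)$; else move to $(l_d,c_d)$. Let $c_v$ be the midpoint of the final window. 4. *VerifyCP*: for each $v$ sample $\lfloor T_v/2\rfloor$ times from $\max(\min J_v,c_v-\eta)$ and from $\min(\max J_v,c_v+\eta)$; the test is positive if $T_v\ge2$ and the means differ in absolute value by more than $\sqrt{\frac{16}{T_v}\log\frac2{\delta^{(k)}}}$, where $\delta^{(k)}=\frac{3\delta}{2\pi^2Nk^2}$.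 If all $N$ tests are positive, stop and return $\{c_1,\dots,c_N\}$ in increasing order; otherwise the stage fails. **Theorem.** There is a numerical constant $c>0$ such that for all $N\ge1$, $0<\delta<1/4$ and $0<\eta<1/4$ the following holds. 1. (Correctness) For every $0<\delta_{\mathrm{explore}}\le1/4$, LocalizeChangePoints$(N,\delta,\eta,\delta_{\mathrm{explore}})$ is $(\delta,\eta,N)$-correct. In every environment with $m\ge N$ change points, with probability at least $1-\delta$ it returns $N$ points $0\le c_1<\dots<c_N\le1$ such that $|c_i-x^*_{l_i}|\le\eta$ for $i\le N$, for some $1\le l_1<\dots<l_N\le m$. 2. (High-probability bound) If $\delta_{\mathrm{explore}}=\delta$, then in every environment with $m\ge N$ change points there is an event of probability at least $1-\delta$ on which the output is correct and $$\mathcal T\le c\Big(\omega_1H_{\mathrm{detect}}\big(\log\tfrac1\delta+\omega_2\big)+H_{\mathrm{localize}}\big(\log\tfrac1{\delta\eta}+\omega_3\big)\Big).$$ 3. (Expectation bound) If $\delta_{\mathrm{explore}}=1/4$, then in every environment with $m\ge N$ change points $$\mathbb E[\mathcal T]\le c\Big(\omega_1H_{\mathrm{detect}}\,\omega_2+H_{\mathrm{localize}}\big(\log\tfrac1{\delta\eta}+\omega_3\big)\Big).$$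 -/

import Mathlib

open MeasureTheory ProbabilityTheory
open scoped ENNReal

universe u

namespace ChangePoint

/-! ### Sequential programs with noisy queries -/

/-- A finite sequential sampling procedure: it either returns a value, or queries a point `x` and
continues depending on the noisy evaluation it receives. It has no other access to the unknown
function. -/
inductive Prog (α : Type) : Type
  | ret (a : α) : Prog α
  | query (x : ℝ) (next : ℝ → Prog α) : Prog α

namespace Prog

variable {α β : Type}

/-- Sequential composition. -/
def bind : Prog α → (α → Prog β) → Prog β
  | ret a, k => k a
  | query x next, k => query x fun y => (next y).bind k

instance : Monad Prog where
  pure := ret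
  bind := bind

/-- Execute a procedure on the function `f`. The query made after `t` earlier queries is answered by
`f x + ε t`. The result is the returned value with the total number of queries made so far. -/
def run (f : ℝ → ℝ) (ε : ℕ → ℝ) : Prog α → ℕ → α × ℕ
  | ret a, t => (a, t)
  | query x next, t => run f ε (next (f x + ε t)) (t + 1)

/-- `for b in l`, collecting the results. -/
def forEach : List β → (β → Prog α) → Prog (List α)
  | [], _ => pure []
  | b :: l, p => do
      let a ← p b
      let as ← forEach l p
      pure (a :: as)

/-- `for b in l`, updating a state. -/
def forFold : List β → α → (β → α → Prog α) → Prog α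
  | [], s, _ => pure s
  | b :: l, s, p => do
      let s' ← p b s
      forFold l s' p

/-- Sum of `n` noisy evaluations at `x`. -/
def sampleSum (x : ℝ) : ℕ → Prog ℝ
  | 0 => pure 0
  | n + 1 => do
      let y ← query x ret
      let s ← sampleSum x n
      pure (y + s)

/-- Sample `n` times from `x` and return the empirical mean (`0` when `n = 0`). -/
noncomputable def sampleMean (x : ℝ) (n : ℕ) : Prog ℝ := do
  let s ← sampleSum x n
  pure (s / n)

end Prog

/-- A sequential algorithm: a loop whose body is a sampling procedure that either updates the
internal state or terminates with an output. -/
structure Algorithm (α : Type) where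
  State : Type
  init : State
  body : State → Prog (State ⊕ α)

namespace Algorithm

variable {α : Type}

/-- State (or output, once terminated) and number of evaluations after `n` passes of the loop. -/
def after (π : Algorithm α) (f : ℝ → ℝ) (ε : ℕ → ℝ) : ℕ → (π.State ⊕ α) × ℕ
  | 0 => (Sum.inl π.init, 0)
  | n + 1 =>
    match π.after f ε n with
    | (Sum.inl s, t) => (π.body s).run f ε t
    | (Sum.inr a, t) => (Sum.inr a, t)

/-- The algorithm stops and outputs `a`. -/
def Returns (π : Algorithm α) (f : ℝ → ℝ) (ε : ℕ → ℝ) (a : α) : Prop :=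
  ∃ n, (π.after f ε n).1 = Sum.inr a

/-- The total number of evaluations of `f` (infinite if the sampling never ends). -/
noncomputable def budget (π : Algorithm α) (f : ℝ → ℝ) (ε : ℕ → ℝ) : ℝ≥0∞ :=
  ⨆ n, ((π.after f ε n).2 : ℝ≥0∞)

end Algorithm

/-! ### Environments -/

/-- A piecewise constant function with `m` change points `x 0 < ... < x (m - 1)` in `(0, 1)` and
nonzero jumps bounded by one. -/
structure StepModel (m : ℕ) where
  base : ℝ
  x : Fin m → ℝ
  jump : Fin m → ℝ
  x_strictMono : StrictMono x
  x_pos : ∀ i, 0 < x i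
  x_lt_one : ∀ i, x i < 1
  jump_ne_zero : ∀ i, jump i ≠ 0
  abs_jump_le_one : ∀ i, |jump i| ≤ 1

namespace StepModel

variable {m : ℕ}

/-- The function `f`. -/
noncomputable def f (S : StepModel m) (z : ℝ) : ℝ :=
  S.base + ∑ i, if S.x i ≤ z then S.jump i else 0

/-- The spacing between the `j`-th and `(j + 1)`-st change points, counted from one, for
`1 ≤ j ≤ m - 1`; by convention it is `1` for `j = 0` and `j = m`. -/
def spacing (S : StepModel m) (j : ℕ) : ℝ :=
  if h : 0 < j ∧ j < m then S.x ⟨j, h.2⟩ - S.x ⟨j - 1, by omega⟩ else 1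

/-- Local spacing `s_i`. -/
noncomputable def s (S : StepModel m) (i : Fin m) : ℝ := min (S.spacing i) (S.spacing (i + 1))

/-- Squared energy of a change point. -/
noncomputable def energySq (S : StepModel m) (i : Fin m) : ℝ := S.s i * S.jump i ^ 2

/-- `H_detect`. -/
noncomputable def Hdetect (S : StepModel m) : ℝ := ⨆ i, 1 / S.energySq i

/-- The `l`-th largest jump in absolute value (counted from zero). -/
noncomputable def sortedJump (S : StepModel m) (l : Fin m) : ℝ :=
  |S.jump (Tuple.sort (fun i => -|S.jump i|) l)|

/-- `H_localize`, the sum over the `N` largest jumps. -/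
noncomputable def Hlocalize (S : StepModel m) (N : ℕ) : ℝ :=
  ∑ l : Fin m with l.val < N, 1 / S.sortedJump l ^ 2

noncomputable def omega1 (S : StepModel m) : ℝ := Real.log S.Hdetect

noncomputable def omega2 (S : StepModel m) : ℝ :=
  ⨆ i, (Real.log (max (Real.log (1 / S.energySq i)) (Real.exp 1)) + Real.log (1 / S.s i))

noncomputable def omega3 (S : StepModel m) (N : ℕ) : ℝ :=
  Real.log (N * max (Real.log (S.Hlocalize N)) 1)

/-- The estimates lie within `η` of change points with indices `i_1 < ... < i_N`. -/
def Localized (S : StepModel m) {N : ℕ} (η : ℝ) (xhat : Fin N → ℝ) : Prop :=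
  ∃ i : Fin N → Fin m, StrictMono i ∧ ∀ l, |xhat l - S.x (i l)| ≤ η

end StepModel

/-- Independent, identically distributed, centered, 1-sub-Gaussian noise. -/
structure IsNoise {Ω : Type u} [MeasurableSpace Ω] (ε : ℕ → Ω → ℝ) (P : Measure Ω) : Prop where
  measurable : ∀ t, Measurable (ε t)
  indep : iIndepFun ε P
  ident : ∀ t, IdentDistrib (ε t) (ε 0) P P
  mean_zero : ∀ t, ∫ ω, ε t ω ∂P = 0
  subgaussian : ∀ t, HasSubgaussianMGF (ε t) 1 P

/-- `(δ, η, N)`-correctness: in every environment with at least `N` change points, the algorithm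
returns, with probability at least `1 - δ`, estimates within `η` of `N` distinct change points. -/
def IsCorrect (δ η : ℝ) (N : ℕ) (π : Algorithm (Fin N → ℝ)) : Prop :=
  ∀ (m : ℕ) (S : StepModel m), N ≤ m →
  ∀ (Ω : Type u) [MeasurableSpace Ω] (P : Measure Ω) [IsProbabilityMeasure P] (ε : ℕ → Ω → ℝ),
    IsNoise ε P →
    1 - δ ≤ P.real {ω | ∃ xhat, π.Returns S.f (fun t => ε t ω) xhat ∧ S.Localized η xhat}

/-! ### Detection of intervals -/

/-- The pair `(d, i)` stands for the dyadic interval `[i / 2 ^ d, (i + 1) / 2 ^ d]`. -/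
abbrev Dyadic := ℕ × ℕ

noncomputable def Dyadic.left (I : Dyadic) : ℝ := (I.2 : ℝ) / 2 ^ I.1

noncomputable def Dyadic.right (I : Dyadic) : ℝ := ((I.2 : ℝ) + 1) / 2 ^ I.1

/-- Add `I` to the list, removing from it every interval that contains `I`. -/
noncomputable def addPruned (I : Dyadic) (L : List Dyadic) : List Dyadic :=
  I :: L.filter fun J => ¬ (J.left ≤ I.left ∧ I.right ≤ J.right)

/-- Pass at depth `d`: sample all endpoints, then test all pairs of neighbouring endpoints. The
threshold is infinite (no interval is flagged) when the number `Td` of samples is zero. -/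
noncomputable def detectDepth (δ : ℝ) (T dmax d : ℕ) (L : List Dyadic) : Prog (List Dyadic) := do
  let n : ℕ := 2 ^ d
  let Td : ℕ := T / (dmax * (n + 1))
  let β : ℝ := √(8 / Td * Real.log (2 * dmax * (n + 1) / δ))
  let y ← Prog.forEach (List.range (n + 1)) fun i => Prog.sampleMean ((i : ℝ) / n) Td
  pure <| (List.range n).foldl
    (fun L i => if 0 < Td ∧ β < |y.getD (i + 1) 0 - y.getD i 0| then addPruned (d, i) L else L) L

/-- `DetectIntervals(δ, T)`. -/
noncomputable def detectIntervals (δ : ℝ) (T : ℕ) : Prog (List Dyadic) :=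
  let dmax : ℕ := ⌊Real.logb 2 (T / Real.log (1 / δ))⌋₊
  Prog.forFold (List.range dmax) [] fun d L => detectDepth δ T dmax (d + 1) L

/-! ### Estimation of jumps -/

/-- The rounds `k, k + 1, ...` of `EstimateJumps`, at most `fuel` of them, where `M` is the number
of candidate intervals, `active` are those not yet accepted, `acc` those accepted, with their
estimated jumps, and `τ` is the budget spent. -/
noncomputable def estimateRounds (δ : ℝ) (T N M : ℕ) :
    (fuel k τ : ℕ) → (active : List Dyadic) → (acc : List (Dyadic × ℝ)) →
      Prog (List (Dyadic × ℝ))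
  | 0, _, _, _, acc => pure acc
  | fuel + 1, k, τ, active, acc =>
    if acc.length < N ∧ τ + active.length * 2 ^ k ≤ T then do
      let thr : ℝ := √((2 : ℝ) ^ (-((k : ℤ) - 5)) * Real.log (Real.pi ^ 2 * M * k ^ 2 / (3 * δ)))
      let res ← Prog.forEach active fun I => do
        let yl ← Prog.sampleMean I.left (2 ^ (k - 1))
        let yr ← Prog.sampleMean I.right (2 ^ (k - 1))
        pure (I, |yr - yl|)
      estimateRounds δ T N M fuel (k + 1) (τ + active.length * 2 ^ k)
        ((res.filter fun p => p.2 < thr).map Prod.fst)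
        (acc ++ res.filter fun p => thr ≤ p.2)
    else pure acc

/-- `EstimateJumps(L, δ, T, N)`: accepted intervals with their estimated jumps. A round `k` with an
active interval is entered only if `2 ^ k ≤ T`, and for `N ≤ L.length` the loop ends when no
interval is active; so `T` rounds suffice to reach its end. -/
noncomputable def estimateJumps (L : List Dyadic) (δ : ℝ) (T N : ℕ) : Prog (List (Dyadic × ℝ)) :=
  estimateRounds δ T N L.length T 1 0 L []

/-! ### Sequential halving with backtracking -/

/-- One round. The state is the current window `(l_d, r_d)`, whose midpoint is `c_d`, with the list
of its ancestors, the parent first; the parent of the root is the root. -/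
noncomputable def shbRound (l r : ℝ) (τ : ℕ) (A : (ℝ × ℝ) × List (ℝ × ℝ)) :
    Prog ((ℝ × ℝ) × List (ℝ × ℝ)) := do
  let w := A.1
  let c := (w.1 + w.2) / 2
  let y₁ ← Prog.sampleMean l τ
  let y₂ ← Prog.sampleMean w.1 τ
  let y₃ ← Prog.sampleMean c τ
  let y₄ ← Prog.sampleMean w.2 τ
  let y₅ ← Prog.sampleMean r τ
  -- the jump seems to lie outside the window: backtrack
  if |(y₁ + y₂) / 2 - (y₄ + y₅) / 2| ≤
      max |(y₁ + y₂ + y₄) / 3 - y₅| |y₁ - (y₂ + y₄ + y₅) / 3| then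
    match A.2 with
    | [] => pure A
    | p :: ps => pure (p, ps)
  else if |y₂ - y₃| ≤ |y₃ - y₄| then pure ((c, w.2), w :: A.2)
  else pure ((w.1, c), w :: A.2)

/-- `SHB([l, r], T, η)`. -/
noncomputable def shb (l r : ℝ) (T : ℕ) (η : ℝ) : Prog ℝ :=
  if r - l ≤ 2 * η then pure ((l + r) / 2)
  else do
    let dmax : ℕ := ⌈6 * Real.log ((r - l) / η)⌉₊
    let A ← Prog.forFold (List.range dmax) ((l, r), []) fun _ A => shbRound l r (T / (5 * dmax)) A
    pure ((A.1.1 + A.1.2) / 2)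

/-! ### Verification and main algorithm -/

/-- `VerifyCP(xl, xr, δ, T)`. -/
noncomputable def verifyCP (xl xr δ : ℝ) (T : ℕ) : Prog Bool := do
  let yl ← Prog.sampleMean xl (T / 2)
  let yr ← Prog.sampleMean xr (T / 2)
  pure (decide (2 ≤ T ∧ √(16 / T * Real.log (2 / δ)) < |yr - yl|))

/-- Confidence level of the verification tests at stage `k`. -/
noncomputable def stageDelta (N : ℕ) (δ : ℝ) (k : ℕ) : ℝ := 3 * δ / (2 * Real.pi ^ 2 * N * k ^ 2)

/-- Stage `k`: either the estimates, in increasing order, or `none` when the stage fails. -/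
noncomputable def stage (N : ℕ) (δ η δexp : ℝ) (k : ℕ) : Prog (Option (Fin N → ℝ)) := do
  let L ← detectIntervals (δexp / 4) (2 ^ k)
  if N ≤ L.length then
    let acc ← estimateJumps L (δexp / 4) (2 ^ k) N
    if N ≤ acc.length then
      -- the `N` largest estimated jumps, in decreasing order
      let J := (acc.insertionSort fun p q => q.2 ≤ p.2).take N
      let W : ℝ := (J.map fun p => (p.2 ^ 2)⁻¹).sum
      let res ← Prog.forEach J fun p => do
        let Tv : ℕ := max ⌊(p.2 ^ 2)⁻¹ / W * 2 ^ k⌋₊ 1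
        let c ← shb p.1.left p.1.right Tv η
        let ok ← verifyCP (max p.1.left (c - η)) (min p.1.right (c + η)) (stageDelta N δ k) Tv
        pure (c, ok)
      if res.all Prod.snd then
        let C := (res.map Prod.fst).insertionSort (· ≤ ·)
        pure (some fun v => C.getD v 0)
      else pure none
    else pure none
  else pure none

/-- `LocalizeChangePoints(N, δ, η, δexp)`: run the stages `k = ⌈log₂ (2 N)⌉, k + 1, ...` until one of
them succeeds. -/
noncomputable def localizeChangePoints (N : ℕ) (δ η δexp : ℝ) : Algorithm (Fin N → ℝ) where
  State := ℕ
  init := Nat.clog 2 (2 * N)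
  body k := do
    match ← stage N δ η δexp k with
    | some c => pure (Sum.inr c)
    | none => pure (Sum.inl (k + 1))

end ChangePoint

/-! The proof separates probability from measurability. A procedure is a finite tree of queries, so
the expectation of a function of its result can be computed backwards, integrating one fresh noise
variable per query; this is `wp`. Using upper integrals makes `wp` monotone and subadditive on all
functions, so union bounds (`FailLE.bind`) and Chernoff bounds (`failLE_of_exp_le`) hold for
arbitrary adaptive procedures without any measurability check. Measurability enters once, in
`IsNoise.run_le_wp`, which bounds true probabilities by `wp`.

Correctness rests on verification alone. Whatever detection, estimation and halving produced, if a
point is not within η of a change point of its interval, then f takes the same value at the two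
verification points, so the test is positive with probability at most δ^(k)
(`failLE_localizeStep_correct`). The N tests of stage k cost 3δ/(2π²k²), and the sum over k is at
most δ/4. The selected intervals do not overlap, so the points and their change points can be
ordered together (`goodOutput_of_disj`).

For the budget it is enough that every stage beyond a threshold Φ succeeds with good probability
(`failLE_stage_succeeds`). (a) Detection: at the depth where cells have length about s_i, the cell
around x_i contains no other change point. Each endpoint there gets about T s_i/ω₁ samples, enough
to see the jump once T is of order ω₁ H_detect (log(1/δ) + ω₂). Pruning never loses an isolated
change point, so the candidates are exactly one isolating interval per change point. (b) Estimation: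
an interval with jump Δ is accepted after about Δ⁻² samples, up to the confidence factor. The total
is controlled by ∑ 1/Δ_i² ≤ 2 H_detect, which follows from ∑ s_i ≤ 2
(`StepModel.sum_inv_sq_jump_le`). Accepted estimates are right up to constants and rejected jumps
are not much larger, so the selected weights sum to at most 9/4 H_localize
(`totalWeight_selectLargest_le`), and an interval with jump Δ receives a budget of order 2^k/(Δ²
H_localize). (c) Halving with backtracking: count the windows of the current stack that contain x
minus those that do not. A round with accurate means raises this count by one and no round lowers it
by more than one. An exponential moment bound for this drifting walk (`Prog.failLE_forFold_drift`)
shows that the count ends at D ≈ log₂((r-l)/η) with high probability, and then the final window lies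
inside a window of width at most η that contains x.

Stages use fresh noise, so beyond the threshold the probability of still running decays
geometrically with ratio q. For δ_explore = δ, one such stage suffices outside probability 3δ/4,
which together with the δ/4 for wrong outputs gives the bound in probability. For δ_explore = 1/4
the ratio satisfies q ≤ 1/4 while the costs double, so the expected cost is of order Φ. -/

namespace ChangePoint

/-! ### Upper integrals -/

/-- The upper Lebesgue integral of a function that need not be measurable. -/
noncomputable def upperLIntegral (ν : Measure ℝ) (F : ℝ → ℝ≥0∞) : ℝ≥0∞ :=
  ⨅ g : {g : ℝ → ℝ≥0∞ // Measurable g ∧ F ≤ g}, ∫⁻ e, g.1 e ∂ν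

section upperLIntegral

variable {ν : Measure ℝ} {F G : ℝ → ℝ≥0∞}

lemma upperLIntegral_le_lintegral (hF : Measurable F) : upperLIntegral ν F ≤ ∫⁻ e, F e ∂ν :=
  iInf_le_of_le ⟨F, hF, le_rfl⟩ le_rfl

lemma lintegral_le_upperLIntegral : ∫⁻ e, F e ∂ν ≤ upperLIntegral ν F :=
  le_iInf fun g => lintegral_mono g.2.2

lemma upperLIntegral_mono (h : F ≤ G) : upperLIntegral ν F ≤ upperLIntegral ν G :=
  le_iInf fun g => iInf_le_of_le ⟨g.1, g.2.1, h.trans g.2.2⟩ le_rfl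

lemma upperLIntegral_const [IsProbabilityMeasure ν] (c : ℝ≥0∞) :
    upperLIntegral ν (fun _ => c) = c :=
  le_antisymm ((upperLIntegral_le_lintegral measurable_const).trans (by simp))
    (le_trans (by simp) lintegral_le_upperLIntegral)

/-- Monotonicity, subadditivity and scaling survive without measurability. Union bounds and
exponential Markov inequalities need nothing more. -/
lemma upperLIntegral_add_le :
    upperLIntegral ν (fun e => F e + G e) ≤ upperLIntegral ν F + upperLIntegral ν G := by
  unfold upperLIntegral
  rw [ENNReal.iInf_add]
  refine le_iInf fun g => ?_
  rw [ENNReal.add_iInf]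
  refine le_iInf fun h => ?_
  refine iInf_le_of_le ⟨fun e => g.1 e + h.1 e, g.2.1.add h.2.1,
    fun e => add_le_add (g.2.2 e) (h.2.2 e)⟩ ?_
  exact (lintegral_add_left g.2.1 _).le

lemma upperLIntegral_const_mul_le {c : ℝ≥0∞} (hc : c ≠ ∞) :
    upperLIntegral ν (fun e => c * F e) ≤ c * upperLIntegral ν F := by
  rcases eq_or_ne c 0 with rfl | h0
  · refine (upperLIntegral_le_lintegral (by simp)).trans (by simp)
  unfold upperLIntegral
  rw [ENNReal.mul_iInf_of_ne h0 hc]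
  refine le_iInf fun g => ?_
  refine iInf_le_of_le ⟨fun e => c * g.1 e, g.2.1.const_mul c,
    fun e => mul_le_mul_right (g.2.2 e) c⟩ ?_
  exact (lintegral_const_mul c g.2.1).le

end upperLIntegral

namespace Prog

variable {α β γ : Type}

/-! ### Running programs -/

lemma pure_def (a : α) : (pure a : Prog α) = ret a := rfl

lemma bind_def (p : Prog α) (q : α → Prog β) : p >>= q = p.bind q := rfl

lemma run_bind (f : ℝ → ℝ) (ε : ℕ → ℝ) (p : Prog α) (q : α → Prog β) (t : ℕ) :
    run f ε (p.bind q) t = run f ε (q (run f ε p t).1) (run f ε p t).2 := by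
  induction p generalizing t with
  | ret a => rfl
  | query x next ih => exact ih _ _

/-- Noise is read only through its time index, so after the first query the rest is a run from time
zero on the shifted sequence. This is what lets the first coordinate be integrated out. -/
lemma run_shift (f : ℝ → ℝ) (ε : ℕ → ℝ) (p : Prog α) (t : ℕ) :
    run f ε p (t + 1) =
      ((run f (fun s => ε (s + 1)) p t).1, (run f (fun s => ε (s + 1)) p t).2 + 1) := by
  induction p generalizing t with
  | ret a => rfl
  | query x next ih => exact ih _ _

/-- Every execution makes at most `n` queries. -/
def CostLE (f : ℝ → ℝ) (p : Prog α) (n : ℕ) : Prop := ∀ ε t, (run f ε p t).2 ≤ t + n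

lemma CostLE.mono {f : ℝ → ℝ} {p : Prog α} {n n' : ℕ} (h : CostLE f p n) (hn : n ≤ n') :
    CostLE f p n' := fun ε t => (h ε t).trans (by omega)

lemma costLE_ret (f : ℝ → ℝ) (a : α) (n : ℕ) : CostLE f (ret a) n := fun _ _ => Nat.le_add_right _ _

lemma CostLE.bind {f : ℝ → ℝ} {p : Prog α} {q : α → Prog β} {n n' : ℕ} (hp : CostLE f p n)
    (hq : ∀ a, CostLE f (q a) n') : CostLE f (p.bind q) (n + n') := fun ε t => by
  rw [run_bind]
  exact (hq _ _ _).trans (by have := hp ε t; omega)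

lemma costLE_sampleSum (f : ℝ → ℝ) (x : ℝ) (n : ℕ) : CostLE f (sampleSum x n) n := by
  induction n with
  | zero => exact costLE_ret _ _ _
  | succ n ih =>
    have h1 : CostLE f (query x ret) 1 := fun _ _ => le_rfl
    exact (h1.bind fun y => ih.bind (n' := 0) fun s => costLE_ret _ _ _).mono (by omega)

lemma costLE_sampleMean (f : ℝ → ℝ) (x : ℝ) (n : ℕ) : CostLE f (sampleMean x n) n :=
  (costLE_sampleSum f x n).bind (n' := 0) fun _ => costLE_ret _ _ _

lemma costLE_forEach {f : ℝ → ℝ} {p : β → Prog α} {c : β → ℕ} (l : List β)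
    (h : ∀ b ∈ l, CostLE f (p b) (c b)) : CostLE f (forEach l p) (l.map c).sum := by
  induction l with
  | nil => exact costLE_ret _ _ _
  | cons b l ih =>
    rw [List.map_cons, List.sum_cons]
    refine (h b (by simp)).bind fun a => ?_
    exact (ih fun b hb => h b (by simp [hb])).bind (n' := 0) fun _ => costLE_ret _ _ _

lemma costLE_forFold {f : ℝ → ℝ} {p : β → α → Prog α} {c : ℕ} (l : List β) (s : α)
    (h : ∀ b ∈ l, ∀ s, CostLE f (p b s) c) : CostLE f (forFold l s p) (l.length * c) := by
  induction l generalizing s with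
  | nil => exact costLE_ret _ _ _
  | cons b l ih =>
    refine ((h b (by simp) s).bind fun a => ih a fun b hb => h b (by simp [hb])).mono ?_
    rw [List.length_cons]; linarith

/-! ### Weakest preconditions -/

/-- The upper expectation of `φ` of the returned value when the noise has law `ν`. -/
noncomputable def wp (f : ℝ → ℝ) (ν : Measure ℝ) : Prog α → (α → ℝ≥0∞) → ℝ≥0∞
  | ret a, φ => φ a
  | query x next, φ => upperLIntegral ν fun e => wp f ν (next (f x + e)) φ

section wp

variable {f : ℝ → ℝ} {ν : Measure ℝ}

/-- The tower property: given the result of `p`, the program `q` works with fresh noise. -/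
lemma wp_bind (p : Prog α) (q : α → Prog β) (φ : β → ℝ≥0∞) :
    wp f ν (p.bind q) φ = wp f ν p fun a => wp f ν (q a) φ := by
  induction p with
  | ret a => rfl
  | query x next ih => simp only [Prog.bind, wp, ih]

lemma wp_mono {p : Prog α} {φ ψ : α → ℝ≥0∞} (h : ∀ a, φ a ≤ ψ a) : wp f ν p φ ≤ wp f ν p ψ := by
  induction p with
  | ret a => exact h a
  | query x next ih => exact upperLIntegral_mono fun e => ih _

lemma wp_const [IsProbabilityMeasure ν] (p : Prog α) (c : ℝ≥0∞) : wp f ν p (fun _ => c) = c := by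
  induction p with
  | ret a => rfl
  | query x next ih => simp only [wp, ih, upperLIntegral_const]

lemma wp_add_le (p : Prog α) (φ ψ : α → ℝ≥0∞) :
    wp f ν p (fun a => φ a + ψ a) ≤ wp f ν p φ + wp f ν p ψ := by
  induction p with
  | ret a => rfl
  | query x next ih => exact (upperLIntegral_mono fun e => ih _).trans upperLIntegral_add_le

lemma wp_const_mul_le (p : Prog α) {c : ℝ≥0∞} (hc : c ≠ ∞) (φ : α → ℝ≥0∞) :
    wp f ν p (fun a => c * φ a) ≤ c * wp f ν p φ := by
  induction p with
  | ret a => rfl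
  | query x next ih =>
    exact (upperLIntegral_mono fun e => ih _).trans (upperLIntegral_const_mul_le hc)

open Classical in
/-- With (outer) probability at least `1 - δ`, the returned value satisfies `Q`. -/
def FailLE (f : ℝ → ℝ) (ν : Measure ℝ) (p : Prog α) (Q : α → Prop) (δ : ℝ) : Prop :=
  wp f ν p (fun a => if Q a then 0 else 1) ≤ ENNReal.ofReal δ

/-- Every execution returns a value satisfying `Q`. -/
def Always (f : ℝ → ℝ) : Prog α → (α → Prop) → Prop
  | ret a, Q => Q a
  | query x next, Q => ∀ e, Always f (next (f x + e)) Q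

lemma Always.mono {p : Prog α} {Q Q' : α → Prop} (h : Always f p Q) (hQ : ∀ a, Q a → Q' a) :
    Always f p Q' := by
  induction p with
  | ret a => exact hQ a h
  | query x next ih => exact fun e => ih _ (h e)

lemma always_bind {p : Prog α} {q : α → Prog β} {Q : β → Prop} :
    Always f (p.bind q) Q ↔ Always f p fun a => Always f (q a) Q := by
  induction p with
  | ret a => rfl
  | query x next ih => exact forall_congr' fun e => ih _

lemma always_of_forall {p : Prog α} {Q : α → Prop} (h : ∀ a, Q a) : Always f p Q := by
  induction p with
  | ret a => exact h a
  | query x next ih => exact fun e => ih _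

lemma Always.run {p : Prog α} {Q : α → Prop} (h : Always f p Q) (ε : ℕ → ℝ) (t : ℕ) :
    Q (Prog.run f ε p t).1 := by
  induction p generalizing t with
  | ret a => exact h
  | query x next ih => exact ih _ (h (ε t)) _

lemma wp_mono_of_always {p : Prog α} {φ ψ : α → ℝ≥0∞} (h : Always f p fun a => φ a ≤ ψ a) :
    wp f ν p φ ≤ wp f ν p ψ := by
  induction p with
  | ret a => exact h
  | query x next ih => exact upperLIntegral_mono fun e => ih _ (h e)

lemma always_forEach {p : β → Prog α} {R : β → α → Prop} (l : List β)
    (h : ∀ b ∈ l, Always f (p b) (R b)) : Always f (forEach l p) (List.Forall₂ R l) := by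
  induction l with
  | nil => exact List.Forall₂.nil
  | cons b l ih =>
    refine always_bind.2 ((h b (by simp)).mono fun a ha => always_bind.2 ?_)
    exact (ih fun b hb => h b (by simp [hb])).mono fun as has => List.Forall₂.cons ha has

lemma failLE_ret {a : α} {Q : α → Prop} (h : Q a) (δ : ℝ) : FailLE f ν (ret a) Q δ := by
  simp [FailLE, wp, h]

lemma FailLE.mono {p : Prog α} {Q Q' : α → Prop} {δ δ' : ℝ} (h : FailLE f ν p Q δ)
    (hQ : ∀ a, Q a → Q' a) (hδ : δ ≤ δ') : FailLE f ν p Q' δ' := by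
  refine (wp_mono fun a => ?_).trans (h.trans (ENNReal.ofReal_le_ofReal hδ))
  by_cases ha : Q a
  · simp [ha, hQ a ha]
  · simp only [ha, if_false]; split_ifs <;> simp

lemma FailLE.and_always {p : Prog α} {Q Q' : α → Prop} {δ : ℝ} (h : FailLE f ν p Q δ)
    (h' : Always f p Q') : FailLE f ν p (fun a => Q a ∧ Q' a) δ := by
  classical
  refine (wp_mono_of_always (h'.mono fun a ha => ?_)).trans h
  by_cases hq : Q a <;> simp [ha, hq]

lemma FailLE.and {p : Prog α} {Q Q' : α → Prop} {δ δ' : ℝ} (h : FailLE f ν p Q δ)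
    (h' : FailLE f ν p Q' δ') (hδ : 0 ≤ δ) (hδ' : 0 ≤ δ') :
    FailLE f ν p (fun a => Q a ∧ Q' a) (δ + δ') := by
  classical
  refine (wp_mono (ψ := fun a => (if Q a then 0 else 1) + (if Q' a then 0 else 1))
    fun a => ?_).trans ((wp_add_le _ _ _).trans ?_)
  · by_cases ha : Q a <;> by_cases ha' : Q' a <;> simp [ha, ha']
  · rw [ENNReal.ofReal_add hδ hδ']
    exact add_le_add h h'

variable [IsProbabilityMeasure ν]

lemma failLE_one (p : Prog α) (Q : α → Prop) {δ : ℝ} (hδ : 1 ≤ δ) : FailLE f ν p Q δ := by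
  refine (wp_mono (ψ := fun _ => 1) fun a => ?_).trans ?_
  · split_ifs <;> simp
  · rw [wp_const]; simpa using hδ

lemma Always.failLE {p : Prog α} {Q : α → Prop} (h : Always f p Q) : FailLE f ν p Q 0 := by
  refine (wp_mono_of_always (ψ := fun _ => 0) (h.mono fun a ha => by simp [ha])).trans ?_
  rw [wp_const]; simp

/-- The union bound along a composition. The second bound is required for every intermediate value
satisfying `R`, which amounts to conditioning on the past. -/
lemma FailLE.bind {p : Prog α} {q : α → Prog β} {R : α → Prop} {Q : β → Prop} {δ δ' : ℝ}
    (hp : FailLE f ν p R δ) (hq : ∀ a, R a → FailLE f ν (q a) Q δ') (hδ : 0 ≤ δ) (hδ' : 0 ≤ δ') :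
    FailLE f ν (p.bind q) Q (δ + δ') := by
  classical
  unfold FailLE
  rw [wp_bind]
  refine (wp_mono (ψ := fun a => (if R a then 0 else 1) + ENNReal.ofReal δ')
    fun a => ?_).trans ((wp_add_le _ _ _).trans ?_)
  · by_cases ha : R a
    · simp only [ha, if_true, zero_add]
      exact hq a ha
    · simp only [ha, if_false]
      refine le_trans ?_ le_self_add
      refine (wp_mono (ψ := fun _ => 1) fun a => ?_).trans (wp_const _ _).le
      split_ifs <;> simp
  · rw [ENNReal.ofReal_add hδ hδ', wp_const]
    exact add_le_add hp le_rfl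

/-- `Forall₂` keeps each result attached to its input, so intervals and their estimates can be
matched later. -/
lemma failLE_forEach {p : β → Prog α} {R : β → α → Prop} {δ : β → ℝ} (hδ : ∀ b, 0 ≤ δ b)
    (l : List β) (h : ∀ b ∈ l, FailLE f ν (p b) (R b) (δ b)) :
    FailLE f ν (forEach l p) (List.Forall₂ R l) (l.map δ).sum := by
  have hs : ∀ l : List β, 0 ≤ (l.map δ).sum := fun l => List.sum_nonneg (by simpa using fun b _ => hδ b)
  induction l with
  | nil => exact failLE_ret List.Forall₂.nil _
  | cons b l ih =>
    rw [List.map_cons, List.sum_cons]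
    refine (h b (by simp)).bind (fun a ha => ?_) (hδ b) (hs l)
    have := (ih fun b hb => h b (by simp [hb])).bind (q := fun as => ret (a :: as))
      (Q := List.Forall₂ R (b :: l)) (δ' := 0)
      (fun as has => failLE_ret (List.Forall₂.cons ha has) _) (hs l) le_rfl
    rwa [add_zero] at this

lemma failLE_forFold_range {p : ℕ → α → Prog α} {Inv : ℕ → α → Prop} {δ : ℝ} (hδ : 0 ≤ δ)
    (n : ℕ) (s : α) (h0 : Inv 0 s)
    (h : ∀ j < n, ∀ s, Inv j s → FailLE f ν (p j s) (Inv (j + 1)) δ) :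
    FailLE f ν (forFold (List.range n) s p) (Inv n) (n * δ) := by
  have key : ∀ (k j : ℕ) (s : α), j + k = n → Inv j s →
      FailLE f ν (forFold (List.range' j k) s p) (Inv n) (k * δ) := by
    intro k
    induction k with
    | zero => rintro j s rfl hs; exact failLE_ret hs _
    | succ k ih =>
      intro j s hj hs
      have := (h j (by omega) s hs).bind (q := fun s' => forFold (List.range' (j + 1) k) s' p)
        (fun a ha => ih (j + 1) a (by omega) ha) hδ (by positivity)
      refine FailLE.mono this (fun _ h => h) (by push_cast; linarith)
  rw [List.range_eq_range']
  exact key n 0 s (by omega) h0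

lemma always_forFold_range {p : ℕ → α → Prog α} {Inv : ℕ → α → Prop} (n : ℕ) (s : α) (h0 : Inv 0 s)
    (h : ∀ j < n, ∀ s, Inv j s → Always f (p j s) (Inv (j + 1))) :
    Always f (forFold (List.range n) s p) (Inv n) := by
  have key : ∀ (k j : ℕ) (s : α), j + k = n → Inv j s →
      Always f (forFold (List.range' j k) s p) (Inv n) := by
    intro k
    induction k with
    | zero => rintro j s rfl hs; exact hs
    | succ k ih =>
      intro j s hj hs
      exact always_bind.2 ((h j (by omega) s hs).mono fun a ha => ih (j + 1) a (by omega) ha)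
  rw [List.range_eq_range']
  exact key n 0 s (by omega) h0

end wp

/-! ### Concentration of empirical means -/

/-- The noise law is a probability measure with the moment generating function of a `1`-sub-Gaussian
variable. -/
structure SubGaussianLaw (ν : Measure ℝ) : Prop where
  prob : IsProbabilityMeasure ν
  lintegral_exp_le : ∀ u : ℝ,
    ∫⁻ e, ENNReal.ofReal (Real.exp (u * e)) ∂ν ≤ ENNReal.ofReal (Real.exp (u ^ 2 / 2))

section concentration

variable {f : ℝ → ℝ} {ν : Measure ℝ}

/-- Each query contributes an independent factor at most exp(u²/2), pulled out of the nested upper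
integrals by the scaling inequality. -/
lemma wp_sampleSum_exp_le (hν : SubGaussianLaw ν) (x u : ℝ) (n : ℕ) :
    wp f ν (sampleSum x n) (fun s => ENNReal.ofReal (Real.exp (u * (s - n * f x)))) ≤
      ENNReal.ofReal (Real.exp (n * (u ^ 2 / 2))) := by
  induction n with
  | zero => simp [sampleSum, pure_def, wp]
  | succ n ih =>
    have : sampleSum x (n + 1) = query x fun y => (sampleSum x n).bind fun s => ret (y + s) := rfl
    rw [this, wp]
    have h1 : ∀ e, wp f ν ((sampleSum x n).bind fun s => ret (f x + e + s))
        (fun s => ENNReal.ofReal (Real.exp (u * (s - (n + 1 : ℕ) * f x)))) ≤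
        ENNReal.ofReal (Real.exp (n * (u ^ 2 / 2))) * ENNReal.ofReal (Real.exp (u * e)) := by
      intro e
      rw [wp_bind]
      have h2 : ∀ s, wp f ν (ret (f x + e + s))
          (fun s => ENNReal.ofReal (Real.exp (u * (s - (n + 1 : ℕ) * f x)))) =
          ENNReal.ofReal (Real.exp (u * e)) * ENNReal.ofReal (Real.exp (u * (s - n * f x))) := by
        intro s
        rw [wp, ← ENNReal.ofReal_mul (Real.exp_nonneg _), ← Real.exp_add]
        congr 2; push_cast; ring
      simp only [h2]
      refine (wp_const_mul_le _ ENNReal.ofReal_ne_top _).trans ?_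
      rw [mul_comm]
      exact mul_le_mul_left ih _
    refine (upperLIntegral_mono h1).trans ?_
    refine (upperLIntegral_const_mul_le ENNReal.ofReal_ne_top).trans ?_
    refine (mul_le_mul_right ((upperLIntegral_le_lintegral (by fun_prop)).trans
      (hν.lintegral_exp_le u)) _).trans ?_
    rw [← ENNReal.ofReal_mul (Real.exp_nonneg _), ← Real.exp_add]
    apply ENNReal.ofReal_le_ofReal
    apply le_of_eq; congr 1; push_cast; ring

lemma wp_sampleMean_exp_le (hν : SubGaussianLaw ν) (x u : ℝ) {n : ℕ} (hn : 0 < n) :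
    wp f ν (sampleMean x n) (fun y => ENNReal.ofReal (Real.exp (u * (y - f x)))) ≤
      ENNReal.ofReal (Real.exp (u ^ 2 / (2 * n))) := by
  have hn' : (n : ℝ) ≠ 0 := by positivity
  have h := wp_sampleSum_exp_le (f := f) hν x (u / n) n
  have e1 : (n : ℝ) * ((u / n) ^ 2 / 2) = u ^ 2 / (2 * n) := by field_simp
  rw [e1] at h
  refine le_trans (le_of_eq ?_) h
  have : sampleMean x n = (sampleSum x n).bind fun s => ret (s / n) := rfl
  rw [this, wp_bind]
  simp only [wp]
  congr 1; funext s; congr 2; field_simp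

/-- Chernoff bound for the two tails of a statistic. -/
lemma failLE_of_exp_le (hν : SubGaussianLaw ν) {p : Prog α} {Z : α → ℝ} {v r : ℝ} (hv : 0 < v)
    (hr : 0 ≤ r)
    (h : ∀ u : ℝ, wp f ν p (fun a => ENNReal.ofReal (Real.exp (u * Z a))) ≤
      ENNReal.ofReal (Real.exp (u ^ 2 * v / 2))) :
    FailLE f ν p (fun a => |Z a| ≤ r) (2 * Real.exp (-r ^ 2 / (2 * v))) := by
  have := hν.prob
  have tail : ∀ σ : ℝ, σ ^ 2 = 1 →
      FailLE f ν p (fun a => σ * Z a ≤ r) (Real.exp (-r ^ 2 / (2 * v))) := by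
    intro σ hσ
    -- The optimal Chernoff parameter r/v, with the sign σ selecting the tail.
    have h' := h (σ * (r / v))
    refine (wp_mono (ψ := fun a => ENNReal.ofReal (Real.exp (-(r / v * r))) *
      ENNReal.ofReal (Real.exp (σ * (r / v) * Z a))) fun a => ?_).trans
      ((wp_const_mul_le _ ENNReal.ofReal_ne_top _).trans ?_)
    · split_ifs with ha
      · simp
      · rw [← ENNReal.ofReal_mul (Real.exp_nonneg _), ← Real.exp_add, ← ENNReal.ofReal_one]
        apply ENNReal.ofReal_le_ofReal
        apply Real.one_le_exp
        push Not at ha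
        have : r / v * r ≤ r / v * (σ * Z a) := mul_le_mul_of_nonneg_left ha.le (by positivity)
        nlinarith
    · refine (mul_le_mul_right h' _).trans ?_
      rw [← ENNReal.ofReal_mul (Real.exp_nonneg _), ← Real.exp_add]
      apply ENNReal.ofReal_le_ofReal
      apply le_of_eq; congr 1
      rw [mul_pow, hσ]; field_simp; ring
  have := (tail 1 (by norm_num)).and (tail (-1) (by norm_num)) (Real.exp_nonneg _)
    (Real.exp_nonneg _)
  refine this.mono (fun a ha => abs_le.2 ⟨by linarith [ha.2], by linarith [ha.1]⟩) (by linarith)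

lemma failLE_sampleMean (hν : SubGaussianLaw ν) (x : ℝ) (n : ℕ) {r : ℝ} (hr : 0 ≤ r) :
    FailLE f ν (sampleMean x n) (fun y => |y - f x| ≤ r) (2 * Real.exp (-(n * r ^ 2 / 2))) := by
  have := hν.prob
  -- Without samples the claimed failure bound equals 2 and says nothing.
  rcases Nat.eq_zero_or_pos n with rfl | hn
  · exact failLE_one _ _ (by simp)
  have hn' : (0 : ℝ) < n := by exact_mod_cast hn
  refine (failLE_of_exp_le hν (v := 1 / n) (by positivity) hr fun u => ?_).mono (fun _ h => h)
    (le_of_eq ?_)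
  · refine (wp_sampleMean_exp_le hν x u hn).trans (le_of_eq ?_)
    congr 2; field_simp
  · congr 2; field_simp

/-- The difference of two independent means is sub-Gaussian with variance proxy 2/n. Treating it
directly, rather than bounding each mean, gives the exponent n r²/4 to which the thresholds of
`estimateRounds` and `verifyCP` are tuned. -/
lemma failLE_sampleMean_pair (hν : SubGaussianLaw ν) (xl xr : ℝ) (n : ℕ) {r : ℝ} (hr : 0 ≤ r)
    {g : ℝ → ℝ → α} {Q : α → Prop} (hQ : ∀ yl yr, |(yr - yl) - (f xr - f xl)| ≤ r → Q (g yl yr)) :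
    FailLE f ν ((sampleMean xl n).bind fun yl => (sampleMean xr n).bind fun yr => ret (g yl yr)) Q
      (2 * Real.exp (-(n * r ^ 2 / 4))) := by
  have := hν.prob
  rcases Nat.eq_zero_or_pos n with rfl | hn
  · exact failLE_one _ _ (by simp)
  have hn' : (0 : ℝ) < n := by exact_mod_cast hn
  have key : FailLE f ν ((sampleMean xl n).bind fun yl => (sampleMean xr n).bind fun yr =>
      ret (yl, yr)) (fun y => |(y.2 - y.1) - (f xr - f xl)| ≤ r)
      (2 * Real.exp (-(n * r ^ 2 / 4))) := by
    refine (failLE_of_exp_le hν (v := 2 / n) (by positivity) hr fun u => ?_).mono (fun _ h => h)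
      (le_of_eq ?_)
    · simp only [wp_bind, wp]
      have h1 : ∀ yl, wp f ν (sampleMean xr n)
          (fun yr => ENNReal.ofReal (Real.exp (u * ((yr - yl) - (f xr - f xl))))) ≤
          ENNReal.ofReal (Real.exp (u ^ 2 / (2 * n))) *
            ENNReal.ofReal (Real.exp ((-u) * (yl - f xl))) := by
        intro yl
        have h2 : ∀ yr, ENNReal.ofReal (Real.exp (u * ((yr - yl) - (f xr - f xl)))) =
            ENNReal.ofReal (Real.exp ((-u) * (yl - f xl))) *
              ENNReal.ofReal (Real.exp (u * (yr - f xr))) := by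
          intro yr
          rw [← ENNReal.ofReal_mul (Real.exp_nonneg _), ← Real.exp_add]
          congr 2; ring
        simp only [h2]
        refine (wp_const_mul_le _ ENNReal.ofReal_ne_top _).trans ?_
        rw [mul_comm]
        exact mul_le_mul_left (wp_sampleMean_exp_le hν xr u hn) _
      refine (wp_mono h1).trans ((wp_const_mul_le _ ENNReal.ofReal_ne_top _).trans ?_)
      refine (mul_le_mul_right (wp_sampleMean_exp_le hν xl (-u) hn) _).trans ?_
      rw [← ENNReal.ofReal_mul (Real.exp_nonneg _), ← Real.exp_add]
      apply ENNReal.ofReal_le_ofReal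
      apply le_of_eq; congr 1; field_simp; ring
    · congr 2; field_simp; ring
  unfold FailLE at key ⊢
  simp only [wp_bind, wp] at key ⊢
  refine le_trans (wp_mono fun yl => wp_mono fun yr => ?_) key
  by_cases h : |(yr - yl) - (f xr - f xl)| ≤ r
  · simp [h, hQ yl yr h]
  · simp only [h, if_false]; split_ifs <;> simp

end concentration

end Prog

end ChangePoint

namespace ChangePoint

/-! ### Measurability of functions of lists -/

section lists

variable {X Y γ β D : Type} [MeasurableSpace X] [MeasurableSpace Y] [MeasurableSpace γ]
  [MeasurableSpace β] [MeasurableSpace D]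

/-- The disjoint union of the product `σ`-algebras on lists of given length. -/
instance instMeasurableSpaceList : MeasurableSpace (List γ) :=
  ⨅ n : ℕ, MeasurableSpace.map (List.ofFn : (Fin n → γ) → List γ) inferInstance

lemma measurableSet_list_iff {s : Set (List γ)} :
    MeasurableSet s ↔ ∀ n : ℕ, MeasurableSet ((List.ofFn : (Fin n → γ) → List γ) ⁻¹' s) :=
  MeasurableSpace.measurableSet_iInf

lemma measurable_ofFn (n : ℕ) : Measurable (List.ofFn : (Fin n → γ) → List γ) :=
  fun _ hs => measurableSet_list_iff.1 hs n

lemma measurableEmbedding_ofFn (n : ℕ) :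
    MeasurableEmbedding (List.ofFn : (Fin n → γ) → List γ) where
  injective := List.ofFn_injective
  measurable := measurable_ofFn n
  measurableSet_image' := by
    intro s hs
    rw [measurableSet_list_iff]
    intro k
    rcases eq_or_ne k n with rfl | hk
    · rwa [Set.preimage_image_eq _ List.ofFn_injective]
    · convert MeasurableSet.empty
      ext v
      simp only [Set.mem_preimage, Set.mem_image, Set.mem_empty_iff_false, iff_false]
      rintro ⟨w, -, hw⟩
      have := congrArg List.length hw
      simp at this
      exact hk this.symm

instance [MeasurableSingletonClass γ] : MeasurableSingletonClass (List γ) where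
  measurableSet_singleton _ := measurableSet_list_iff.2 fun _ =>
    Set.Subsingleton.measurableSet fun _ hv _ hw => List.ofFn_injective (hv.trans hw.symm)

/-- Lists of a given length form a measurable copy of a power of γ, and there are countably many
lengths. So measurability in a list, jointly with a parameter, can be checked length by length. -/
lemma measurable_prod_list {F : X × List γ → β}
    (h : ∀ n, Measurable fun z : X × (Fin n → γ) => F (z.1, List.ofFn z.2)) : Measurable F := by
  intro s hs
  have : F ⁻¹' s = ⋃ n : ℕ, Prod.map (id : X → X) (List.ofFn : (Fin n → γ) → List γ) ''
      ((fun z : X × (Fin n → γ) => F (z.1, List.ofFn z.2)) ⁻¹' s) := by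
    ext ⟨x, l⟩
    simp only [Set.mem_preimage, Set.mem_iUnion, Set.mem_image, Prod.exists, Prod.map_apply, id,
      Prod.mk.injEq]
    constructor
    · intro hx
      exact ⟨l.length, x, fun i => l.get i, by simpa using hx, rfl, by simp⟩
    · rintro ⟨n, y, v, hv, rfl, rfl⟩
      exact hv
  rw [this]
  exact MeasurableSet.iUnion fun n => (MeasurableEmbedding.id.prodMap
    (measurableEmbedding_ofFn n)).measurableSet_image.2 (h n hs)

lemma measurable_list_cases {F : X × List γ → β} (hnil : Measurable fun x => F (x, []))
    (hcons : Measurable fun z : X × γ × List γ => F (z.1, z.2.1 :: z.2.2)) : Measurable F := by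
  refine measurable_prod_list fun n => ?_
  cases n with
  | zero => simpa [Function.comp_def] using hnil.comp measurable_fst
  | succ n =>
    have : Measurable fun z : X × (Fin (n + 1) → γ) =>
        (z.1, z.2 0, List.ofFn fun i : Fin n => z.2 i.succ) :=
      measurable_fst.prodMk (((measurable_pi_apply 0).comp measurable_snd).prodMk
        ((measurable_ofFn n).comp (by fun_prop)))
    simpa [List.ofFn_succ, Function.comp_def] using hcons.comp this

/-- Functions defined by primitive recursion on lists are measurable. -/
lemma measurable_list_rec {F : X → List γ → β} {G : X × γ × List γ × β → β}
    (hnil : Measurable fun x => F x []) (hG : Measurable G)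
    (hcons : ∀ x a l, F x (a :: l) = G (x, a, l, F x l)) :
    Measurable fun z : X × List γ => F z.1 z.2 := by
  refine measurable_prod_list fun n => ?_
  induction n with
  | zero => simpa [Function.comp_def] using hnil.comp measurable_fst
  | succ n ih =>
    simp only [List.ofFn_succ, hcons]
    refine hG.comp (measurable_fst.prodMk (((measurable_pi_apply 0).comp measurable_snd).prodMk
      (((measurable_ofFn n).comp (by fun_prop)).prodMk ?_)))
    have : Measurable fun z : X × (Fin (n + 1) → γ) => (z.1, fun i : Fin n => z.2 i.succ) := by
      fun_prop
    exact ih.comp this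

lemma measurable_list_cons : Measurable fun z : γ × List γ => z.1 :: z.2 := by
  refine measurable_prod_list fun n => ?_
  have : (fun z : γ × (Fin n → γ) => z.1 :: List.ofFn z.2) =
      List.ofFn ∘ fun z : γ × (Fin n → γ) => (Fin.cons z.1 z.2 : Fin (n + 1) → γ) := by
    funext z; simp [List.ofFn_succ]
  rw [this]
  refine (measurable_ofFn _).comp (measurable_pi_iff.2 fun i => ?_)
  refine Fin.cases ?_ (fun i => ?_) i
  · simpa using measurable_fst
  · simpa [Function.comp_def] using (measurable_pi_apply i).comp measurable_snd

lemma Measurable.list_cons {a : X → γ} {l : X → List γ} (ha : Measurable a) (hl : Measurable l) :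
    Measurable fun x => a x :: l x := measurable_list_cons.comp (ha.prodMk hl)

lemma Measurable.list_append {l l' : X → List γ} (hl : Measurable l) (hl' : Measurable l') :
    Measurable fun x => l x ++ l' x := by
  have : Measurable fun z : List γ × List γ => z.2 ++ z.1 :=
    measurable_list_rec (F := fun b l => l ++ b) (G := fun z => z.2.1 :: z.2.2.2)
      measurable_id (by exact Measurable.list_cons (by fun_prop) (by fun_prop)) fun _ _ _ => rfl
  exact this.comp (hl'.prodMk hl)

lemma Measurable.list_map {g : X → γ → β} {l : X → List γ}
    (hg : Measurable fun z : X × γ => g z.1 z.2) (hl : Measurable l) :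
    Measurable fun x => (l x).map (g x) := by
  have : Measurable fun z : X × List γ => z.2.map (g z.1) :=
    measurable_list_rec (F := fun x l => l.map (g x)) (G := fun z => g z.1 z.2.1 :: z.2.2.2)
      (by simp) (Measurable.list_cons (hg.comp (by fun_prop :
        Measurable fun z : X × γ × List γ × List β => (z.1, z.2.1))) (by fun_prop)) fun _ _ _ => rfl
  exact this.comp (measurable_id.prodMk hl)

lemma Measurable.list_filter {P : X → γ → Bool} {l : X → List γ}
    (hP : Measurable fun z : X × γ => P z.1 z.2) (hl : Measurable l) :
    Measurable fun x => (l x).filter (P x) := by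
  have : Measurable fun z : X × List γ => z.2.filter (P z.1) :=
    measurable_list_rec (F := fun x l => l.filter (P x))
      (G := fun z => if P z.1 z.2.1 = true then z.2.1 :: z.2.2.2 else z.2.2.2)
      (by simp) (Measurable.ite (hP.comp (by fun_prop :
          Measurable fun z : X × γ × List γ × List γ => (z.1, z.2.1)) (measurableSet_singleton true))
        (Measurable.list_cons (by fun_prop) (by fun_prop)) (by fun_prop))
      fun _ _ _ => List.filter_cons
  exact this.comp (measurable_id.prodMk hl)

lemma measurable_list_length : Measurable (List.length : List γ → ℕ) := by
  have : Measurable fun z : Unit × List γ => z.2.length :=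
    measurable_list_rec (F := fun _ l => l.length) (G := fun z => z.2.2.2 + 1)
      (by simp) (by fun_prop) fun _ _ _ => rfl
  exact this.comp (measurable_const.prodMk measurable_id : Measurable fun l : List γ => ((), l))

lemma measurable_list_sum : Measurable (List.sum : List ℝ → ℝ) := by
  have : Measurable fun z : Unit × List ℝ => z.2.sum :=
    measurable_list_rec (F := fun _ l => l.sum) (G := fun z => z.2.1 + z.2.2.2)
      (by simp) (by fun_prop) fun _ _ _ => List.sum_cons
  exact this.comp (measurable_const.prodMk measurable_id : Measurable fun l : List ℝ => ((), l))

lemma measurable_list_getD (i : ℕ) (d : γ) : Measurable fun l : List γ => l.getD i d := by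
  have : Measurable fun z : Unit × List γ => z.2.getD i d := by
    induction i with
    | zero => exact measurable_list_cases (by simp) (by simpa using by fun_prop)
    | succ i ih =>
      refine measurable_list_cases (by simp) ?_
      simpa [Function.comp_def] using ih.comp (by fun_prop : Measurable fun z : Unit × γ × List γ => (z.1, z.2.2))
  exact this.comp (measurable_const.prodMk measurable_id : Measurable fun l : List γ => ((), l))

lemma measurable_list_take (n : ℕ) : Measurable fun l : List γ => l.take n := by
  have : Measurable fun z : Unit × List γ => z.2.take n := by
    induction n with
    | zero => simp
    | succ n ih =>
      refine measurable_list_cases (by simp) ?_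
      simpa using Measurable.list_cons (by fun_prop)
        (ih.comp (by fun_prop : Measurable fun z : Unit × γ × List γ => (z.1, z.2.2)))
  exact this.comp (measurable_const.prodMk measurable_id : Measurable fun l : List γ => ((), l))

lemma measurable_list_insertionSort {r : γ → γ → Prop} [DecidableRel r]
    (hr : MeasurableSet {z : γ × γ | r z.1 z.2}) :
    Measurable fun l : List γ => l.insertionSort r := by
  have hins : Measurable fun z : γ × List γ => z.2.orderedInsert r z.1 :=
    measurable_list_rec (F := fun a l => l.orderedInsert r a)
      (G := fun z => if r z.1 z.2.1 then z.1 :: z.2.1 :: z.2.2.1 else z.2.1 :: z.2.2.2)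
      (by exact Measurable.list_cons measurable_id measurable_const)
      (Measurable.ite (measurableSet_preimage (by fun_prop :
          Measurable fun z : γ × γ × List γ × List γ => (z.1, z.2.1)) hr)
        (Measurable.list_cons (by fun_prop) (Measurable.list_cons (by fun_prop) (by fun_prop)))
        (Measurable.list_cons (by fun_prop) (by fun_prop)))
      fun _ _ _ => rfl
  have : Measurable fun z : Unit × List γ => z.2.insertionSort r :=
    measurable_list_rec (F := fun _ l => l.insertionSort r)
      (G := fun z => z.2.2.2.orderedInsert r z.2.1)
      (by simp) (hins.comp (by fun_prop :
        Measurable fun z : Unit × γ × List γ × List γ => (z.2.1, z.2.2.2))) fun _ _ _ => rfl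
  exact this.comp (measurable_const.prodMk measurable_id : Measurable fun l : List γ => ((), l))

lemma measurable_list_all {P : γ → Bool} (hP : Measurable P) :
    Measurable fun l : List γ => l.all P := by
  have : Measurable fun z : Unit × List γ => z.2.all P :=
    measurable_list_rec (F := fun _ l => l.all P) (G := fun z => P z.2.1 && z.2.2.2)
      (by simp) ((measurable_of_countable fun b : Bool × Bool => b.1 && b.2).comp
        ((hP.comp (by fun_prop)).prodMk (by fun_prop))) fun _ _ _ => List.all_cons
  exact this.comp (measurable_const.prodMk measurable_id : Measurable fun l : List γ => ((), l))

/-- Measurability may be checked after fixing a parameter with countably many values. -/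
lemma measurable_of_countable_param [Countable D] [MeasurableSingletonClass D] {F : D → X → β}
    {g : X → D} (hg : Measurable g) (h : ∀ d, Measurable (F d)) : Measurable fun x => F (g x) x := by
  have : Measurable fun z : X × D => F z.2 z.1 := measurable_from_prod_countable_left h
  exact this.comp (measurable_id.prodMk hg)

end lists

/-- The `σ`-algebra of the disjoint union with a point. -/
instance instMeasurableSpaceOption {γ : Type} [MeasurableSpace γ] : MeasurableSpace (Option γ) :=
  MeasurableSpace.comap (Equiv.optionEquivSumPUnit.{0} γ) inferInstance

lemma measurable_some {γ : Type} [MeasurableSpace γ] : Measurable (some : γ → Option γ) :=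
  measurable_comap_iff.2 (by simpa [Function.comp_def] using measurable_inl)

lemma measurable_optionElim {γ β : Type} [MeasurableSpace γ] [MeasurableSpace β] {b : β}
    {g : γ → β} (hg : Measurable g) : Measurable fun o : Option γ => o.elim b g := by
  have h1 : Measurable (Equiv.optionEquivSumPUnit.{0} γ) := comap_measurable _
  have h2 : Measurable (Sum.elim g fun _ : PUnit => b) := Measurable.sumElim hg measurable_const
  convert h2.comp h1 using 1
  funext o; cases o <;> simp

namespace Prog

/-! ### Measurability of programs -/

section Meas

variable {X Y α β γ D : Type} [MeasurableSpace X] [MeasurableSpace Y] [MeasurableSpace α]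
  [MeasurableSpace β] [MeasurableSpace γ] [MeasurableSpace D] {f : ℝ → ℝ}

/-- The outcome of a family of programs depends measurably on its parameter and on the noise. -/
def Meas (f : ℝ → ℝ) (p : X → Prog α) : Prop :=
  ∀ t, Measurable fun z : X × (ℕ → ℝ) => run f z.2 (p z.1) t

lemma meas_ret {g : X → α} (hg : Measurable g) : Meas f fun x => ret (g x) := fun t => by
  simpa [run] using (hg.comp measurable_fst).prodMk measurable_const

lemma Meas.comp {p : X → Prog α} (hp : Meas f p) {g : Y → X} (hg : Measurable g) :
    Meas f fun y => p (g y) := fun t =>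
  (hp t).comp ((hg.comp measurable_fst).prodMk measurable_snd)

lemma Meas.bind {p : X → Prog α} {q : X → α → Prog β} (hp : Meas f p)
    (hq : Meas f fun z : X × α => q z.1 z.2) : Meas f fun x => (p x).bind (q x) := fun t => by
  -- The time at which `q` starts is random but takes countably many values, so it may be frozen.
  simp only [run_bind]
  exact measurable_of_countable_param (X := X × (ℕ → ℝ))
    (F := fun (t' : ℕ) z => run f z.2 (q z.1 (run f z.2 (p z.1) t).1) t')
    (g := fun z => (run f z.2 (p z.1) t).2) ((hp t).snd)
    fun t' => (hq t').comp ((measurable_fst.prodMk (hp t).fst).prodMk measurable_snd)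

lemma Meas.ite {P : X → Prop} [DecidablePred P] {p q : X → Prog α} (hP : MeasurableSet {x | P x})
    (hp : Meas f p) (hq : Meas f q) : Meas f fun x => if P x then p x else q x := fun t => by
  have : (fun z : X × (ℕ → ℝ) => run f z.2 (if P z.1 then p z.1 else q z.1) t) =
      fun z => if P z.1 then run f z.2 (p z.1) t else run f z.2 (q z.1) t := by
    funext z; split_ifs <;> rfl
  rw [this]
  exact Measurable.ite (measurableSet_preimage measurable_fst hP) (hp t) (hq t)

lemma meas_of_countable_param [Countable D] [MeasurableSingletonClass D] {p : D → X → Prog α}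
    {g : X → D} (hg : Measurable g) (h : ∀ d, Meas f (p d)) : Meas f fun x => p (g x) x := fun t =>
  measurable_of_countable_param (X := X × (ℕ → ℝ)) (F := fun d z => run f z.2 (p d z.1) t)
    (hg.comp measurable_fst) fun d => h d t

lemma meas_query (hf : Measurable f) {g : X → ℝ} (hg : Measurable g) :
    Meas f fun x => query (g x) ret := fun t => by
  simp only [run]
  exact ((hf.comp (hg.comp measurable_fst)).add
    ((measurable_pi_apply t).comp measurable_snd)).prodMk measurable_const

lemma meas_sampleSum (hf : Measurable f) {g : X → ℝ} (hg : Measurable g) (n : ℕ) :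
    Meas f fun x => sampleSum (g x) n := by
  induction n generalizing X with
  | zero => exact meas_ret measurable_const
  | succ n ih =>
    exact (meas_query hf hg).bind ((ih (hg.comp measurable_fst)).bind
      (meas_ret (by fun_prop)))

lemma meas_sampleMean (hf : Measurable f) {g : X → ℝ} (hg : Measurable g) (n : ℕ) :
    Meas f fun x => sampleMean (g x) n :=
  (meas_sampleSum hf hg n).bind (meas_ret (by fun_prop))

lemma Meas.of_list {p : X × List γ → Prog α}
    (h : ∀ n, Meas f fun z : X × (Fin n → γ) => p (z.1, List.ofFn z.2)) : Meas f p := fun t => by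
  have : Measurable fun z : (X × (ℕ → ℝ)) × List γ => run f z.1.2 (p (z.1.1, z.2)) t := by
    refine measurable_prod_list fun n => ?_
    exact (h n t).comp (by fun_prop : Measurable fun z : (X × (ℕ → ℝ)) × (Fin n → γ) =>
      ((z.1.1, z.2), z.1.2))
  exact this.comp (by fun_prop : Measurable fun z : (X × List γ) × (ℕ → ℝ) =>
    ((z.1.1, z.2), z.1.2))

lemma meas_forEach {p : X → γ → Prog α} (hp : Meas f fun z : X × γ => p z.1 z.2)
    {l : X → List γ} (hl : Measurable l) : Meas f fun x => forEach (l x) (p x) := by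
  have : Meas f fun z : X × List γ => forEach z.2 (p z.1) := by
    refine Meas.of_list fun n => ?_
    induction n with
    | zero => simpa [forEach, pure_def] using meas_ret measurable_const
    | succ n ih =>
      simp only [List.ofFn_succ, forEach, bind_def, pure_def]
      refine (hp.comp (by fun_prop : Measurable fun z : X × (Fin (n + 1) → γ) =>
        (z.1, z.2 0))).bind ?_
      refine (ih.comp (by fun_prop : Measurable fun z : (X × (Fin (n + 1) → γ)) × α =>
        (z.1.1, fun i : Fin n => z.1.2 i.succ))).bind ?_
      exact meas_ret (Measurable.list_cons (by fun_prop) (by fun_prop))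
  exact this.comp (measurable_id.prodMk hl)

lemma meas_forFold {δ : Type} {p : δ → α → Prog α} (hp : ∀ b, Meas f (p b)) (l : List δ) :
    Meas f fun s => forFold l s p := by
  induction l with
  | nil => exact meas_ret measurable_id
  | cons b l ih => exact (hp b).bind (ih.comp measurable_snd)

end Meas

/-! ### Executions with random noise -/

section link

/-- The sequence with first term `z.1` and remaining terms `z.2`. -/
def consSeq (z : ℝ × (ℕ → ℝ)) : ℕ → ℝ
  | 0 => z.1
  | n + 1 => z.2 n

lemma measurable_consSeq : Measurable consSeq := by
  refine measurable_pi_iff.2 fun n => ?_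
  cases n with
  | zero => exact measurable_fst
  | succ n => exact (measurable_pi_apply n).comp measurable_snd

/-- Prepending an independent coordinate of law ν to an i.i.d. sequence of law ν reproduces its law.
This is Fubini for the first query. -/
lemma map_consSeq (ν : Measure ℝ) [IsProbabilityMeasure ν] :
    (ν.prod (Measure.infinitePi fun _ : ℕ => ν)).map consSeq = Measure.infinitePi fun _ => ν := by
  classical
  refine Measure.eq_infinitePi _ fun s t ht => ?_
  obtain ⟨n, hn⟩ : ∃ n, s ⊆ Finset.range (n + 1) :=
    ⟨s.sup id, fun i hi => Finset.mem_range.2 (Nat.lt_succ_of_le (Finset.le_sup (f := id) hi))⟩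
  -- Padding with full factors turns an arbitrary finite cylinder into one over an initial segment
  -- of indices, which is compatible with the shift.
  set t' : ℕ → Set ℝ := fun i => if i ∈ s then t i else Set.univ with ht'
  have mt' : ∀ i, MeasurableSet (t' i) := fun i => by
    simp only [ht']; split_ifs; exacts [ht i, .univ]
  have h1 : Set.pi (s : Set ℕ) t = Set.pi (Finset.range (n + 1) : Set ℕ) t' := by
    ext x
    simp only [Set.mem_pi, Finset.mem_coe, ht']
    refine ⟨fun h i _ => ?_, fun h i hi => by simpa [hi] using h i (hn hi)⟩
    split_ifs with hi
    exacts [h i hi, trivial]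
  have h2 : consSeq ⁻¹' Set.pi (Finset.range (n + 1) : Set ℕ) t' =
      t' 0 ×ˢ Set.pi (Finset.range n : Set ℕ) fun i => t' (i + 1) := by
    ext ⟨e, x⟩
    simp only [Set.mem_preimage, Set.mem_pi, Finset.mem_coe, Finset.mem_range, Set.mem_prod]
    refine ⟨fun h => ⟨h 0 (by omega), fun i hi => h (i + 1) (by omega)⟩, fun h i hi => ?_⟩
    cases i with
    | zero => exact h.1
    | succ i => exact h.2 i (by omega)
  have h3 : ∏ i ∈ s, ν (t i) = ∏ i ∈ Finset.range (n + 1), ν (t' i) := by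
    rw [← Finset.prod_subset hn (f := fun i => ν (t' i))]
    · exact Finset.prod_congr rfl fun i hi => by simp [ht', hi]
    · intro i _ hi; simp [ht', hi]
  rw [h3, h1, Measure.map_apply measurable_consSeq
    (MeasurableSet.pi (Finset.countable_toSet _) fun i _ => mt' i), h2, Measure.prod_prod,
    Measure.infinitePi_pi _ fun i _ => mt' _, Finset.prod_range_succ', mul_comm]

variable {α : Type} [MeasurableSpace α] {f : ℝ → ℝ}

/-- By induction on the tree: split off the first noise variable, apply Fubini, and bound the outer
integral by the upper integral. An inequality is all that is available, and all that is needed. -/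
lemma infinitePi_run_le_wp (ν : Measure ℝ) [IsProbabilityMeasure ν] {p : Prog α}
    (hp : Measurable fun ε : ℕ → ℝ => run f ε p 0) {C : Set α} (hC : MeasurableSet C) :
    Measure.infinitePi (fun _ : ℕ => ν) {ε | (run f ε p 0).1 ∈ C} ≤
      wp f ν p (C.indicator 1) := by
  induction p with
  | ret a =>
    by_cases ha : a ∈ C <;> simp [run, wp, ha]
  | query x next ih =>
    have hrun : ∀ e ε, run f (consSeq (e, ε)) (query x next) 0 =
        ((run f ε (next (f x + e)) 0).1, (run f ε (next (f x + e)) 0).2 + 1) := fun e ε =>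
      run_shift f (consSeq (e, ε)) (next (f x + e)) 0
    have hm1 : Measurable fun z : ℝ × (ℕ → ℝ) => run f (consSeq z) (query x next) 0 :=
      hp.comp measurable_consSeq
    -- The continuation after the answer `y` is recovered from the whole program by freezing the
    -- first noise variable at `y - f x`; the count is then reduced by the first query.
    have hm : ∀ y, Measurable fun ε : ℕ → ℝ => run f ε (next y) 0 := by
      intro y
      have h := hm1.comp (measurable_prodMk_left (x := y - f x))
      simp only [Function.comp_def, hrun, add_sub_cancel] at h
      have h2 : Measurable fun r : α × ℕ => (r.1, r.2 - 1) :=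
        measurable_fst.prodMk ((measurable_of_countable fun n : ℕ => n - 1).comp measurable_snd)
      simpa [Function.comp_def] using h2.comp h
    have hS : MeasurableSet {ε | (run f ε (query x next) 0).1 ∈ C} := hp.fst hC
    rw [← map_consSeq ν, Measure.map_apply measurable_consSeq hS,
      Measure.prod_apply (measurable_consSeq hS), wp]
    refine lintegral_le_upperLIntegral.trans (upperLIntegral_mono fun e => ?_)
    refine le_trans (le_of_eq ?_) (ih (f x + e) (hm _))
    congr 1
    ext ε
    simp only [Set.mem_preimage, Set.mem_ofPred_eq, hrun]

end link

end Prog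

lemma IsNoise.subGaussianLaw {Ω : Type*} [MeasurableSpace Ω] {P : Measure Ω}
    [IsProbabilityMeasure P] {ε : ℕ → Ω → ℝ} (h : IsNoise ε P) :
    Prog.SubGaussianLaw (P.map (ε 0)) where
  prob := Measure.isProbabilityMeasure_map (h.measurable 0).aemeasurable
  lintegral_exp_le u := by
    rw [lintegral_map (by fun_prop) (h.measurable 0),
      ← ofReal_integral_eq_lintegral_ofReal ((h.subgaussian 0).integrable_exp_mul u)
        (Filter.Eventually.of_forall fun _ => (Real.exp_nonneg _))]
    apply ENNReal.ofReal_le_ofReal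
    simpa [mgf] using (h.subgaussian 0).mgf_le u

/-- Independence and identical distribution say that the noise sequence has the product law. This is
the only passage from the environment to `wp`. -/
lemma IsNoise.run_le_wp {Ω : Type*} [MeasurableSpace Ω] {P : Measure Ω}
    [IsProbabilityMeasure P] {ε : ℕ → Ω → ℝ} (h : IsNoise ε P) {α : Type} [MeasurableSpace α]
    {f : ℝ → ℝ} {p : Prog α} (hp : Prog.Meas f fun _ : Unit => p) {C : Set α}
    (hC : MeasurableSet C) :
    P {ω | (Prog.run f (fun t => ε t ω) p 0).1 ∈ C} ≤
      Prog.wp f (P.map (ε 0)) p (C.indicator 1) := by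
  have hp' : Measurable fun ε : ℕ → ℝ => Prog.run f ε p 0 :=
    (hp 0).comp (measurable_prodMk_left (x := ()))
  have hS : MeasurableSet {x : ℕ → ℝ | (Prog.run f x p 0).1 ∈ C} := hp'.fst hC
  have hseq : Measurable fun ω => fun t => ε t ω := measurable_pi_iff.2 h.measurable
  have := h.subGaussianLaw.prob
  have hmap : P.map (fun ω t => ε t ω) = Measure.infinitePi fun _ : ℕ => P.map (ε 0) := by
    rw [h.indep.map_fun_eq_infinitePi_map h.measurable]
    congr 1; funext t; exact (h.ident t).map_eq
  have h2 := Prog.infinitePi_run_le_wp (f := f) (P.map (ε 0)) hp' hC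
  rw [← hmap, Measure.map_apply hseq hS] at h2
  exact h2

end ChangePoint

namespace ChangePoint

open Prog

/-! ### Measurability of the algorithm -/

section measurability

variable {f : ℝ → ℝ} {X : Type} [MeasurableSpace X]

lemma measurable_foldl_update {S : Type} [MeasurableSpace S] [Countable S]
    [MeasurableSingletonClass S] {c : X → ℕ → Prop} [∀ x i, Decidable (c x i)] (upd : ℕ → S → S)
    (hc : ∀ i, MeasurableSet {x | c x i}) (l : List ℕ) {g : X → S} (hg : Measurable g) :
    Measurable fun x => l.foldl (fun s i => if c x i then upd i s else s) (g x) := by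
  induction l generalizing g with
  | nil => exact hg
  | cons i l ih =>
    exact ih (g := fun x => if c x i then upd i (g x) else g x)
      (Measurable.ite (hc i) ((measurable_of_countable (upd i)).comp hg) hg)

lemma measurable_decide {P : X → Prop} [DecidablePred P] (hP : MeasurableSet {x | P x}) :
    Measurable fun x => decide (P x) := by
  have : (fun x => decide (P x)) = fun x => if P x then true else false := by
    funext x; by_cases h : P x <;> simp [h]
  rw [this]
  exact Measurable.ite hP measurable_const measurable_const

/-- Lists of dyadic intervals are countable, so the incoming list can be frozen. Only the threshold
comparisons between real-valued means remain. -/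
lemma meas_detectDepth (hf : Measurable f) (δ : ℝ) (T dmax d : ℕ) :
    Meas f fun L => detectDepth δ T dmax d L := by
  refine meas_of_countable_param (p := fun (L : List Dyadic) (_ : List Dyadic) =>
    detectDepth δ T dmax d L) measurable_id fun L => ?_
  refine Meas.bind (meas_forEach (p := fun (_ : List Dyadic) (i : ℕ) =>
    sampleMean ((i : ℝ) / (2 ^ d : ℕ)) (T / (dmax * (2 ^ d + 1)))) ?_ measurable_const) (meas_ret ?_)
  · exact meas_of_countable_param (X := List Dyadic × ℕ) (p := fun (i : ℕ) _ =>
      sampleMean ((i : ℝ) / (2 ^ d : ℕ)) (T / (dmax * (2 ^ d + 1)))) measurable_snd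
      fun i => meas_sampleMean hf measurable_const _
  · refine measurable_foldl_update (X := List Dyadic × List ℝ) 
      (c := fun z i => 0 < _ ∧ _ < |z.2.getD (i + 1) 0 - z.2.getD i 0|)
      (fun i L => addPruned (d, i) L) (fun i => ?_) _ measurable_const
    have h : ∀ i, Measurable fun z : List Dyadic × List ℝ => z.2.getD i 0 := fun i =>
      (measurable_list_getD i 0).comp measurable_snd
    refine MeasurableSet.inter (MeasurableSet.const _) ?_
    exact measurableSet_lt measurable_const ((h _).sub (h _)).abs

lemma meas_detectIntervals (hf : Measurable f) (δ : ℝ) (T : ℕ) :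
    Meas f fun _ : X => detectIntervals δ T :=
  (meas_forFold (fun d => meas_detectDepth hf δ T _ (d + 1)) _).comp measurable_const

lemma meas_estimateRounds (hf : Measurable f) (δ : ℝ) (T N M fuel k : ℕ) :
    Meas f fun z : ℕ × List Dyadic × List (Dyadic × ℝ) =>
      estimateRounds δ T N M fuel k z.1 z.2.1 z.2.2 := by
  induction fuel generalizing k with
  | zero => exact meas_ret (by fun_prop)
  | succ fuel ih =>
    have hlen : Measurable fun z : ℕ × List Dyadic × List (Dyadic × ℝ) =>
        z.1 + z.2.1.length * 2 ^ k := measurable_fst.add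
          ((measurable_list_length.comp (by fun_prop)).mul measurable_const)
    set thr : ℝ := √((2 : ℝ) ^ (-((k : ℤ) - 5)) * Real.log (Real.pi ^ 2 * M * k ^ 2 / (3 * δ)))
      with hthr
    refine Meas.ite ?_ (Meas.bind (meas_forEach (p := fun (_ : ℕ × List Dyadic ×
        List (Dyadic × ℝ)) (I : Dyadic) => (sampleMean I.left (2 ^ (k - 1))).bind fun yl =>
          (sampleMean I.right (2 ^ (k - 1))).bind fun yr => ret (I, |yr - yl|)) ?_ (by fun_prop)) ?_)
      (meas_ret (by fun_prop))
    · refine MeasurableSet.inter ?_ ?_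
      · exact measurableSet_lt (measurable_list_length.comp (by fun_prop)) measurable_const
      · exact measurableSet_le hlen measurable_const
    · refine meas_of_countable_param (X := (ℕ × List Dyadic × List (Dyadic × ℝ)) × Dyadic)
        (p := fun (I : Dyadic) _ => (sampleMean I.left (2 ^ (k - 1))).bind fun yl =>
          (sampleMean I.right (2 ^ (k - 1))).bind fun yr => ret (I, |yr - yl|))
        measurable_snd fun I => ?_
      refine (meas_sampleMean hf measurable_const _).bind
        ((meas_sampleMean hf measurable_const _).bind (meas_ret ?_))
      fun_prop
    · refine (ih (k + 1)).comp (g := fun z : (ℕ × List Dyadic × List (Dyadic × ℝ)) ×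
        List (Dyadic × ℝ) => (z.1.1 + z.1.2.1.length * 2 ^ k,
          (z.2.filter fun p => p.2 < thr).map Prod.fst, z.1.2.2 ++ z.2.filter fun p => thr ≤ p.2)) ?_
      refine (hlen.comp measurable_fst).prodMk (Measurable.prodMk ?_ ?_)
      · refine Measurable.list_map (g := fun _ (p : Dyadic × ℝ) => p.1) (by fun_prop)
          (Measurable.list_filter (P := fun _ (p : Dyadic × ℝ) => decide (p.2 < thr)) ?_ measurable_snd)
        exact measurable_decide (measurableSet_lt (by fun_prop) measurable_const)
      · refine Measurable.list_append (by fun_prop)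
          (Measurable.list_filter (P := fun _ (p : Dyadic × ℝ) => decide (thr ≤ p.2)) ?_ measurable_snd)
        exact measurable_decide (measurableSet_le measurable_const (by fun_prop))

lemma meas_estimateJumps (hf : Measurable f) (δ : ℝ) (T N : ℕ) :
    Meas f fun L => estimateJumps L δ T N :=
  meas_of_countable_param (p := fun (L : List Dyadic) (_ : List Dyadic) => estimateJumps L δ T N)
    measurable_id fun L =>
      (meas_estimateRounds hf δ T N L.length T 1).comp (g := fun _ => (0, L, [])) measurable_const

lemma meas_shbRound (hf : Measurable f) (l r : ℝ) (τ : ℕ) : Meas f (shbRound l r τ) := by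
  refine (meas_sampleMean hf measurable_const _).bind ((meas_sampleMean hf (by fun_prop) _).bind
    ((meas_sampleMean hf (by fun_prop) _).bind ((meas_sampleMean hf (by fun_prop) _).bind
    ((meas_sampleMean hf measurable_const _).bind ?_))))
  refine Meas.ite (measurableSet_le (by fun_prop) (by fun_prop)) ?_ (Meas.ite
    (measurableSet_le (by fun_prop) (by fun_prop))
    (meas_ret (Measurable.prodMk (by fun_prop) (Measurable.list_cons (by fun_prop) (by fun_prop))))
    (meas_ret (Measurable.prodMk (by fun_prop) (Measurable.list_cons (by fun_prop) (by fun_prop)))))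
  have h : Meas f fun A : (ℝ × ℝ) × List (ℝ × ℝ) => match A.2 with
      | [] => (ret A : Prog ((ℝ × ℝ) × List (ℝ × ℝ)))
      | p :: ps => ret (p, ps) := by
    have : (fun A : (ℝ × ℝ) × List (ℝ × ℝ) => match A.2 with
      | [] => (ret A : Prog ((ℝ × ℝ) × List (ℝ × ℝ)))
      | p :: ps => ret (p, ps)) = fun A => ret (match A.2 with
      | [] => A
      | p :: ps => (p, ps)) := by
      funext A; rcases A with ⟨w, _ | _⟩ <;> rfl
    rw [this]
    refine meas_ret (measurable_list_cases ?_ ?_)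
    · exact measurable_id.prodMk measurable_const
    · exact measurable_snd
  exact h.comp (g := fun z : (((((ℝ × ℝ) × List (ℝ × ℝ)) × ℝ) × ℝ) × ℝ) × ℝ × ℝ => z.1.1.1.1)
    (by fun_prop) |>.comp (g := fun z : ((((((ℝ × ℝ) × List (ℝ × ℝ)) × ℝ) × ℝ) × ℝ) × ℝ) × ℝ =>
      (z.1.1, z.1.2, z.2)) (by fun_prop)

lemma meas_shb (hf : Measurable f) (l r : ℝ) (T : ℕ) (η : ℝ) : Meas f fun _ : X => shb l r T η := by
  unfold shb
  split_ifs
  · exact meas_ret measurable_const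
  · exact ((meas_forFold (fun _ => meas_shbRound hf l r _) _).comp measurable_const).bind
      (meas_ret (by fun_prop))

lemma meas_verifyCP (hf : Measurable f) {xl xr : X → ℝ} (hl : Measurable xl) (hr : Measurable xr)
    (δ : ℝ) (T : ℕ) : Meas f fun x => verifyCP (xl x) (xr x) δ T := by
  refine (meas_sampleMean hf hl _).bind ((meas_sampleMean hf (by fun_prop) _).bind
    (meas_ret ?_))
  refine measurable_decide (P := fun z : (X × ℝ) × ℝ => 2 ≤ T ∧
    √(16 / T * Real.log (2 / δ)) < |z.2 - z.1.2|) (MeasurableSet.inter (MeasurableSet.const _) ?_)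
  exact measurableSet_lt measurable_const
    ((measurable_snd.sub (measurable_snd.comp measurable_fst)).abs)

/-- The localization and verification of one interval in stage `k`. -/
noncomputable def localizeStep (N : ℕ) (δ η : ℝ) (k : ℕ) (W : ℝ) (p : Dyadic × ℝ) :
    Prog (ℝ × Bool) := do
  let Tv : ℕ := max ⌊(p.2 ^ 2)⁻¹ / W * 2 ^ k⌋₊ 1
  let c ← shb p.1.left p.1.right Tv η
  let ok ← verifyCP (max p.1.left (c - η)) (min p.1.right (c + η)) (stageDelta N δ k) Tv
  pure (c, ok)

/-- The `N` accepted intervals with the largest estimated jumps. -/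
noncomputable def selectLargest (N : ℕ) (acc : List (Dyadic × ℝ)) : List (Dyadic × ℝ) :=
  (acc.insertionSort fun p q => q.2 ≤ p.2).take N

/-- The sum of the inverse squared estimated jumps. -/
noncomputable def totalWeight (J : List (Dyadic × ℝ)) : ℝ := (J.map fun p => (p.2 ^ 2)⁻¹).sum

/-- The output of a stage computed from the localized points and the results of their tests. -/
noncomputable def stageOutput (N : ℕ) (res : List (ℝ × Bool)) : Option (Fin N → ℝ) :=
  if res.all Prod.snd then
    some fun v => ((res.map Prod.fst).insertionSort (· ≤ ·)).getD v 0
  else none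

lemma stage_eq (N : ℕ) (δ η δexp : ℝ) (k : ℕ) :
    stage N δ η δexp k = (detectIntervals (δexp / 4) (2 ^ k)).bind fun L =>
      if N ≤ L.length then (estimateJumps L (δexp / 4) (2 ^ k) N).bind fun acc =>
        if N ≤ acc.length then
          (forEach (selectLargest N acc)
            (localizeStep N δ η k (totalWeight (selectLargest N acc)))).bind
              fun res => ret (stageOutput N res)
        else ret none
      else ret none := by
  unfold stage
  simp only [bind_def, pure_def]
  congr 1
  funext L
  split_ifs
  · congr 1
    funext acc
    split_ifs
    · congr 1
      funext res
      unfold stageOutput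
      split_ifs <;> rfl
    · rfl
  · rfl

/-- The interval and its integer budget range over a countable set. Once they are frozen, the loop
length and the sample sizes are constants. -/
lemma meas_localizeStep (hf : Measurable f) (N : ℕ) (δ η : ℝ) (k : ℕ) :
    Meas f fun z : ℝ × (Dyadic × ℝ) => localizeStep N δ η k z.1 z.2 := by
  have h1 : Measurable fun z : ℝ × (Dyadic × ℝ) =>
      max ⌊(z.2.2 ^ 2)⁻¹ / z.1 * 2 ^ k⌋₊ 1 :=
    (Nat.measurable_floor.comp (by fun_prop)).max measurable_const
  refine meas_of_countable_param (D := ℕ × Dyadic) (p := fun D (z : ℝ × (Dyadic × ℝ)) =>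
    (shb D.2.left D.2.right D.1 η).bind fun c =>
      (verifyCP (max D.2.left (c - η)) (min D.2.right (c + η)) (stageDelta N δ k) D.1).bind
        fun ok => ret (c, ok)) (g := fun z => (max ⌊(z.2.2 ^ 2)⁻¹ / z.1 * 2 ^ k⌋₊ 1, z.2.1))
    (h1.prodMk (by fun_prop)) fun D => ?_
  exact (meas_shb hf _ _ _ _).bind ((meas_verifyCP hf (by fun_prop) (by fun_prop) _ _).bind
    (meas_ret (by fun_prop)))

lemma measurable_stageOutput (N : ℕ) : Measurable (stageOutput N) := by
  refine Measurable.ite ?_ (measurable_some.comp (measurable_pi_iff.2 fun v => ?_)) measurable_const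
  · exact measurable_list_all measurable_snd (measurableSet_singleton true)
  · exact (measurable_list_getD _ _).comp ((measurable_list_insertionSort
      (measurableSet_le measurable_fst measurable_snd)).comp
      (Measurable.list_map (X := List (ℝ × Bool)) (g := fun _ p => p.1) (by fun_prop) measurable_id))

lemma measurable_selectLargest (N : ℕ) : Measurable (selectLargest N) :=
  (measurable_list_take N).comp (measurable_list_insertionSort
    (measurableSet_le (by fun_prop) (by fun_prop)))

lemma measurable_totalWeight : Measurable totalWeight :=
  measurable_list_sum.comp (Measurable.list_map (X := List (Dyadic × ℝ))
    (g := fun _ p => (p.2 ^ 2)⁻¹)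
    (by fun_prop) measurable_id)

lemma meas_stage (hf : Measurable f) (N : ℕ) (δ η δexp : ℝ) (k : ℕ) :
    Meas f fun _ : X => stage N δ η δexp k := by
  simp only [stage_eq]
  have hloc : Meas f fun acc : List (Dyadic × ℝ) => (forEach (selectLargest N acc)
      (localizeStep N δ η k (totalWeight (selectLargest N acc)))).bind
        fun res => ret (stageOutput N res) := by
    refine Meas.bind (meas_forEach (p := fun (acc : List (Dyadic × ℝ)) (p : Dyadic × ℝ) =>
      localizeStep N δ η k (totalWeight (selectLargest N acc)) p) ?_ (measurable_selectLargest N))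
      (meas_ret ((measurable_stageOutput N).comp measurable_snd))
    have hg : Measurable fun z : List (Dyadic × ℝ) × (Dyadic × ℝ) =>
        (totalWeight (selectLargest N z.1), z.2) :=
      ((measurable_totalWeight.comp (measurable_selectLargest N)).comp measurable_fst).prodMk
        measurable_snd
    have := (meas_localizeStep hf N δ η k).comp hg
    exact this
  have hest : Meas f fun L : List Dyadic => (estimateJumps L (δexp / 4) (2 ^ k) N).bind fun acc =>
      if N ≤ acc.length then
        (forEach (selectLargest N acc)
          (localizeStep N δ η k (totalWeight (selectLargest N acc)))).bind
            fun res => ret (stageOutput N res)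
      else ret none := by
    have h := Meas.ite (P := fun acc : List (Dyadic × ℝ) => N ≤ acc.length)
      (measurableSet_le measurable_const measurable_list_length) hloc
      (meas_ret (g := fun _ => none) measurable_const)
    exact (meas_estimateJumps hf _ _ _).bind (h.comp measurable_snd)
  have h := Meas.ite (P := fun L : List Dyadic => N ≤ L.length)
    (measurableSet_le measurable_const measurable_list_length) hest
    (meas_ret (g := fun _ => none) measurable_const)
  exact (meas_detectIntervals hf _ _).bind (h.comp measurable_snd)

end measurability

/-! ### The number of queries of a stage -/

section cost

variable {f : ℝ → ℝ}

lemma costLE_detectIntervals (δ : ℝ) (T : ℕ) : CostLE f (detectIntervals δ T) T := by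
  set dmax : ℕ := ⌊Real.logb 2 (T / Real.log (1 / δ))⌋₊
  have h := costLE_forFold (f := f) (p := fun d L => detectDepth δ T dmax (d + 1) L)
    (c := T / dmax) (List.range dmax) [] (fun d _ L => ?_)
  · refine CostLE.mono h ?_
    simpa using Nat.mul_div_le T dmax
  · have h2 : CostLE f (detectDepth δ T dmax (d + 1) L) _ :=
      (costLE_forEach (c := fun _ => T / (dmax * (2 ^ (d + 1) + 1)))
        (List.range (2 ^ (d + 1) + 1)) fun i _ => costLE_sampleMean _ _ _).bind (n' := 0)
        fun y => costLE_ret _ _ _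
    refine h2.mono ?_
    simp only [List.map_const', List.length_range, List.sum_replicate, smul_eq_mul, add_zero]
    rw [← Nat.div_div_eq_div_mul]
    exact Nat.mul_div_le _ _

lemma costLE_estimateRounds (δ : ℝ) (T N M fuel k τ : ℕ) (active : List Dyadic)
    (acc : List (Dyadic × ℝ)) (hk : 1 ≤ k) :
    CostLE f (estimateRounds δ T N M fuel k τ active acc) (T - τ) := by
  induction fuel generalizing k τ active acc with
  | zero => exact costLE_ret _ _ _
  | succ fuel ih =>
    unfold estimateRounds
    split_ifs with h
    · have h2 : 2 ^ k = 2 ^ (k - 1) + 2 ^ (k - 1) := by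
        obtain ⟨j, rfl⟩ : ∃ j, k = j + 1 := ⟨k - 1, by omega⟩
        rw [Nat.add_sub_cancel, pow_succ]; ring
      refine CostLE.mono (CostLE.bind (n := active.length * 2 ^ k)
        (n' := T - (τ + active.length * 2 ^ k)) ?_ fun res => ih _ _ _ _ (by omega)) (by omega)
      have := costLE_forEach (f := f) (p := fun I : Dyadic =>
        (sampleMean I.left (2 ^ (k - 1))).bind fun yl =>
          (sampleMean I.right (2 ^ (k - 1))).bind fun yr => ret (I, |yr - yl|))
        (c := fun _ => 2 ^ k) active fun I _ => ?_
      · simp only [List.map_const', List.sum_replicate, smul_eq_mul] at this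
        exact this
      · exact ((costLE_sampleMean f _ _).bind fun _ => (costLE_sampleMean f _ _).bind (n' := 0)
          fun _ => costLE_ret _ _ _).mono (by omega)
    · exact costLE_ret _ _ _

lemma costLE_shbRound (l r : ℝ) (τ : ℕ) (A : (ℝ × ℝ) × List (ℝ × ℝ)) :
    CostLE f (shbRound l r τ A) (5 * τ) := by
  refine CostLE.mono ((costLE_sampleMean f _ _).bind fun _ => (costLE_sampleMean f _ _).bind
    fun _ => (costLE_sampleMean f _ _).bind fun _ => (costLE_sampleMean f _ _).bind
    fun _ => (costLE_sampleMean f _ _).bind (n' := 0) fun _ => ?_) (by omega)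
  split_ifs
  · cases A.2 <;> exact costLE_ret _ _ _
  · exact costLE_ret _ _ _
  · exact costLE_ret _ _ _

lemma costLE_shb (l r : ℝ) (T : ℕ) (η : ℝ) : CostLE f (shb l r T η) T := by
  unfold shb
  split_ifs
  · exact costLE_ret _ _ _
  · refine CostLE.mono ((costLE_forFold (c := 5 * (T / (5 * ⌈6 * Real.log ((r - l) / η)⌉₊))) _ _
      fun _ _ A => costLE_shbRound _ _ _ A).bind (n' := 0) fun _ => costLE_ret _ _ _) ?_
    simp only [List.length_range, add_zero]
    rw [← mul_assoc, mul_comm _ 5]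
    exact Nat.mul_div_le _ _

lemma costLE_verifyCP (xl xr δ : ℝ) (T : ℕ) : CostLE f (verifyCP xl xr δ T) T :=
  ((costLE_sampleMean f _ _).bind fun _ => (costLE_sampleMean f _ _).bind (n' := 0)
    fun _ => costLE_ret _ _ _).mono (by omega)

lemma costLE_localizeStep (N : ℕ) (δ η : ℝ) (k : ℕ) (W : ℝ) (p : Dyadic × ℝ) :
    CostLE f (localizeStep N δ η k W p) (2 * (⌊(p.2 ^ 2)⁻¹ / W * 2 ^ k⌋₊ + 1)) :=
  ((costLE_shb _ _ _ _).bind fun _ => (costLE_verifyCP _ _ _ _).bind (n' := 0)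
    fun _ => costLE_ret _ _ _).mono (by omega)

/-- The shares of the weights sum to at most 1; when the total weight vanishes this still holds,
since division by zero yields zero. -/
lemma sum_floor_weight_le (J : List (Dyadic × ℝ)) (k : ℕ) :
    (J.map fun p => ⌊(p.2 ^ 2)⁻¹ / totalWeight J * 2 ^ k⌋₊).sum ≤ 2 ^ k := by
  have hW : 0 ≤ totalWeight J := List.sum_nonneg (by
    simp only [List.mem_map]; rintro _ ⟨p, -, rfl⟩; positivity)
  have key : ∀ l : List (Dyadic × ℝ),
      (((l.map fun p => ⌊(p.2 ^ 2)⁻¹ / totalWeight J * 2 ^ k⌋₊).sum : ℕ) : ℝ) ≤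
        totalWeight l / totalWeight J * 2 ^ k := by
    intro l
    induction l with
    | nil => simp [totalWeight]
    | cons p l ih =>
      have h1 : totalWeight (p :: l) = (p.2 ^ 2)⁻¹ + totalWeight l := by simp [totalWeight]
      rw [List.map_cons, List.sum_cons, h1, Nat.cast_add, add_div, add_mul]
      exact add_le_add (Nat.floor_le (by positivity)) ih
  have h := (key J).trans (mul_le_of_le_one_left (by positivity) (div_self_le_one _))
  exact_mod_cast h

/-- Detection and estimation cost 2^k each. Every selected interval spends its budget twice, on
halving and on verification, and rounding adds at most one unit per interval: 2(2^k + N) ≤ 4·2^k. -/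
lemma costLE_stage (N : ℕ) (δ η δexp : ℝ) {k : ℕ} (hk : N ≤ 2 ^ k) :
    CostLE f (stage N δ η δexp k) (6 * 2 ^ k) := by
  rw [stage_eq]
  refine CostLE.mono (n := 2 ^ k + (2 ^ k + (2 * (2 ^ k + N) + 0)))
    ((costLE_detectIntervals _ _).bind fun L => ?_) (by omega)
  split_ifs
  · refine (costLE_estimateRounds _ _ _ _ _ _ _ _ _ le_rfl).bind fun acc => ?_
    split_ifs
    · refine CostLE.bind (CostLE.mono (costLE_forEach _ fun p _ => costLE_localizeStep _ _ _ _ _ p)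
        ?_) fun res => costLE_ret _ _ _
      rw [List.sum_map_mul_left, List.sum_map_add]
      have h1 := sum_floor_weight_le (selectLargest N acc) k
      have h2 : (selectLargest N acc).length ≤ N := by simp [selectLargest]
      simp only [List.map_const', List.sum_replicate, smul_eq_mul, mul_one]
      omega
    · exact costLE_ret _ _ _
  · exact costLE_ret _ _ _

end cost

end ChangePoint

namespace ChangePoint

open Prog

/-! ### Step functions -/

namespace StepModel

variable {m : ℕ} (S : StepModel m)

lemma measurable_f : Measurable S.f :=
  measurable_const.add (Finset.measurable_sum _ fun _ _ =>
    Measurable.ite measurableSet_Ici measurable_const measurable_const)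

lemma f_sub {a b : ℝ} (hab : a ≤ b) :
    S.f b - S.f a = ∑ i, if a < S.x i ∧ S.x i ≤ b then S.jump i else 0 := by
  simp only [f, add_sub_add_left_eq_sub, ← Finset.sum_sub_distrib]
  refine Finset.sum_congr rfl fun i _ => ?_
  rcases le_or_gt (S.x i) a with h1 | h1
  · simp [h1, h1.trans hab, not_lt.2 h1]
  · by_cases h2 : S.x i ≤ b <;> simp [h1, h2, not_le.2 h1]

lemma f_eq_of_forall {a b : ℝ} (hab : a ≤ b) (h : ∀ i, ¬ (a < S.x i ∧ S.x i ≤ b)) :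
    S.f b = S.f a := by
  have := S.f_sub hab
  simp only [h, if_false, Finset.sum_const_zero] at this
  linarith

lemma f_sub_eq_jump {a b : ℝ} (hab : a ≤ b) (i : Fin m)
    (h : ∀ j, (a < S.x j ∧ S.x j ≤ b) ↔ j = i) : S.f b - S.f a = S.jump i := by
  rw [S.f_sub hab]
  simp [h]

lemma spacing_pos (j : ℕ) : 0 < S.spacing j := by
  unfold spacing
  split_ifs with h
  · have : (⟨j - 1, by omega⟩ : Fin m) < ⟨j, h.2⟩ := by simp [Fin.lt_def]; omega
    linarith [S.x_strictMono this]
  · exact one_pos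

lemma spacing_le_one (j : ℕ) : S.spacing j ≤ 1 := by
  unfold spacing
  split_ifs with h
  · linarith [S.x_lt_one ⟨j, h.2⟩, S.x_pos ⟨j - 1, by omega⟩]
  · exact le_rfl

lemma s_pos (i : Fin m) : 0 < S.s i := lt_min (S.spacing_pos _) (S.spacing_pos _)

lemma s_le_one (i : Fin m) : S.s i ≤ 1 := (min_le_left _ _).trans (S.spacing_le_one _)

lemma s_le_sub_of_lt {i j : Fin m} (h : i < j) : S.s i ≤ S.x j - S.x i := by
  refine (min_le_right _ _).trans ?_
  have hi : i.val + 1 < m := by have := Fin.lt_def.1 h; omega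
  have hj : (⟨i.val + 1, hi⟩ : Fin m) ≤ j := by rw [Fin.le_def]; exact Fin.lt_def.1 h
  unfold spacing
  rw [dif_pos ⟨by omega, hi⟩]
  simp only [Nat.add_sub_cancel]
  linarith [S.x_strictMono.monotone hj]

lemma s_le_sub_of_gt {i j : Fin m} (h : j < i) : S.s i ≤ S.x i - S.x j := by
  refine (min_le_left _ _).trans ?_
  have hi : 0 < i.val := by have := Fin.lt_def.1 h; omega
  have hj : j ≤ (⟨i.val - 1, by omega⟩ : Fin m) := by
    rw [Fin.le_def]; have := Fin.lt_def.1 h; simp only; omega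
  unfold spacing
  rw [dif_pos ⟨hi, i.2⟩]
  linarith [S.x_strictMono.monotone hj]

/-- Other change points are at distance at least s_i from x_i, while two points of a half-open
interval differ by strictly less than its length. -/
lemma eq_of_mem_Ioc {i j : Fin m} {a b : ℝ} (hab : b - a ≤ S.s i) (hi : a < S.x i ∧ S.x i ≤ b)
    (hj : a < S.x j ∧ S.x j ≤ b) : j = i := by
  rcases lt_trichotomy i j with h | h | h
  · linarith [S.s_le_sub_of_lt h]
  · exact h.symm
  · linarith [S.s_le_sub_of_gt h]

lemma abs_jump_pos (i : Fin m) : 0 < |S.jump i| := abs_pos.2 (S.jump_ne_zero i)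

end StepModel

/-! ### Dyadic intervals -/

namespace Dyadic

lemma left_lt_right (I : Dyadic) : I.left < I.right := by
  unfold left right
  exact div_lt_div_of_pos_right (by linarith) (by positivity)

/-- Membership in the half-open interval. -/
def Mem (x : ℝ) (I : Dyadic) : Prop := I.left < x ∧ x ≤ I.right

/-- The two intervals do not overlap. -/
def Disj (I J : Dyadic) : Prop := I.right ≤ J.left ∨ J.right ≤ I.left

instance : Std.Symm Disj := ⟨fun _ _ h => Or.symm h⟩

lemma Disj.not_mem {I J : Dyadic} (h : I.Disj J) {x : ℝ} (hx : Mem x I) : ¬ Mem x J := by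
  rintro ⟨h1, h2⟩
  rcases h with h | h <;> linarith [hx.1, hx.2]

lemma left_nonneg (I : Dyadic) : 0 ≤ I.left := by unfold left; positivity

lemma right_le_one {I : Dyadic} (h : I.2 < 2 ^ I.1) : I.right ≤ 1 := by
  unfold right
  rw [div_le_one (by positivity)]
  exact_mod_cast h

/-- The endpoints of a coarser dyadic interval are grid points of the finer mesh, so it either
contains a given cell or does not overlap it. -/
lemma disj_of_not_contains {d b : ℕ} {J : Dyadic} (hJ : J.1 ≤ d)
    (h : ¬ (J.left ≤ left (d, b) ∧ right (d, b) ≤ J.right)) : Disj (d, b) J := by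
  obtain ⟨d', j⟩ := J
  obtain ⟨e, rfl⟩ : ∃ e, d = d' + e := ⟨d - d', by simp at hJ; omega⟩
  have h1 : left (d', j) = ((j * 2 ^ e : ℕ) : ℝ) / 2 ^ (d' + e) := by
    simp only [left]; rw [pow_add]; push_cast; field_simp
  have h2 : right (d', j) = (((j + 1) * 2 ^ e : ℕ) : ℝ) / 2 ^ (d' + e) := by
    simp only [right]; rw [pow_add]; push_cast; field_simp
  have h3 : left (d' + e, b) = (b : ℝ) / 2 ^ (d' + e) := rfl
  have h4 : right (d' + e, b) = ((b + 1 : ℕ) : ℝ) / 2 ^ (d' + e) := by simp [right]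
  have hp : (0 : ℝ) < 2 ^ (d' + e) := by positivity
  unfold Disj
  rw [h1, h2, h3, h4] at h ⊢
  simp only [div_le_div_iff_of_pos_right hp, Nat.cast_le] at h ⊢
  push Not at h
  omega

end Dyadic

/-! ### Invariants of the detection of intervals -/

section detection

variable {m : ℕ} (S : StepModel m)

/-- The interval contains the `i`-th change point and no other one. -/
def Isolates (J : Dyadic) (i : Fin m) : Prop := ∀ j, J.Mem (S.x j) ↔ j = i

/-- State of the list after testing `b` intervals at depth `d`. -/
structure ListInv (d b : ℕ) (L : List Dyadic) : Prop where
  cells : ∀ J ∈ L, J.2 < 2 ^ J.1 ∧ (J.1 < d ∨ J.1 = d ∧ J.2 < b)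
  disj : L.Pairwise Dyadic.Disj

/-- Every interval contains a change point, and the change points that are isolated at the depths
already treated are covered. -/
structure CoverInv (dep : Fin m → ℕ) (d b : ℕ) (L : List Dyadic) : Prop where
  hit : ∀ J ∈ L, ∃ i, J.Mem (S.x i)
  cover : ∀ i, (dep i < d ∨ dep i = d ∧ S.x i ≤ (b : ℝ) / 2 ^ d) → ∃ J ∈ L, Isolates S J i

lemma ListInv.update {d b : ℕ} {L : List Dyadic} (h : ListInv d b L) (hb : b < 2 ^ d) {c : Prop}
    [Decidable c] : ListInv d (b + 1) (if c then addPruned (d, b) L else L) := by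
  split_ifs
  · refine ⟨?_, ?_⟩
    · intro J hJ
      rcases List.mem_cons.1 hJ with rfl | hJ
      · exact ⟨hb, Or.inr ⟨rfl, by simp⟩⟩
      · have := h.cells J (List.mem_filter.1 hJ).1
        exact ⟨this.1, by omega⟩
    · refine List.pairwise_cons.2 ⟨fun J hJ => ?_, h.disj.filter _⟩
      obtain ⟨hJ, hc⟩ := List.mem_filter.1 hJ
      have := h.cells J hJ
      exact Dyadic.disj_of_not_contains (by omega) (of_decide_eq_true hc)
  · exact ⟨fun J hJ => by have := h.cells J hJ; exact ⟨this.1, by omega⟩, h.disj⟩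

lemma ListInv.next_depth {d : ℕ} {L : List Dyadic} (h : ListInv d (2 ^ d) L) :
    ListInv (d + 1) 0 L :=
  ⟨fun J hJ => by have := h.cells J hJ; exact ⟨this.1, by omega⟩, h.disj⟩

variable {S} {dep : Fin m → ℕ}

/-- At depth `dep i` the cell around x_i has length at most s_i, so it isolates x_i and is flagged.
Pruning is harmless because a flagged cell contains some change point: if it replaces an interval
isolating i, that change point can only be x_i, and the cell isolates i in turn. -/
lemma CoverInv.update {d b : ℕ} {L : List Dyadic} (h : CoverInv S dep d b L)
    (hdep : ∀ i, (1 : ℝ) / 2 ^ dep i ≤ S.s i) {c : Prop} [Decidable c]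
    (hhit : c → ∃ i, Dyadic.Mem (S.x i) (d, b))
    (hflag : ∀ i, dep i = d → Isolates S (d, b) i → c) :
    CoverInv S dep d (b + 1) (if c then addPruned (d, b) L else L) := by
  have hnew : ∀ i, dep i = d → (b : ℝ) / 2 ^ d < S.x i → S.x i ≤ ((b + 1 : ℕ) : ℝ) / 2 ^ d →
      Isolates S (d, b) i := by
    intro i hi h1 h2
    have hmem : Dyadic.Mem (S.x i) (d, b) := ⟨h1, by simpa [Dyadic.right] using h2⟩
    intro j
    refine ⟨fun hj => S.eq_of_mem_Ioc ?_ hmem hj, fun hj => hj ▸ hmem⟩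
    have := hdep i
    rw [hi] at this
    simp only [Dyadic.left, Dyadic.right]
    rwa [← sub_div, add_sub_cancel_left]
  have hcases : ∀ i, (dep i < d ∨ dep i = d ∧ S.x i ≤ ((b + 1 : ℕ) : ℝ) / 2 ^ d) →
      (∃ J ∈ L, Isolates S J i) ∨ (dep i = d ∧ Isolates S (d, b) i) := by
    rintro i (hi | ⟨hi, h2⟩)
    · exact Or.inl (h.cover i (Or.inl hi))
    · rcases le_or_gt (S.x i) ((b : ℝ) / 2 ^ d) with h1 | h1
      · exact Or.inl (h.cover i (Or.inr ⟨hi, h1⟩))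
      · exact Or.inr ⟨hi, hnew i hi h1 h2⟩
  split_ifs with hc
  · refine ⟨?_, fun i hi => ?_⟩
    · intro J hJ
      rcases List.mem_cons.1 hJ with rfl | hJ
      · exact hhit hc
      · exact h.hit J (List.mem_filter.1 hJ).1
    · rcases hcases i hi with ⟨J, hJ, hJi⟩ | ⟨-, hI⟩
      -- If `J` is pruned, the new cell takes over its change point; otherwise `J` stays in the
      -- list.
      · by_cases hcont : J.left ≤ Dyadic.left (d, b) ∧ Dyadic.right (d, b) ≤ J.right
        · have hsub : ∀ j, Dyadic.Mem (S.x j) (d, b) → j = i := fun j hj =>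
            (hJi j).1 ⟨hcont.1.trans_lt hj.1, hj.2.trans hcont.2⟩
          obtain ⟨j, hj⟩ := hhit hc
          refine ⟨(d, b), List.mem_cons_self, fun j' => ⟨hsub j', ?_⟩⟩
          rintro rfl
          exact hsub j hj ▸ hj
        · exact ⟨J, List.mem_cons_of_mem _ (List.mem_filter.2 ⟨hJ, decide_eq_true hcont⟩), hJi⟩
      · exact ⟨(d, b), List.mem_cons_self, hI⟩
  · refine ⟨h.hit, fun i hi => ?_⟩
    rcases hcases i hi with h' | ⟨hd, hI⟩
    · exact h'
    · exact absurd (hflag i hd hI) hc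

/-- A completed depth has swept the whole unit interval, and at the start of the next one no cell
lies to the left of a change point, since x_i > 0. -/
lemma CoverInv.next_depth {d : ℕ} {L : List Dyadic} (h : CoverInv S dep d (2 ^ d) L) :
    CoverInv S dep (d + 1) 0 L := by
  refine ⟨h.hit, fun i hi => h.cover i ?_⟩
  rcases hi with hi | ⟨-, hi⟩
  · rcases Nat.lt_succ_iff_lt_or_eq.1 hi with hi | hi
    · exact Or.inl hi
    · refine Or.inr ⟨hi, ?_⟩
      push_cast
      rw [div_self (by positivity)]
      exact (S.x_lt_one i).le
  · have := S.x_pos i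
    simp at hi
    linarith

lemma foldl_range_induction {σ : Type} {Inv : ℕ → σ → Prop} {g : σ → ℕ → σ} (n : ℕ) {s : σ}
    (h0 : Inv 0 s) (h : ∀ j < n, ∀ s, Inv j s → Inv (j + 1) (g s j)) :
    Inv n ((List.range n).foldl g s) := by
  induction n with
  | zero => exact h0
  | succ n ih =>
    rw [List.range_succ, List.foldl_append]
    exact h n (by omega) _ (ih fun j hj => h j (by omega))

variable {ν : Measure ℝ}

lemma always_detectDepth (f : ℝ → ℝ) (δ : ℝ) (T dmax d : ℕ) {L : List Dyadic} (h : ListInv d 0 L) :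
    Always f (detectDepth δ T dmax d L) (ListInv (d + 1) 0) := by
  refine always_bind.2 (always_of_forall fun y => ?_)
  exact (foldl_range_induction (Inv := ListInv d) (2 ^ d) h
    fun _ hj _ hL => hL.update hj).next_depth

/-- The number of samples of each endpoint at depth `d`. -/
def depthSamples (T dmax d : ℕ) : ℕ := T / (dmax * (2 ^ d + 1))

/-- The detection threshold at depth `d`. -/
noncomputable def depthThreshold (δ : ℝ) (T dmax d : ℕ) : ℝ :=
  √(8 / depthSamples T dmax d * Real.log (2 * dmax * ((2 ^ d : ℕ) + 1) / δ))

/-- If every endpoint mean is within β/2 of the truth, a cell without change point shows a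
difference of at most β, and one isolating a jump larger than 2β shows more than β. The threshold
makes the union bound over the 2^d + 1 endpoints cost exactly δ/dmax. -/
lemma failLE_detectDepth (hν : SubGaussianLaw ν) {δ : ℝ} (hδ : 0 < δ) (hδ1 : δ ≤ 1) {T dmax d : ℕ}
    (hdmax : 0 < dmax) (hdep : ∀ i, (1 : ℝ) / 2 ^ dep i ≤ S.s i)
    (hT : ∀ i, dep i = d → 0 < depthSamples T dmax d ∧
      2 * depthThreshold δ T dmax d < |S.jump i|)
    {L : List Dyadic} (hL : CoverInv S dep d 0 L) :
    FailLE S.f ν (detectDepth δ T dmax d L) (CoverInv S dep (d + 1) 0) (δ / dmax) := by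
  have := hν.prob
  set Td := depthSamples T dmax d with hTd
  set β := depthThreshold δ T dmax d with hβ
  have hβ0 : 0 ≤ β := Real.sqrt_nonneg _
  have hd0 : (0 : ℝ) < dmax := by exact_mod_cast hdmax
  set R : ℕ → ℝ → Prop := fun i y => |y - S.f ((i : ℝ) / (2 ^ d : ℕ))| ≤ β / 2 with hR
  -- Without samples nothing is flagged, so accuracy is only asserted when `0 < Td`.
  have hp : FailLE S.f ν (forEach (List.range (2 ^ d + 1)) fun i =>
      sampleMean ((i : ℝ) / (2 ^ d : ℕ)) Td)
      (fun y => 0 < Td → List.Forall₂ R (List.range (2 ^ d + 1)) y) (δ / dmax) := by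
    rcases Nat.eq_zero_or_pos Td with h0 | h0
    · exact (Always.failLE (always_of_forall fun y h => by omega)).mono (fun _ h => h)
        (by positivity)
    have h := failLE_forEach (f := S.f) (ν := ν) (R := R)
      (δ := fun _ => 2 * Real.exp (-(Td * (β / 2) ^ 2 / 2))) (fun _ => by positivity)
      (List.range (2 ^ d + 1)) fun i _ => failLE_sampleMean hν _ Td (by positivity)
    refine h.mono (fun y hy _ => hy) (le_of_eq ?_)
    have h0' : (0 : ℝ) < Td := by exact_mod_cast h0
    have harg : 1 ≤ 2 * dmax * (((2 ^ d : ℕ) : ℝ) + 1) / δ := by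
      rw [le_div_iff₀ hδ, one_mul]
      have : (1 : ℝ) ≤ dmax := by exact_mod_cast hdmax
      have : (0 : ℝ) ≤ ((2 ^ d : ℕ) : ℝ) := by positivity
      nlinarith
    have hsq : β ^ 2 = 8 / Td * Real.log (2 * dmax * ((2 ^ d : ℕ) + 1) / δ) :=
      Real.sq_sqrt (mul_nonneg (by positivity) (Real.log_nonneg harg))
    have e1 : (Td : ℝ) * (β / 2) ^ 2 / 2 = Real.log (2 * dmax * ((2 ^ d : ℕ) + 1) / δ) := by
      rw [div_pow, hsq]; field_simp; norm_num
    rw [e1, Real.exp_neg, Real.exp_log (by positivity)]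
    simp only [List.map_const', List.length_range, List.sum_replicate, nsmul_eq_mul]
    push_cast
    field_simp
  have hq : ∀ y : List ℝ, (0 < Td → List.Forall₂ R (List.range (2 ^ d + 1)) y) →
      CoverInv S dep (d + 1) 0 ((List.range (2 ^ d)).foldl
        (fun L i => if 0 < Td ∧ β < |y.getD (i + 1) 0 - y.getD i 0| then addPruned (d, i) L else L)
        L) := by
    intro y hy
    refine (foldl_range_induction (Inv := CoverInv S dep d) (2 ^ d) hL
      fun b hb _ hL => hL.update hdep ?_ ?_).next_depth
    all_goals
      have hy' : 0 < Td → ∀ i < 2 ^ d + 1,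
          |y.getD i 0 - S.f ((i : ℝ) / (2 ^ d : ℕ))| ≤ β / 2 := by
        intro h0 i hi
        obtain ⟨hlen, hget⟩ := List.forall₂_iff_get.1 (hy h0)
        have hi' : i < y.length := by rw [← hlen]; simpa using hi
        have := hget i (by simpa using hi) hi'
        rw [List.getD_eq_getElem _ _ hi']
        simpa [hR] using this
      have hl : Dyadic.left (d, b) = (b : ℝ) / (2 ^ d : ℕ) := by simp [Dyadic.left]
      have hr : Dyadic.right (d, b) = ((b + 1 : ℕ) : ℝ) / (2 ^ d : ℕ) := by simp [Dyadic.right]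
      have hlr := (Dyadic.left_lt_right (d, b)).le
    · rintro ⟨h0, hc⟩
      by_contra hcon
      push Not at hcon
      have hf := S.f_eq_of_forall hlr hcon
      have h1 := hy' h0 b (by omega)
      have h2 := hy' h0 (b + 1) (by omega)
      rw [← hl] at h1
      rw [← hr, hf] at h2
      rw [abs_le] at h1 h2
      have : |y.getD (b + 1) 0 - y.getD b 0| ≤ β := abs_le.2 ⟨by linarith, by linarith⟩
      linarith
    · intro i hi hI
      obtain ⟨h0, hj⟩ := hT i hi
      refine ⟨h0, ?_⟩
      have hf := S.f_sub_eq_jump hlr i hI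
      have h1 := hy' h0 b (by omega)
      have h2 := hy' h0 (b + 1) (by omega)
      rw [← hl] at h1
      rw [← hr] at h2
      rw [← hf] at hj
      rw [abs_le] at h1 h2
      by_contra hcon
      push Not at hcon
      rw [abs_le] at hcon
      have : |S.f (Dyadic.right (d, b)) - S.f (Dyadic.left (d, b))| ≤ 2 * β :=
        abs_le.2 ⟨by linarith, by linarith⟩
      linarith
  have := hp.bind (q := fun y => ret ((List.range (2 ^ d)).foldl
        (fun L i => if 0 < Td ∧ β < |y.getD (i + 1) 0 - y.getD i 0| then addPruned (d, i) L else L)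
        L)) (Q := CoverInv S dep (d + 1) 0) (δ' := 0) (fun y hy => failLE_ret (hq y hy) _)
        (by positivity) le_rfl
  rw [add_zero] at this
  exact this

/-- The maximal depth of `DetectIntervals`. -/
noncomputable def maxDepth (δ : ℝ) (T : ℕ) : ℕ := ⌊Real.logb 2 (T / Real.log (1 / δ))⌋₊

lemma listInv_nil (d : ℕ) : ListInv d 0 [] := ⟨by simp, List.Pairwise.nil⟩

lemma always_detectIntervals (f : ℝ → ℝ) (δ : ℝ) (T : ℕ) :
    Always f (detectIntervals δ T) (fun L => (∀ J ∈ L, J.2 < 2 ^ J.1) ∧ L.Pairwise Dyadic.Disj) :=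
  (always_forFold_range (Inv := fun j => ListInv (j + 1) 0) (maxDepth δ T) [] (listInv_nil _)
    fun j _ _ hL => always_detectDepth f δ T _ (j + 1) hL).mono
    fun _ hL => ⟨fun J hJ => (hL.cells J hJ).1, hL.disj⟩

/-- A candidate contains some x_i, hence overlaps the candidate isolating x_i, and non-overlap of
distinct candidates forces the two to coincide. -/
lemma exists_perm_of_coverInv {L : List Dyadic} (hd : L.Pairwise Dyadic.Disj)
    (hhit : ∀ J ∈ L, ∃ i, J.Mem (S.x i)) (hcover : ∀ i, ∃ J ∈ L, Isolates S J i) :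
    ∃ I : Fin m → Dyadic, (∀ i, Isolates S (I i) i) ∧ L.Perm (List.ofFn I) := by
  choose I hI hiso using hcover
  refine ⟨I, hiso, (List.perm_ext_iff_of_nodup ?_ ?_).2 fun J => ?_⟩
  · refine hd.imp fun {J K} h hJK => ?_
    subst hJK
    rcases h with h | h <;> linarith [J.left_lt_right]
  · rw [List.nodup_ofFn]
    intro i j hij
    exact (hiso j i).1 (hij ▸ (hiso i i).2 rfl)
  · rw [List.mem_ofFn']
    constructor
    · intro hJ
      obtain ⟨i, hi⟩ := hhit J hJ
      refine ⟨i, ?_⟩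
      by_contra hne
      have := hd.forall (hI i) hJ hne
      exact this.not_mem ((hiso i i).2 rfl) hi
    · rintro ⟨i, rfl⟩
      exact hI i

/-- If every change point can be detected at its own depth, then with high probability the
candidate intervals isolate all the change points. -/
lemma failLE_detectIntervals (hm : 0 < m) (hν : SubGaussianLaw ν) {δ : ℝ} (hδ : 0 < δ) (hδ1 : δ ≤ 1) {T : ℕ}
    (hdep : ∀ i, (1 : ℝ) / 2 ^ dep i ≤ S.s i) (hdep1 : ∀ i, 1 ≤ dep i ∧ dep i ≤ maxDepth δ T)
    (hT : ∀ i, 0 < depthSamples T (maxDepth δ T) (dep i) ∧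
      2 * depthThreshold δ T (maxDepth δ T) (dep i) < |S.jump i|) :
    FailLE S.f ν (detectIntervals δ T) (fun L => ∃ I : Fin m → Dyadic,
      (∀ i, Isolates S (I i) i) ∧ L.Perm (List.ofFn I)) δ := by
  have := hν.prob
  have h0 : 0 < maxDepth δ T := by have := hdep1 ⟨0, hm⟩; omega
  have h := failLE_forFold_range (f := S.f) (ν := ν)
    (p := fun d L => detectDepth δ T (maxDepth δ T) (d + 1) L)
    (Inv := fun j L => CoverInv S dep (j + 1) 0 L) (δ := δ / maxDepth δ T) (by positivity)
    (maxDepth δ T) [] ⟨by simp, fun i hi => ?_⟩ fun j _ L hL =>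
      failLE_detectDepth hν hδ hδ1 h0 hdep (fun i hi => hi ▸ hT i) hL
  · refine (FailLE.and_always (p := detectIntervals δ T) h (always_detectIntervals S.f δ T)).mono
      (fun L hL => ?_) (le_of_eq ?_)
    · exact exists_perm_of_coverInv hL.2.2 hL.1.hit fun i =>
        hL.1.cover i (Or.inl (by have := hdep1 i; omega))
    · have : (0 : ℝ) < maxDepth δ T := by exact_mod_cast h0
      field_simp
  · have := hdep1 i
    rcases hi with hi | ⟨-, hi⟩
    · omega
    · have := S.x_pos i
      simp at hi
      linarith

end detection

end ChangePoint

namespace ChangePoint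

open Prog

/-! ### Estimation of the jumps -/

section estimation

/-- The variation of `f` between the endpoints of an interval. -/
noncomputable def Dyadic.gap (f : ℝ → ℝ) (I : Dyadic) : ℝ := |f I.right - f I.left|

/-- The acceptance threshold of `EstimateJumps` in round `k`. -/
noncomputable def estThreshold (δ : ℝ) (M k : ℕ) : ℝ :=
  √((2 : ℝ) ^ (-((k : ℤ) - 5)) * Real.log (Real.pi ^ 2 * M * k ^ 2 / (3 * δ)))

/-- The sampling of all active intervals in round `k`. -/
noncomputable def sampleGaps (k : ℕ) (active : List Dyadic) : Prog (List (Dyadic × ℝ)) :=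
  forEach active fun I => (sampleMean I.left (2 ^ (k - 1))).bind fun yl =>
    (sampleMean I.right (2 ^ (k - 1))).bind fun yr => ret (I, |yr - yl|)

lemma estimateRounds_succ (δ : ℝ) (T N M fuel k τ : ℕ) (active : List Dyadic)
    (acc : List (Dyadic × ℝ)) : estimateRounds δ T N M (fuel + 1) k τ active acc =
    if acc.length < N ∧ τ + active.length * 2 ^ k ≤ T then
      (sampleGaps k active).bind fun res =>
        estimateRounds δ T N M fuel (k + 1) (τ + active.length * 2 ^ k)
          ((res.filter fun p => p.2 < estThreshold δ M k).map Prod.fst)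
          (acc ++ res.filter fun p => estThreshold δ M k ≤ p.2)
    else ret acc := rfl

lemma forall₂_fst_eq {R : Dyadic → Dyadic × ℝ → Prop} (hR : ∀ I p, R I p → p.1 = I)
    {l : List Dyadic} {res : List (Dyadic × ℝ)} (h : List.Forall₂ R l res) :
    res.map Prod.fst = l := by
  induction h with
  | nil => rfl
  | cons h1 _ ih => rw [List.map_cons, hR _ _ h1, ih]

lemma exists_of_forall₂_mem_right {α β : Type} {R : α → β → Prop} {l : List α} {l' : List β}
    (h : List.Forall₂ R l l') {b : β} (hb : b ∈ l') : ∃ a ∈ l, R a b := by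
  induction h with
  | nil => simp at hb
  | cons h1 _ ih =>
    rcases List.mem_cons.1 hb with rfl | hb
    · exact ⟨_, by simp, h1⟩
    · obtain ⟨a, ha, hab⟩ := ih hb
      exact ⟨a, by simp [ha], hab⟩

lemma filter_le_append_filter_lt_perm (θ : ℝ) (res : List (Dyadic × ℝ)) :
    ((res.filter fun p => θ ≤ p.2) ++ res.filter fun p => p.2 < θ).Perm res := by
  have h := List.filter_append_perm (fun p : Dyadic × ℝ => decide (θ ≤ p.2)) res
  convert h using 3
  funext p
  by_cases hp : θ ≤ p.2 <;> simp [hp, not_lt.2, not_le.1]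

lemma perm_update {L active : List Dyadic} {acc res : List (Dyadic × ℝ)} {θ : ℝ}
    (h : (acc.map Prod.fst ++ active).Perm L) (hres : res.map Prod.fst = active) :
    ((acc ++ res.filter fun p => θ ≤ p.2).map Prod.fst ++
      (res.filter fun p => p.2 < θ).map Prod.fst).Perm L := by
  refine List.Perm.trans ?_ h
  rw [List.map_append, List.append_assoc, ← List.map_append, ← hres]
  exact List.Perm.append_left _ ((filter_le_append_filter_lt_perm θ res).map _)

lemma always_estimateJumps (f : ℝ → ℝ) (L : List Dyadic) (δ : ℝ) (T N : ℕ) :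
    Always f (estimateJumps L δ T N) fun acc => ∃ rest, (acc.map Prod.fst ++ rest).Perm L := by
  have key : ∀ (fuel k τ : ℕ) (active : List Dyadic) (acc : List (Dyadic × ℝ)),
      (acc.map Prod.fst ++ active).Perm L →
      Always f (estimateRounds δ T N L.length fuel k τ active acc)
        fun acc => ∃ rest, (acc.map Prod.fst ++ rest).Perm L := by
    intro fuel
    induction fuel with
    | zero => exact fun k τ active acc h => ⟨active, h⟩
    | succ fuel ih =>
      intro k τ active acc h
      rw [estimateRounds_succ]
      split_ifs
      · refine always_bind.2 ((always_forEach (R := fun I p => p.1 = I) active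
          fun I _ => ?_).mono fun res hres => ?_)
        · exact always_bind.2 (always_of_forall fun yl => always_bind.2
            (always_of_forall fun yr => rfl))
        · exact ih _ _ _ _ (perm_update h (forall₂_fst_eq (fun _ _ h => h) hres))
      · exact ⟨active, h⟩
  exact key T 1 0 L [] (by simp)

/-- The accepted estimates are accurate up to constant factors, and the intervals which are not
accepted do not have much larger jumps than the accepted ones. -/
structure GoodEstimates (f : ℝ → ℝ) (L : List Dyadic) (N : ℕ) (acc : List (Dyadic × ℝ)) :
    Prop where
  card : N ≤ acc.length
  accurate : ∀ p ∈ acc, 2 / 3 * p.1.gap f ≤ p.2 ∧ p.2 ≤ 2 * p.1.gap f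
  rest : ∃ rest, (acc.map Prod.fst ++ rest).Perm L ∧
    ∃ θ, (∀ p ∈ acc, θ ≤ p.2) ∧ ∀ J ∈ rest, J.gap f ≤ 3 / 2 * θ

variable {f : ℝ → ℝ} {ν : Measure ℝ} {δ : ℝ} {L : List Dyadic} {R : Dyadic → ℕ}

/-- The invariant of `EstimateJumps`, where the jump of the interval `I` is large enough to be
accepted in round `R I`. -/
structure EstInv (f : ℝ → ℝ) (δ : ℝ) (T : ℕ) (L : List Dyadic) (R : Dyadic → ℕ) (k τ : ℕ)
    (active : List Dyadic) (acc : List (Dyadic × ℝ)) : Prop where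
  perm : (acc.map Prod.fst ++ active).Perm L
  le_round : ∀ I ∈ active, k ≤ R I
  budget : τ + (active.map fun I => 2 ^ (R I + 1)).sum ≤ T + active.length * 2 ^ k
  accurate : ∀ p ∈ acc, 2 / 3 * p.1.gap f ≤ p.2 ∧ p.2 ≤ 2 * p.1.gap f
  acc_ge : ∀ p ∈ acc, estThreshold δ L.length k ≤ p.2
  separated : ∃ θ, (∀ p ∈ acc, θ ≤ p.2) ∧ ∀ J ∈ active, J.gap f ≤ 3 / 2 * θ

/-- Combined with the budget invariant, this bounds τ + |active|·2^k by T, so the next round is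
affordable. -/
lemma sum_pow_ge {k : ℕ} {l : List Dyadic} (h : ∀ I ∈ l, k ≤ R I) :
    2 * (l.length * 2 ^ k) ≤ (l.map fun I => 2 ^ (R I + 1)).sum := by
  induction l with
  | nil => simp
  | cons I l ih =>
    have h1 := ih fun J hJ => h J (by simp [hJ])
    have h2 : 2 ^ k ≤ 2 ^ R I := Nat.pow_le_pow_right (by norm_num) (h I (by simp))
    rw [List.map_cons, List.sum_cons, List.length_cons, pow_succ]
    linarith

lemma EstInv.goodEstimates {T N k τ : ℕ} {active : List Dyadic} {acc : List (Dyadic × ℝ)}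
    (h : EstInv f δ T L R k τ active acc) (hN : N ≤ acc.length) : GoodEstimates f L N acc :=
  ⟨hN, h.accurate, active, h.perm, h.separated⟩

lemma estThreshold_nonneg (δ : ℝ) (M k : ℕ) : 0 ≤ estThreshold δ M k := Real.sqrt_nonneg _

lemma pi_sq_gt_nine : 9 < Real.pi ^ 2 := by nlinarith [Real.pi_gt_three]

lemma one_le_estThreshold_arg (hδ : 0 < δ) (hδ1 : δ ≤ 1 / 2) {M k : ℕ} (hM : 1 ≤ M)
    (hk : 1 ≤ k) : 4 * (k : ℝ) ^ 2 ≤ Real.pi ^ 2 * M * k ^ 2 / (3 * δ) := by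
  have hM' : (1 : ℝ) ≤ M := by exact_mod_cast hM
  have hk' : (1 : ℝ) ≤ k := by exact_mod_cast hk
  have := pi_sq_gt_nine
  have h1 : 9 ≤ Real.pi ^ 2 * M := by nlinarith
  rw [le_div_iff₀ (by positivity)]
  have : 4 * (3 * δ) ≤ Real.pi ^ 2 * M := by linarith
  nlinarith [sq_nonneg (k : ℝ)]

lemma estThreshold_sq (hδ : 0 < δ) (hδ1 : δ ≤ 1 / 2) {M k : ℕ} (hM : 1 ≤ M) (hk : 1 ≤ k) :
    estThreshold δ M k ^ 2 =
      2 ^ (-((k : ℤ) - 5)) * Real.log (Real.pi ^ 2 * M * k ^ 2 / (3 * δ)) := by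
  have h := one_le_estThreshold_arg hδ hδ1 hM hk
  have hk' : (1 : ℝ) ≤ k := by exact_mod_cast hk
  exact Real.sq_sqrt (mul_nonneg (by positivity) (Real.log_nonneg (by nlinarith)))

/-- Halving the leading factor beats the growth of the logarithm: with c the argument at k, the
argument at k + 1 is at most 4c ≤ c². -/
lemma estThreshold_succ_le (hδ : 0 < δ) (hδ1 : δ ≤ 1 / 2) {M k : ℕ} (hM : 1 ≤ M) (hk : 1 ≤ k) :
    estThreshold δ M (k + 1) ≤ estThreshold δ M k := by
  have h := one_le_estThreshold_arg hδ hδ1 hM hk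
  have hk' : (1 : ℝ) ≤ k := by exact_mod_cast hk
  have hM' : (1 : ℝ) ≤ M := by exact_mod_cast hM
  set c : ℝ := Real.pi ^ 2 * M * k ^ 2 / (3 * δ) with hc
  have hc0 : 0 < c := by nlinarith
  apply Real.sqrt_le_sqrt
  have e1 : (2 : ℝ) ^ (-((k : ℤ) - 5)) = 2 ^ (-(((k + 1 : ℕ) : ℤ) - 5)) * 2 := by
    rw [← zpow_add_one₀ (two_ne_zero)]; congr 1; push_cast; ring
  rw [← hc, e1, mul_assoc (2 ^ (-(((k + 1 : ℕ) : ℤ) - 5))) 2, mul_comm 2 (Real.log c)]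
  refine mul_le_mul_of_nonneg_left ?_ (by positivity)
  have e2 : Real.log c * 2 = Real.log (c ^ 2) := by rw [Real.log_pow]; push_cast; ring
  rw [e2]
  apply Real.log_le_log (by positivity)
  calc Real.pi ^ 2 * M * ((k + 1 : ℕ) : ℝ) ^ 2 / (3 * δ)
      ≤ Real.pi ^ 2 * M * (4 * (k : ℝ) ^ 2) / (3 * δ) := by
        gcongr; push_cast; nlinarith
    _ = 4 * c := by rw [hc]; ring
    _ ≤ c ^ 2 := by have : 4 ≤ c := by nlinarith
                    nlinarith

/-- With errors at most θ/2, an accepted estimate is at least θ and hence correct up to constants, a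
rejected interval has a gap of at most 3θ/2, and a gap of at least 3θ/2 forces acceptance. For the
budget, an interval still active at round k can yet cost 2^k + ⋯ + 2^R = 2^(R+1) - 2^k; the
invariant says that the spent budget plus these reserves is at most T, written without subtraction.
-/
lemma EstInv.update {T k τ : ℕ} {active : List Dyadic} {acc res : List (Dyadic × ℝ)}
    (h : EstInv f δ T L R k τ active acc) (hδ : 0 < δ) (hδ1 : δ ≤ 1 / 2) (hL : 1 ≤ L.length)
    (hk : 1 ≤ k) (hR : ∀ I ∈ L, 3 / 2 * estThreshold δ L.length (R I) ≤ I.gap f)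
    (hres : List.Forall₂ (fun I p => p.1 = I ∧ |p.2 - I.gap f| ≤ estThreshold δ L.length k / 2)
      active res) :
    EstInv f δ T L R (k + 1) (τ + active.length * 2 ^ k)
      ((res.filter fun p => p.2 < estThreshold δ L.length k).map Prod.fst)
      (acc ++ res.filter fun p => estThreshold δ L.length k ≤ p.2) := by
  set θ := estThreshold δ L.length k with hθ
  have hfst := forall₂_fst_eq (fun _ _ h => h.1) hres
  have hmem : ∀ p ∈ res, p.1 ∈ active ∧ |p.2 - p.1.gap f| ≤ θ / 2 := by
    intro p hp
    obtain ⟨I, hI, rfl, h2⟩ := exists_of_forall₂_mem_right hres hp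
    exact ⟨hI, h2⟩
  have hactL : ∀ I ∈ active, I ∈ L := fun I hI => h.perm.subset (List.mem_append_right _ hI)
  have hle : ∀ I ∈ (res.filter fun p => p.2 < θ).map Prod.fst, k + 1 ≤ R I := by
    intro I hI
    obtain ⟨p, hp, rfl⟩ := List.mem_map.1 hI
    obtain ⟨hp1, hp2⟩ := List.mem_filter.1 hp
    obtain ⟨hp3, hp4⟩ := hmem p hp1
    have hp2 := of_decide_eq_true hp2
    rcases (h.le_round _ hp3).lt_or_eq with h1 | h1
    · exact h1
    · have := hR _ (hactL _ hp3)
      rw [← h1, ← hθ] at this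
      rw [abs_le] at hp4
      linarith [hp4.1]
  have hnew : ∀ p ∈ res.filter fun p => θ ≤ p.2,
      2 / 3 * p.1.gap f ≤ p.2 ∧ p.2 ≤ 2 * p.1.gap f ∧ θ ≤ p.2 := by
    intro p hp
    obtain ⟨hp1, hp2⟩ := List.mem_filter.1 hp
    have hp2 := of_decide_eq_true hp2
    have hp4 := (hmem p hp1).2
    rw [abs_le] at hp4
    exact ⟨by linarith, by linarith, hp2⟩
  have hall : ∀ p ∈ acc ++ res.filter fun p => θ ≤ p.2, θ ≤ p.2 := by
    intro p hp
    rcases List.mem_append.1 hp with hp | hp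
    exacts [h.acc_ge p hp, (hnew p hp).2.2]
  refine ⟨perm_update h.perm hfst, hle, ?_, ?_, ?_, θ, hall, ?_⟩
  · have hperm := (filter_le_append_filter_lt_perm θ res).map Prod.fst
    rw [hfst, List.map_append] at hperm
    have h1 := (hperm.map fun I => 2 ^ (R I + 1)).sum_eq
    have h2 := hperm.length_eq
    rw [List.map_append, List.sum_append] at h1
    rw [List.length_append] at h2
    have h3 := sum_pow_ge (R := R) (k := k) (l := (res.filter fun p => θ ≤ p.2).map Prod.fst)
      fun I hI => h.le_round I (hperm.subset (List.mem_append_left _ hI))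
    have h4 := h.budget
    rw [← h1, ← h2] at h4
    rw [← h2, pow_succ]
    simp only [add_mul] at h4 ⊢
    linarith
  · intro p hp
    rcases List.mem_append.1 hp with hp | hp
    exacts [h.accurate p hp, ⟨(hnew p hp).1, (hnew p hp).2.1⟩]
  · exact fun p hp => (estThreshold_succ_le hδ hδ1 hL hk).trans (hall p hp)
  · intro I hI
    obtain ⟨p, hp, rfl⟩ := List.mem_map.1 hI
    obtain ⟨hp1, hp2⟩ := List.mem_filter.1 hp
    have hp2 := of_decide_eq_true hp2
    have hp4 := (hmem p hp1).2
    rw [abs_le] at hp4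
    linarith

/-- The threshold is such that 2^(k-1)(θ/2)²/4 is exactly the logarithm in it. At most M intervals
are tested, and the factors 6/(π²k²) sum to at most 1 over the rounds. -/
lemma failLE_sampleGaps (hν : SubGaussianLaw ν) (hδ : 0 < δ) (hδ1 : δ ≤ 1 / 2) {M k : ℕ}
    (hM : 1 ≤ M) (hk : 1 ≤ k) {active : List Dyadic} (hact : active.length ≤ M) :
    FailLE f ν (sampleGaps k active)
      (List.Forall₂ (fun I p => p.1 = I ∧ |p.2 - I.gap f| ≤ estThreshold δ M k / 2) active)
      (6 / Real.pi ^ 2 * δ * (1 / (k : ℝ) ^ 2)) := by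
  have := hν.prob
  set θ := estThreshold δ M k with hθ
  have hθ0 : 0 ≤ θ := estThreshold_nonneg _ _ _
  have hM' : (1 : ℝ) ≤ M := by exact_mod_cast hM
  have hk' : (1 : ℝ) ≤ k := by exact_mod_cast hk
  have h := failLE_forEach (f := f) (ν := ν) (p := fun I : Dyadic =>
      (sampleMean I.left (2 ^ (k - 1))).bind fun yl =>
        (sampleMean I.right (2 ^ (k - 1))).bind fun yr => ret (I, |yr - yl|))
    (R := fun I p => p.1 = I ∧ |p.2 - I.gap f| ≤ θ / 2)
    (δ := fun _ => 2 * Real.exp (-((2 ^ (k - 1) : ℕ) * (θ / 2) ^ 2 / 4)))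
    (fun _ => by positivity) active fun I _ => failLE_sampleMean_pair hν I.left I.right (2 ^ (k - 1))
      (r := θ / 2) (by positivity) fun yl yr hy =>
        ⟨rfl, (abs_abs_sub_abs_le _ _).trans hy⟩
  refine h.mono (fun _ h => h) ?_
  have e0 : (2 : ℝ) ^ (k - 1) * 2 ^ (-((k : ℤ) - 5)) = 16 := by
    rw [← zpow_natCast, ← zpow_add₀ (by norm_num)]
    have : ((k - 1 : ℕ) : ℤ) + -((k : ℤ) - 5) = 4 := by omega
    rw [this]; norm_num
  have e1 : ((2 ^ (k - 1) : ℕ) : ℝ) * (θ / 2) ^ 2 / 4 =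
      Real.log (Real.pi ^ 2 * M * k ^ 2 / (3 * δ)) := by
    rw [div_pow, hθ, estThreshold_sq hδ hδ1 hM hk]
    push_cast
    linear_combination (Real.log (Real.pi ^ 2 * M * k ^ 2 / (3 * δ)) / 16) * e0
  have hpi := Real.pi_pos
  rw [e1, Real.exp_neg, Real.exp_log (by positivity)]
  simp only [List.map_const', List.sum_replicate, nsmul_eq_mul]
  have hact' : (active.length : ℝ) ≤ M := by exact_mod_cast hact
  calc (active.length : ℝ) * (2 * (Real.pi ^ 2 * M * k ^ 2 / (3 * δ))⁻¹)
      ≤ M * (2 * (Real.pi ^ 2 * M * k ^ 2 / (3 * δ))⁻¹) := by gcongr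
    _ = 6 / Real.pi ^ 2 * δ * (1 / (k : ℝ) ^ 2) := by field_simp; norm_num

lemma sum_one_div_sq_le (n : ℕ) :
    ∑ j ∈ Finset.range n, 1 / (((1 + j : ℕ) : ℝ)) ^ 2 ≤ Real.pi ^ 2 / 6 := by
  have h := hasSum_zeta_two
  have h2 := sum_le_hasSum (Finset.range (n + 1)) (fun i _ => by positivity) h
  rw [Finset.sum_range_succ'] at h2
  simpa [add_comm] using h2

/-- If every candidate interval has a jump that is accepted before the budget is exhausted, then
with high probability `EstimateJumps` succeeds. -/
lemma failLE_estimateJumps (hν : SubGaussianLaw ν) (hδ : 0 < δ) (hδ1 : δ ≤ 1 / 2) {T N : ℕ}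
    (hL : 1 ≤ L.length) (hN : N ≤ L.length)
    (hR : ∀ I ∈ L, 1 ≤ R I ∧ 3 / 2 * estThreshold δ L.length (R I) ≤ I.gap f)
    (hT : (L.map fun I => 2 ^ (R I + 1)).sum ≤ T) :
    FailLE f ν (estimateJumps L δ T N) (GoodEstimates f L N) δ := by
  have := hν.prob
  set b : ℕ → ℝ := fun k => 6 / Real.pi ^ 2 * δ * (1 / (k : ℝ) ^ 2) with hb
  have hb0 : ∀ k, 0 ≤ b k := fun k => by positivity
  have key : ∀ (fuel k τ : ℕ) (active : List Dyadic) (acc : List (Dyadic × ℝ)),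
      fuel + k = T + 1 → 1 ≤ k → EstInv f δ T L R k τ active acc →
      FailLE f ν (estimateRounds δ T N L.length fuel k τ active acc) (GoodEstimates f L N)
        (∑ j ∈ Finset.range fuel, b (k + j)) := by
    intro fuel
    induction fuel with
    | zero =>
      intro k τ active acc hk hk1 h
      -- The fuel runs out at k = T + 1. An active interval would then need 2^k ≤ T, which is
      -- impossible, so all intervals have been accepted.
      refine failLE_ret (h.goodEstimates ?_) _
      have hlen := h.perm.length_eq
      rw [List.length_append, List.length_map] at hlen
      rcases Nat.eq_zero_or_pos active.length with h0 | h0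
      · omega
      · have h1 := sum_pow_ge h.le_round
        have h2 := h.budget
        have h3 : k < 2 ^ k := Nat.lt_two_pow_self
        have h4 : 1 * 2 ^ k ≤ active.length * 2 ^ k := Nat.mul_le_mul_right _ h0
        omega
    | succ fuel ih =>
      intro k τ active acc hk hk1 h
      rw [estimateRounds_succ]
      split_ifs with hc
      · rw [Finset.sum_range_succ', add_comm (Finset.sum _ _)]
        refine FailLE.bind (δ := b k) (failLE_sampleGaps hν hδ hδ1 hL hk1 ?_) (fun res hres => ?_)
          (hb0 _) (Finset.sum_nonneg fun _ _ => hb0 _)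
        · have := h.perm.length_eq
          rw [List.length_append] at this
          omega
        · have := ih (k + 1) _ _ _ (by omega) (by omega)
            (h.update hδ hδ1 hL hk1 (fun I hI => (hR I hI).2) hres)
          refine this.mono (fun _ h => h) (le_of_eq ?_)
          refine Finset.sum_congr rfl fun j _ => ?_
          rw [add_assoc, add_comm 1 j]
      · refine failLE_ret (h.goodEstimates ?_) _
        have h1 := sum_pow_ge h.le_round
        have h2 := h.budget
        by_contra hcon
        exact hc ⟨by omega, by omega⟩
  have h0 : EstInv f δ T L R 1 0 L [] := by
    -- Nothing is accepted yet, so θ may be any number dominating 2/3 of every gap; the sum of the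
    -- gaps serves.
    refine ⟨by simp, fun I hI => (hR I hI).1, by omega, by simp, by simp,
      2 / 3 * (L.map fun J => J.gap f).sum, by simp, fun J hJ => ?_⟩
    have := List.single_le_sum (l := L.map fun J => J.gap f)
      (by simp only [List.mem_map]; rintro _ ⟨J, -, rfl⟩; exact abs_nonneg _) _
      (List.mem_map_of_mem hJ)
    linarith
  refine (key T 1 0 L [] rfl le_rfl h0).mono (fun _ h => h) ?_
  rw [hb, ← Finset.mul_sum]
  have := sum_one_div_sq_le T
  have hpi := Real.pi_pos
  calc 6 / Real.pi ^ 2 * δ * ∑ j ∈ Finset.range T, 1 / (((1 + j : ℕ) : ℝ)) ^ 2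
      ≤ 6 / Real.pi ^ 2 * δ * (Real.pi ^ 2 / 6) := by gcongr
    _ = δ := by field_simp

end estimation

end ChangePoint

namespace ChangePoint

open Prog

/-! ### Random walks with drift -/

/-- One step multiplies the exponential moment by at most exp(-u) + p·exp(u) ≤ 2·exp(-u): the first
term is a step up, the second a failure, which loses at most one unit. The bound on p balances the
two terms. -/
lemma Prog.wp_forFold_exp_le {σ β : Type} {f : ℝ → ℝ} {ν : Measure ℝ} [IsProbabilityMeasure ν]
    {step : σ → Prog σ} {Ch : σ → Prop} {pot : σ → ℤ} {p u : ℝ} (hu : 0 ≤ u)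
    (hp : p ≤ Real.exp (-(2 * u)))
    (halways : ∀ A, Ch A → Always f (step A) fun A' => Ch A' ∧ pot A - 1 ≤ pot A')
    (hfail : ∀ A, Ch A → FailLE f ν (step A) (fun A' => pot A + 1 ≤ pot A') p)
    (l : List β) (A : σ) (hA : Ch A) :
    wp f ν (forFold l A fun _ => step) (fun A' => ENNReal.ofReal (Real.exp (-(u * pot A')))) ≤
      ENNReal.ofReal ((2 * Real.exp (-u)) ^ l.length * Real.exp (-(u * pot A))) := by
  classical
  induction l generalizing A with
  | nil => simp [forFold, pure_def, wp]
  | cons b l ih =>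
    have e : forFold (b :: l) A (fun _ => step) =
        (step A).bind fun A' => forFold l A' fun _ => step := rfl
    rw [e, wp_bind]
    set C : ℝ := (2 * Real.exp (-u)) ^ l.length with hC
    have hC0 : 0 ≤ C := by positivity
    set E1 : ℝ := Real.exp (-(u * (pot A + 1))) with hE1
    set E2 : ℝ := Real.exp (-(u * (pot A - 1))) with hE2
    refine (wp_mono_of_always (ψ := fun A' => ENNReal.ofReal (C * E1) +
      ENNReal.ofReal (C * E2) * (if pot A + 1 ≤ pot A' then 0 else 1))
      ((halways A hA).mono fun A' hA' => (ih A' hA'.1).trans ?_)).trans ?_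
    · split_ifs with h
      · rw [mul_zero, add_zero]
        apply ENNReal.ofReal_le_ofReal
        refine mul_le_mul_of_nonneg_left (Real.exp_le_exp.2 ?_) hC0
        have : (pot A : ℝ) + 1 ≤ pot A' := by exact_mod_cast h
        nlinarith
      · rw [mul_one]
        refine le_trans (ENNReal.ofReal_le_ofReal ?_) le_add_self
        refine mul_le_mul_of_nonneg_left (Real.exp_le_exp.2 ?_) hC0
        have : (pot A : ℝ) - 1 ≤ pot A' := by exact_mod_cast hA'.2
        nlinarith
    · refine (wp_add_le _ _ _).trans ?_
      rw [wp_const]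
      have h1 := hfail A hA
      have h2 : wp f ν (step A) (fun A' => ENNReal.ofReal (C * E2) *
          (if pot A + 1 ≤ pot A' then 0 else 1)) ≤ ENNReal.ofReal (C * E1) := by
        refine (wp_const_mul_le _ ENNReal.ofReal_ne_top _).trans ?_
        refine (mul_le_mul_right (le_trans (le_of_eq ?_)
          (h1.trans (ENNReal.ofReal_le_ofReal hp))) _).trans ?_
        · congr 1; funext a; congr
        · rw [← ENNReal.ofReal_mul (by positivity)]
          apply ENNReal.ofReal_le_ofReal
          rw [mul_assoc, hE2, ← Real.exp_add]
          apply le_of_eq; rw [hE1]; congr 2; ring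
      refine (add_le_add_right h2 _).trans ?_
      rw [← ENNReal.ofReal_add (by positivity) (by positivity)]
      apply ENNReal.ofReal_le_ofReal
      have e3 : E1 = Real.exp (-u) * Real.exp (-(u * pot A)) := by
        rw [hE1, ← Real.exp_add]; congr 1; ring
      rw [e3, List.length_cons, pow_succ, ← hC]
      apply le_of_eq; ring

/-- Markov's inequality for exp(-u·pot), started from potential zero. -/
lemma Prog.failLE_forFold_drift {σ β : Type} {f : ℝ → ℝ} {ν : Measure ℝ} [IsProbabilityMeasure ν]
    {step : σ → Prog σ} {Ch : σ → Prop} {pot : σ → ℤ} {p u : ℝ} (hu : 0 ≤ u)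
    (hp : p ≤ Real.exp (-(2 * u)))
    (halways : ∀ A, Ch A → Always f (step A) fun A' => Ch A' ∧ pot A - 1 ≤ pot A')
    (hfail : ∀ A, Ch A → FailLE f ν (step A) (fun A' => pot A + 1 ≤ pot A') p)
    (l : List β) (A : σ) (hA : Ch A) (hA0 : pot A = 0) (D : ℕ) :
    FailLE f ν (forFold l A fun _ => step) (fun A' => (D : ℤ) ≤ pot A')
      (Real.exp (l.length * Real.log 2 - u * (l.length - D))) := by
  have h := wp_forFold_exp_le hu hp halways hfail l A hA
  refine (wp_mono (ψ := fun A' => ENNReal.ofReal (Real.exp (u * D)) *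
    ENNReal.ofReal (Real.exp (-(u * pot A')))) fun A' => ?_).trans
    ((wp_const_mul_le _ ENNReal.ofReal_ne_top _).trans ((mul_le_mul_right h _).trans ?_))
  · split_ifs with hD
    · simp
    · rw [← ENNReal.ofReal_mul (by positivity), ← Real.exp_add, ← ENNReal.ofReal_one]
      apply ENNReal.ofReal_le_ofReal
      apply Real.one_le_exp
      have : (pot A' : ℝ) ≤ D := by exact_mod_cast (not_le.1 hD).le
      nlinarith
  · rw [← ENNReal.ofReal_mul (by positivity)]
    apply ENNReal.ofReal_le_ofReal
    apply le_of_eq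
    have h2 : (2 : ℝ) = Real.exp (Real.log 2) := (Real.exp_log (by norm_num)).symm
    rw [hA0, Int.cast_zero, mul_zero, neg_zero, Real.exp_zero, mul_one]
    conv_lhs => rw [h2]
    rw [← Real.exp_add, ← Real.exp_nat_mul, ← Real.exp_add]
    congr 1; ring

/-! ### Sequential halving with backtracking -/

/-- The state after a round, given the five means. -/
noncomputable def shbNext (A : (ℝ × ℝ) × List (ℝ × ℝ)) (y₁ y₂ y₃ y₄ y₅ : ℝ) :
    (ℝ × ℝ) × List (ℝ × ℝ) :=
  if |(y₁ + y₂) / 2 - (y₄ + y₅) / 2| ≤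
      max |(y₁ + y₂ + y₄) / 3 - y₅| |y₁ - (y₂ + y₄ + y₅) / 3| then
    match A.2 with
    | [] => A
    | p :: ps => (p, ps)
  else if |y₂ - y₃| ≤ |y₃ - y₄| then (((A.1.1 + A.1.2) / 2, A.1.2), A.1 :: A.2)
  else ((A.1.1, (A.1.1 + A.1.2) / 2), A.1 :: A.2)

lemma shbRound_eq (l r : ℝ) (τ : ℕ) (A : (ℝ × ℝ) × List (ℝ × ℝ)) :
    shbRound l r τ A = (sampleMean l τ).bind fun y₁ => (sampleMean A.1.1 τ).bind fun y₂ =>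
      (sampleMean ((A.1.1 + A.1.2) / 2) τ).bind fun y₃ => (sampleMean A.1.2 τ).bind fun y₄ =>
        (sampleMean r τ).bind fun y₅ => ret (shbNext A y₁ y₂ y₃ y₄ y₅) := by
  unfold shbRound shbNext
  simp only [bind_def, pure_def]
  congr 1; funext y₁; congr 1; funext y₂; congr 1; funext y₃; congr 1; funext y₄; congr 1
  funext y₅
  rcases A with ⟨w, _ | ⟨p, ps⟩⟩ <;> split_ifs <;> rfl

/-- The stack of windows: each is a half of its parent, the last one is the root `(l, r)`. -/
def IsChain (l r : ℝ) : (ℝ × ℝ) → List (ℝ × ℝ) → Prop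
  | w, [] => w = (l, r)
  | w, p :: ps =>
    (w = ((p.1 + p.2) / 2, p.2) ∨ w = (p.1, (p.1 + p.2) / 2)) ∧ IsChain l r p ps

lemma IsChain.geometry {l r : ℝ} (hlr : l < r) {w : ℝ × ℝ} {anc : List (ℝ × ℝ)}
    (h : IsChain l r w anc) :
    w.2 - w.1 = (r - l) / 2 ^ anc.length ∧ l ≤ w.1 ∧ w.2 ≤ r ∧ w.1 < w.2 := by
  induction anc generalizing w with
  | nil => subst h; simpa using hlr
  | cons p ps ih =>
    obtain ⟨h1, h2, h3, h4⟩ := ih h.2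
    have e : w.2 - w.1 = (r - l) / 2 ^ (p :: ps).length := by
      rw [List.length_cons, pow_succ, ← div_div, ← h1]
      rcases h.1 with rfl | rfl <;> simp only <;> ring
    refine ⟨e, ?_⟩
    rcases h.1 with rfl | rfl
    · exact ⟨by simp only; linarith, h3, by simp only; linarith⟩
    · exact ⟨h2, by simp only; linarith, by simp only; linarith⟩

/-- The half-open window contains `x`. -/
def InWindow (x : ℝ) (w : ℝ × ℝ) : Prop := w.1 < x ∧ x ≤ w.2

open Classical in
/-- `1` if the window contains `x` and `-1` otherwise. -/
noncomputable def windowSign (x : ℝ) (w : ℝ × ℝ) : ℤ := if InWindow x w then 1 else -1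

/-- The number of windows of the stack that contain `x` minus the number of the others, where the
root is not counted. -/
noncomputable def stackPotential (x : ℝ) (A : (ℝ × ℝ) × List (ℝ × ℝ)) : ℤ :=
  windowSign x A.1 + (A.2.map (windowSign x)).sum - 1

lemma windowSign_le (x : ℝ) (w : ℝ × ℝ) : windowSign x w ≤ 1 := by
  unfold windowSign; split_ifs <;> norm_num

lemma neg_one_le_windowSign (x : ℝ) (w : ℝ × ℝ) : -1 ≤ windowSign x w := by
  unfold windowSign; split_ifs <;> norm_num

lemma sum_windowSign_le (x : ℝ) (l : List (ℝ × ℝ)) : (l.map (windowSign x)).sum ≤ l.length := by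
  induction l with
  | nil => simp
  | cons w l ih =>
    have := windowSign_le x w
    rw [List.map_cons, List.sum_cons, List.length_cons]
    push_cast
    linarith

/-- Windows missing x are removed from the top of the stack, and each removal raises the potential.
The first remaining window contains x, and its depth is at least the potential, since each sign is
at most 1. Stack windows are nested, so the current one lies inside it. -/
lemma IsChain.exists_ancestor {l r x : ℝ} (hlr : l < r) {w : ℝ × ℝ} {anc : List (ℝ × ℝ)}
    (h : IsChain l r w anc) {D : ℕ} (hD : (D : ℤ) ≤ stackPotential x (w, anc)) :
    ∃ u : ℝ × ℝ, InWindow x u ∧ u.2 - u.1 ≤ (r - l) / 2 ^ D ∧ u.1 ≤ w.1 ∧ w.2 ≤ u.2 := by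
  induction anc generalizing w with
  | nil =>
    by_cases hw : InWindow x w
    · refine ⟨w, hw, ?_, le_rfl, le_rfl⟩
      have := windowSign_le x w
      simp only [stackPotential, List.map_nil, List.sum_nil] at hD
      obtain rfl : D = 0 := by omega
      exact (h.geometry hlr).1.le
    · simp [stackPotential, windowSign, hw] at hD
      omega
  | cons p ps ih =>
    by_cases hw : InWindow x w
    · refine ⟨w, hw, ?_, le_rfl, le_rfl⟩
      rw [(h.geometry hlr).1]
      have h1 := windowSign_le x w
      have h2 := sum_windowSign_le x (p :: ps)
      have hlr' : 0 ≤ r - l := by linarith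
      simp only [stackPotential] at hD
      refine div_le_div_of_nonneg_left hlr' (by positivity)
        (pow_le_pow_right₀ (by norm_num) (by omega))
    · have hD' : (D : ℤ) ≤ stackPotential x (p, ps) := by
        simp only [stackPotential, List.map_cons, List.sum_cons] at hD ⊢
        have : windowSign x w = -1 := by simp [windowSign, hw]
        omega
      obtain ⟨u, hu1, hu2, hu3, hu4⟩ := ih h.2 hD'
      have hp := (h.2.geometry hlr).2.2.2
      refine ⟨u, hu1, hu2, ?_, ?_⟩ <;> rcases h.1 with rfl | rfl <;> simp only <;> linarith

/-! ### The decisions of one round when all means are accurate to |Δ|/16 -/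

section decision

variable {y₁ y₂ y₃ y₄ y₅ u Δ : ℝ}

/-- With the jump between y₂ and y₄, the balanced contrast is at least 7|Δ|/8, while each unbalanced
one is at most 2|Δ|/3 + |Δ|/8. -/
lemma not_backtrack (h₁ : |y₁ - u| ≤ |Δ| / 16) (h₂ : |y₂ - u| ≤ |Δ| / 16)
    (h₄ : |y₄ - (u + Δ)| ≤ |Δ| / 16) (h₅ : |y₅ - (u + Δ)| ≤ |Δ| / 16) (hΔ : Δ ≠ 0) :
    ¬ (|(y₁ + y₂) / 2 - (y₄ + y₅) / 2| ≤
      max |(y₁ + y₂ + y₄) / 3 - y₅| |y₁ - (y₂ + y₄ + y₅) / 3|) := by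
  rw [abs_le] at h₁ h₂ h₄ h₅
  rw [not_le]
  rcases lt_or_gt_of_ne hΔ with h | h
  · rw [abs_of_neg h] at *
    refine max_lt (lt_of_lt_of_le ?_ (le_abs_self _)) (lt_of_lt_of_le ?_ (le_abs_self _)) <;>
      exact abs_lt.2 ⟨by linarith, by linarith⟩
  · rw [abs_of_pos h] at *
    refine max_lt (lt_of_lt_of_le ?_ (neg_le_abs _)) (lt_of_lt_of_le ?_ (neg_le_abs _)) <;>
      exact abs_lt.2 ⟨by linarith, by linarith⟩

/-- The balanced contrast now mixes both levels and is at most 5|Δ|/8, whereas the contrast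
isolating y₁ is at least 7|Δ|/8. -/
lemma backtrack_of_left (h₁ : |y₁ - u| ≤ |Δ| / 16) (h₂ : |y₂ - (u + Δ)| ≤ |Δ| / 16)
    (h₄ : |y₄ - (u + Δ)| ≤ |Δ| / 16) (h₅ : |y₅ - (u + Δ)| ≤ |Δ| / 16) :
    |(y₁ + y₂) / 2 - (y₄ + y₅) / 2| ≤
      max |(y₁ + y₂ + y₄) / 3 - y₅| |y₁ - (y₂ + y₄ + y₅) / 3| := by
  refine le_max_of_le_right ?_
  rw [abs_le] at h₁ h₂ h₄ h₅
  rcases le_or_gt Δ 0 with h | h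
  · rw [abs_of_nonpos h] at *
    refine le_trans ?_ (le_abs_self _)
    exact abs_le.2 ⟨by linarith, by linarith⟩
  · rw [abs_of_pos h] at *
    refine le_trans ?_ (neg_le_abs _)
    exact abs_le.2 ⟨by linarith, by linarith⟩

lemma backtrack_of_right (h₁ : |y₁ - u| ≤ |Δ| / 16) (h₂ : |y₂ - u| ≤ |Δ| / 16)
    (h₄ : |y₄ - u| ≤ |Δ| / 16) (h₅ : |y₅ - (u + Δ)| ≤ |Δ| / 16) :
    |(y₁ + y₂) / 2 - (y₄ + y₅) / 2| ≤
      max |(y₁ + y₂ + y₄) / 3 - y₅| |y₁ - (y₂ + y₄ + y₅) / 3| := by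
  refine le_max_of_le_left ?_
  rw [abs_le] at h₁ h₂ h₄ h₅
  rcases le_or_gt Δ 0 with h | h
  · rw [abs_of_nonpos h] at *
    refine le_trans ?_ (le_abs_self _)
    exact abs_le.2 ⟨by linarith, by linarith⟩
  · rw [abs_of_pos h] at *
    refine le_trans ?_ (neg_le_abs _)
    exact abs_le.2 ⟨by linarith, by linarith⟩

lemma go_right (h₂ : |y₂ - u| ≤ |Δ| / 16) (h₃ : |y₃ - u| ≤ |Δ| / 16)
    (h₄ : |y₄ - (u + Δ)| ≤ |Δ| / 16) : |y₂ - y₃| ≤ |y₃ - y₄| := by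
  rw [abs_le] at h₂ h₃ h₄
  rcases le_or_gt Δ 0 with h | h
  · rw [abs_of_nonpos h] at *
    refine le_trans ?_ (le_abs_self _)
    exact abs_le.2 ⟨by linarith, by linarith⟩
  · rw [abs_of_pos h] at *
    refine le_trans ?_ (neg_le_abs _)
    exact abs_le.2 ⟨by linarith, by linarith⟩

lemma go_left (h₂ : |y₂ - u| ≤ |Δ| / 16) (h₃ : |y₃ - (u + Δ)| ≤ |Δ| / 16)
    (h₄ : |y₄ - (u + Δ)| ≤ |Δ| / 16) (hΔ : Δ ≠ 0) : ¬ |y₂ - y₃| ≤ |y₃ - y₄| := by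
  rw [abs_le] at h₂ h₃ h₄
  rw [not_le]
  rcases lt_or_gt_of_ne hΔ with h | h
  · rw [abs_of_neg h] at *
    refine lt_of_lt_of_le ?_ (le_abs_self _)
    exact abs_lt.2 ⟨by linarith, by linarith⟩
  · rw [abs_of_pos h] at *
    refine lt_of_lt_of_le ?_ (neg_le_abs _)
    exact abs_lt.2 ⟨by linarith, by linarith⟩

end decision

section shb

variable {f : ℝ → ℝ} {ν : Measure ℝ} {l r x Δ : ℝ}

/-- On `[l, r]`, `f` has exactly one jump, of size `Δ`, at `x`. -/
structure SingleJump (f : ℝ → ℝ) (l r x Δ : ℝ) : Prop where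
  left_lt : l < x
  le_right : x ≤ r
  ne_zero : Δ ≠ 0
  eq_left : ∀ z, l ≤ z → z < x → f z = f l
  eq_right : ∀ z, x ≤ z → z ≤ r → f z = f l + Δ

lemma isChain_shbNext {A : (ℝ × ℝ) × List (ℝ × ℝ)} (h : IsChain l r A.1 A.2)
    (y₁ y₂ y₃ y₄ y₅ : ℝ) : IsChain l r (shbNext A y₁ y₂ y₃ y₄ y₅).1 (shbNext A y₁ y₂ y₃ y₄ y₅).2 := by
  unfold shbNext
  split_ifs
  · rcases A with ⟨w, _ | ⟨p, ps⟩⟩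
    exacts [h, h.2]
  · exact ⟨Or.inl rfl, h⟩
  · exact ⟨Or.inr rfl, h⟩

lemma stackPotential_shbNext_ge (A : (ℝ × ℝ) × List (ℝ × ℝ)) (y₁ y₂ y₃ y₄ y₅ : ℝ) :
    stackPotential x A - 1 ≤ stackPotential x (shbNext A y₁ y₂ y₃ y₄ y₅) := by
  unfold shbNext stackPotential
  split_ifs
  · rcases A with ⟨w, _ | ⟨p, ps⟩⟩
    · simp only; omega
    · have := windowSign_le x w
      simp only [List.map_cons, List.sum_cons]; omega
  · have := neg_one_le_windowSign x ((A.1.1 + A.1.2) / 2, A.1.2)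
    simp only [List.map_cons, List.sum_cons]; omega
  · have := neg_one_le_windowSign x (A.1.1, (A.1.1 + A.1.2) / 2)
    simp only [List.map_cons, List.sum_cons]; omega

/-- If the window contains x, the half containing x is pushed; if not, a window missing x is popped.
Both add one. The root contains x, so accurate means never ask for a backtrack from the root. -/
lemma stackPotential_shbNext_of_accurate (hf : SingleJump f l r x Δ)
    {A : (ℝ × ℝ) × List (ℝ × ℝ)} (h : IsChain l r A.1 A.2) {y₁ y₂ y₃ y₄ y₅ : ℝ}
    (h₁ : |y₁ - f l| ≤ |Δ| / 16) (h₂ : |y₂ - f A.1.1| ≤ |Δ| / 16)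
    (h₃ : |y₃ - f ((A.1.1 + A.1.2) / 2)| ≤ |Δ| / 16) (h₄ : |y₄ - f A.1.2| ≤ |Δ| / 16)
    (h₅ : |y₅ - f r| ≤ |Δ| / 16) :
    stackPotential x A + 1 ≤ stackPotential x (shbNext A y₁ y₂ y₃ y₄ y₅) := by
  have hlr : l < r := hf.left_lt.trans_le hf.le_right
  obtain ⟨-, g1, g2, g3⟩ := h.geometry hlr
  rw [hf.eq_right r hf.le_right le_rfl] at h₅
  have hsign : ∀ w : ℝ × ℝ, InWindow x w → windowSign x w = 1 := fun w hw => by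
    simp [windowSign, hw]
  unfold shbNext
  by_cases hw : InWindow x A.1
  · rw [hf.eq_left _ g1 hw.1] at h₂
    rw [hf.eq_right _ hw.2 g2] at h₄
    rw [if_neg (not_backtrack h₁ h₂ h₄ h₅ hf.ne_zero)]
    rcases lt_or_ge ((A.1.1 + A.1.2) / 2) x with hc | hc
    · rw [hf.eq_left _ (by linarith) hc] at h₃
      rw [if_pos (go_right h₂ h₃ h₄)]
      have := hsign ((A.1.1 + A.1.2) / 2, A.1.2) ⟨hc, hw.2⟩
      simp only [stackPotential, List.map_cons, List.sum_cons]; omega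
    · rw [hf.eq_right _ hc (by linarith)] at h₃
      rw [if_neg (go_left h₂ h₃ h₄ hf.ne_zero)]
      have := hsign (A.1.1, (A.1.1 + A.1.2) / 2) ⟨hw.1, hc⟩
      simp only [stackPotential, List.map_cons, List.sum_cons]; omega
  · have hback : |(y₁ + y₂) / 2 - (y₄ + y₅) / 2| ≤
        max |(y₁ + y₂ + y₄) / 3 - y₅| |y₁ - (y₂ + y₄ + y₅) / 3| := by
      rcases lt_or_ge A.1.1 x with hx | hx
      · have hx2 : A.1.2 < x := not_le.1 fun h => hw ⟨hx, h⟩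
        rw [hf.eq_left _ g1 hx] at h₂
        rw [hf.eq_left _ (by linarith) hx2] at h₄
        exact backtrack_of_right h₁ h₂ h₄ h₅
      · rw [hf.eq_right _ hx (by linarith)] at h₂
        rw [hf.eq_right _ (by linarith) g2] at h₄
        exact backtrack_of_left h₁ h₂ h₄ h₅
    rw [if_pos hback]
    have hs : windowSign x A.1 = -1 := by simp [windowSign, hw]
    rcases A with ⟨w, _ | ⟨p, ps⟩⟩
    · have : w = (l, r) := h
      subst this
      exact absurd ⟨hf.left_lt, hf.le_right⟩ hw
    · simp only [stackPotential, List.map_cons, List.sum_cons] at hs ⊢; omega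

lemma always_shbRound (f : ℝ → ℝ) (τ : ℕ) {A : (ℝ × ℝ) × List (ℝ × ℝ)} (h : IsChain l r A.1 A.2) :
    Always f (shbRound l r τ A) fun A' =>
      IsChain l r A'.1 A'.2 ∧ stackPotential x A - 1 ≤ stackPotential x A' := by
  rw [shbRound_eq]
  exact always_bind.2 (always_of_forall fun y₁ => always_bind.2 (always_of_forall fun y₂ =>
    always_bind.2 (always_of_forall fun y₃ => always_bind.2 (always_of_forall fun y₄ =>
    always_bind.2 (always_of_forall fun y₅ =>
      ⟨isChain_shbNext h y₁ y₂ y₃ y₄ y₅, stackPotential_shbNext_ge A y₁ y₂ y₃ y₄ y₅⟩)))))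

/-- A union bound over five means, each at accuracy |Δ|/16: 5·2 = 10 and 2·16² = 512. -/
lemma failLE_shbRound (hν : SubGaussianLaw ν) (hf : SingleJump f l r x Δ) (τ : ℕ)
    {A : (ℝ × ℝ) × List (ℝ × ℝ)} (h : IsChain l r A.1 A.2) :
    FailLE f ν (shbRound l r τ A) (fun A' => stackPotential x A + 1 ≤ stackPotential x A')
      (10 * Real.exp (-(τ * Δ ^ 2 / 512))) := by
  have := hν.prob
  rw [shbRound_eq]
  have hs : ∀ z, FailLE f ν (sampleMean z τ) (fun y => |y - f z| ≤ |Δ| / 16)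
      (2 * Real.exp (-(τ * Δ ^ 2 / 512))) := fun z => by
    refine (failLE_sampleMean hν z τ (r := |Δ| / 16) (by positivity)).mono (fun _ h => h)
      (le_of_eq ?_)
    rw [div_pow, sq_abs]; congr 3; ring
  set q := 2 * Real.exp (-(τ * Δ ^ 2 / 512)) with hq
  have hq0 : 0 ≤ q := by positivity
  have key := (hs l).bind (q := fun y₁ => (sampleMean A.1.1 τ).bind fun y₂ =>
      (sampleMean ((A.1.1 + A.1.2) / 2) τ).bind fun y₃ => (sampleMean A.1.2 τ).bind fun y₄ =>
        (sampleMean r τ).bind fun y₅ => ret (shbNext A y₁ y₂ y₃ y₄ y₅))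
    (Q := fun A' => stackPotential x A + 1 ≤ stackPotential x A')
    (fun y₁ h₁ => (hs A.1.1).bind (fun y₂ h₂ => (hs _).bind (fun y₃ h₃ => (hs _).bind
      (fun y₄ h₄ => (hs r).bind (δ' := 0) (fun y₅ h₅ => failLE_ret (f := f) (ν := ν)
        (Q := fun A' => stackPotential x A + 1 ≤ stackPotential x A')
        (stackPotential_shbNext_of_accurate hf h h₁ h₂ h₃ h₄ h₅) 0) hq0 le_rfl) hq0 (by linarith))
      hq0 (by linarith)) hq0 (by linarith)) hq0 (by linarith)
  exact key.mono (fun _ h => h) (by linarith)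

lemma always_shb (f : ℝ → ℝ) (hlr : l < r) (T : ℕ) (η : ℝ) :
    Always f (shb l r T η) fun c => l < c ∧ c < r := by
  unfold shb
  split_ifs
  · exact ⟨by linarith, by linarith⟩
  -- The point 0 tracked below is a dummy: only the chain part of the invariant is used.
  · refine always_bind.2 ((always_forFold_range (Inv := fun _ A => IsChain l r A.1 A.2) _
        ((l, r), []) (show IsChain l r (l, r) [] from rfl)
      fun j _ A hA => (always_shbRound (x := 0) f _ hA).mono fun A' hA' => hA'.1).mono
        fun A hA => ?_)
    obtain ⟨-, h1, h2, h3⟩ := hA.geometry hlr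
    exact ⟨by linarith, by linarith⟩

/-- Take D = ⌈y⌉ with y = log₂ ρ. Since 6 log 2 > 4, the number n of rounds exceeds 4y, and y + 1 ≤
8y/5 for y > 3. For smaller y rounding matters, and the ranges y ≤ 2 and 2 < y ≤ 3 are settled using
n ≥ 5 and n > 8. -/
lemma clog_depth_bound {ρ : ℝ} (hρ : 2 < ρ) :
    ∃ D : ℕ, ρ ≤ 2 ^ D ∧ (D : ℝ) ≤ 2 / 5 * ⌈6 * Real.log ρ⌉₊ := by
  set y := Real.logb 2 ρ with hy
  have hl2 : 0 < Real.log 2 := Real.log_pos (by norm_num)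
  have hl2' := Real.log_two_gt_d9
  have hlog : Real.log ρ = y * Real.log 2 := by rw [hy, Real.logb]; field_simp
  have hρ2 : (2 : ℝ) ^ y = ρ := Real.rpow_logb (by norm_num) (by norm_num) (by linarith)
  have hy1 : 1 < y := by
    rw [hy, Real.lt_logb_iff_rpow_lt (by norm_num) (by linarith)]; simpa using hρ
  set n := ⌈6 * Real.log ρ⌉₊ with hn
  have hn1 : 4 * y < n := by
    have := Nat.le_ceil (6 * Real.log ρ)
    rw [← hn, hlog] at this
    nlinarith
  refine ⟨⌈y⌉₊, ?_, ?_⟩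
  · rw [← hρ2, ← Real.rpow_natCast]
    exact Real.rpow_le_rpow_of_exponent_le (by norm_num) (Nat.le_ceil y)
  · rcases le_or_gt y 2 with h | h
    · have h1 : ⌈y⌉₊ ≤ 2 := Nat.ceil_le.2 (by exact_mod_cast h)
      have h2 : 5 ≤ n := by
        have : (4 : ℝ) < n := by linarith
        exact_mod_cast this
      have h1' : ((⌈y⌉₊ : ℕ) : ℝ) ≤ 2 := by exact_mod_cast h1
      have h2' : (5 : ℝ) ≤ n := by exact_mod_cast h2
      linarith
    · have := Nat.ceil_lt_add_one (by linarith : (0 : ℝ) ≤ y)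
      rcases le_or_gt y 3 with h3 | h3
      · have h1 : ⌈y⌉₊ ≤ 3 := Nat.ceil_le.2 (by exact_mod_cast h3)
        have h1' : ((⌈y⌉₊ : ℕ) : ℝ) ≤ 3 := by exact_mod_cast h1
        linarith
      · linarith

/-- `SHB` localizes the change point with high probability, in such a way that it does not coincide
with the left endpoint of the confidence interval. -/
lemma failLE_shb (hν : SubGaussianLaw ν) (hf : SingleJump f l r x Δ) (T : ℕ) {η q : ℝ}
    (hη : 0 < η)
    (hT : 2 * η < r - l → ∃ u : ℝ, 0 ≤ u ∧
      10 * Real.exp (-((T / (5 * ⌈6 * Real.log ((r - l) / η)⌉₊) : ℕ) * Δ ^ 2 / 512)) ≤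
        Real.exp (-(2 * u)) ∧
      Real.exp (⌈6 * Real.log ((r - l) / η)⌉₊ * (Real.log 2 - 3 / 5 * u)) ≤ q) :
    FailLE f ν (shb l r T η) (fun c => c - η < x ∧ x ≤ c + η) q := by
  have := hν.prob
  have hlr : l < r := hf.left_lt.trans_le hf.le_right
  unfold shb
  split_ifs with hs
  · exact failLE_ret ⟨by linarith [hf.left_lt], by linarith [hf.le_right]⟩ _
  · push Not at hs
    obtain ⟨u, hu, hT, hq'⟩ := hT hs
    -- D halvings bring the width down to η, and D ≤ 2n/5 leaves n - D ≥ 3n/5 in the exponent.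
    obtain ⟨D, hD1, hD2⟩ := clog_depth_bound (ρ := (r - l) / η) (by rwa [lt_div_iff₀ hη])
    set n := ⌈6 * Real.log ((r - l) / η)⌉₊ with hn
    have h := failLE_forFold_drift (f := f) (ν := ν) (step := shbRound l r (T / (5 * n)))
      (Ch := fun A => IsChain l r A.1 A.2) (pot := stackPotential x) hu hT
      (fun A hA => always_shbRound f _ hA) (fun A hA => failLE_shbRound hν hf _ hA)
      (List.range n) ((l, r), []) rfl
      (by simp [stackPotential, windowSign, InWindow, hf.left_lt, hf.le_right]) D
    have hch : Always f (forFold (List.range n) ((l, r), []) fun _ A => shbRound l r (T / (5 * n)) A)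
        fun A => IsChain l r A.1 A.2 :=
      always_forFold_range (Inv := fun _ A => IsChain l r A.1 A.2) _
        ((l, r), []) (show IsChain l r (l, r) [] from rfl)
        fun j _ A hA => (always_shbRound (x := 0) f _ hA).mono fun A' hA' => hA'.1
    have h2 := (h.and_always hch).bind (q := fun A => ret ((A.1.1 + A.1.2) / 2)) (δ' := 0)
      (Q := fun c => c - η < x ∧ x ≤ c + η) (fun A hA => failLE_ret ?_ _) (by positivity) le_rfl
    · refine FailLE.mono h2 (fun _ h => h) (le_trans ?_ hq')
      rw [add_zero, List.length_range]
      apply Real.exp_le_exp.2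
      nlinarith
    · obtain ⟨w, hw1, hw2, hw3, hw4⟩ := hA.2.exists_ancestor hlr hA.1
      have hg := (hA.2.geometry hlr).2.2.2
      have : (r - l) / 2 ^ D ≤ η := by
        rw [div_le_iff₀ (by positivity)]
        rw [div_le_iff₀ hη] at hD1
        linarith
      exact ⟨by linarith [hw1.1], by linarith [hw1.2]⟩

end shb

/-! ### Verification -/

section verification

variable {f : ℝ → ℝ} {ν : Measure ℝ}

/-- The threshold of the verification test. -/
noncomputable def verifyThreshold (δ : ℝ) (T : ℕ) : ℝ := √(16 / T * Real.log (2 / δ))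

lemma failLE_verifyCP_pair (hν : SubGaussianLaw ν) (xl xr : ℝ) {δ : ℝ} (hδ : 0 < δ) (hδ1 : δ ≤ 1)
    {T : ℕ} (hT : 2 ≤ T) {Q : Bool → Prop}
    (hQ : ∀ yl yr : ℝ, |(yr - yl) - (f xr - f xl)| ≤ verifyThreshold δ T →
      Q (decide (2 ≤ T ∧ verifyThreshold δ T < |yr - yl|))) :
    FailLE f ν (verifyCP xl xr δ T) Q δ := by
  have h := failLE_sampleMean_pair (f := f) hν xl xr (T / 2)
    (r := verifyThreshold δ T) (Real.sqrt_nonneg _)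
    (g := fun yl yr => decide (2 ≤ T ∧ verifyThreshold δ T < |yr - yl|)) hQ
  refine FailLE.mono (p := verifyCP xl xr δ T) h (fun _ h => h) ?_
  have hT0 : (0 : ℝ) < T := by positivity
  have hlog : 0 ≤ Real.log (2 / δ) := Real.log_nonneg (by rw [le_div_iff₀ hδ]; linarith)
  have hsq : verifyThreshold δ T ^ 2 = 16 / T * Real.log (2 / δ) :=
    Real.sq_sqrt (by positivity)
  -- Rounding down T/2 loses at most a factor two once T ≥ 2; the constant 16 in the threshold
  -- absorbs it.
  have h3 : (T : ℝ) ≤ 4 * ((T / 2 : ℕ) : ℝ) := by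
    have : T ≤ 4 * (T / 2) := by omega
    exact_mod_cast this
  have h4 : Real.log (2 / δ) ≤ ((T / 2 : ℕ) : ℝ) * verifyThreshold δ T ^ 2 / 4 := by
    rw [hsq, show ((T / 2 : ℕ) : ℝ) * (16 / T * Real.log (2 / δ)) / 4 =
      (4 * ((T / 2 : ℕ) : ℝ) / T) * Real.log (2 / δ) by ring]
    exact le_mul_of_one_le_left hlog (by rwa [le_div_iff₀ hT0, one_mul])
  calc 2 * Real.exp (-(((T / 2 : ℕ) : ℝ) * verifyThreshold δ T ^ 2 / 4))
      ≤ 2 * Real.exp (-Real.log (2 / δ)) := by gcongr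
    _ = δ := by rw [Real.exp_neg, Real.exp_log (by positivity)]; field_simp

lemma failLE_verifyCP_of_eq (hν : SubGaussianLaw ν) {xl xr : ℝ} (h : f xr = f xl) {δ : ℝ}
    (hδ : 0 < δ) (hδ1 : δ ≤ 1) (T : ℕ) :
    FailLE f ν (verifyCP xl xr δ T) (fun ok => ok = false) δ := by
  have := hν.prob
  rcases lt_or_ge T 2 with hT | hT
  · refine (Always.failLE ?_).mono (fun _ h => h) hδ.le
    exact always_bind.2 (always_of_forall fun yl => always_bind.2 (always_of_forall fun yr =>
      decide_eq_false fun h => by omega))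
  · refine failLE_verifyCP_pair hν xl xr hδ hδ1 hT fun yl yr hy => decide_eq_false fun hc => ?_
    rw [h, sub_self, sub_zero] at hy
    exact absurd hc.2 (not_lt.2 hy)

lemma failLE_verifyCP_of_gap (hν : SubGaussianLaw ν) {xl xr : ℝ} {δ : ℝ} (hδ : 0 < δ) (hδ1 : δ ≤ 1)
    {T : ℕ} (hT : 2 ≤ T) (h : 2 * verifyThreshold δ T < |f xr - f xl|) :
    FailLE f ν (verifyCP xl xr δ T) (fun ok => ok = true) δ := by
  refine failLE_verifyCP_pair hν xl xr hδ hδ1 hT fun yl yr hy => decide_eq_true ⟨hT, ?_⟩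
  have h1 := abs_sub_abs_le_abs_sub (f xr - f xl) (yr - yl)
  rw [abs_sub_comm (f xr - f xl)] at h1
  linarith

end verification

end ChangePoint

namespace ChangePoint

open Prog

/-! ### Correctness of the output of a stage -/

section lists

lemma exists_zip_of_forall₂ {α β γ δ : Type} {R : α → β → Prop} (g : α → γ) (g' : β → δ)
    {l : List α} {l' : List β} (h : List.Forall₂ R l l') :
    ∃ Z : List (γ × δ), Z.map Prod.fst = l.map g ∧ Z.map Prod.snd = l'.map g' ∧
      ∀ z ∈ Z, ∃ a ∈ l, ∃ b ∈ l', R a b ∧ z = (g a, g' b) := by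
  induction h with
  | nil => exact ⟨[], rfl, rfl, by simp⟩
  | @cons a b l l' hab _ ih =>
    obtain ⟨Z, h1, h2, h3⟩ := ih
    refine ⟨(g a, g' b) :: Z, by simp [h1], by simp [h2], fun z hz => ?_⟩
    rcases List.mem_cons.1 hz with rfl | hz
    · exact ⟨a, by simp, b, by simp, hab, rfl⟩
    · obtain ⟨a', ha', b', hb', h⟩ := h3 z hz
      exact ⟨a', by simp [ha'], b', by simp [hb'], h⟩

lemma exists_sorted_of_map {γ : Type} (Z : List (γ × ℝ)) :
    ∃ Z' : List (γ × ℝ), Z'.Perm Z ∧ Z'.map Prod.snd = (Z.map Prod.snd).insertionSort (· ≤ ·) := by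
  refine ⟨Z.insertionSort fun a b => a.2 ≤ b.2, List.perm_insertionSort _ _, ?_⟩
  have : Std.Total fun a b : γ × ℝ => a.2 ≤ b.2 := ⟨fun a b => le_total _ _⟩
  have : IsTrans (γ × ℝ) fun a b => a.2 ≤ b.2 := ⟨fun _ _ _ => le_trans⟩
  refine List.Perm.eq_of_pairwise' (r := (· ≤ ·)) ?_ (List.pairwise_insertionSort _ _)
    (((List.perm_insertionSort _ _).map _).trans (List.perm_insertionSort _ _).symm)
  rw [List.pairwise_map]
  exact List.pairwise_insertionSort _ _

/-- In an increasing list the first entries have the smallest sum among all sublists of the same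
length. -/
lemma sum_take_le_of_sublist {a b : List ℝ} (ha : a.Pairwise (· ≤ ·)) (h : b.Sublist a) :
    (a.take b.length).sum ≤ b.sum := by
  induction a generalizing b with
  | nil => simp [List.sublist_nil.1 h]
  | cons x a ih =>
    obtain ⟨hx, ha⟩ := List.pairwise_cons.1 ha
    rcases b with _ | ⟨y, b⟩
    · simp
    · have hxy : x ≤ y ∧ b.Sublist a := by
        rcases List.cons_sublist_cons'.1 h with h' | ⟨h1, h'⟩
        · exact ⟨hx y (h'.subset (by simp)), (List.sublist_cons_self y b).trans h'⟩
        · exact ⟨h1.ge, h'⟩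
      rw [List.length_cons, List.take_succ_cons, List.sum_cons, List.sum_cons]
      linarith [ih ha hxy.2]

end lists

section output

variable {m : ℕ} {S : StepModel m} {N : ℕ}

/-- The output is increasing, lies in the unit interval, and localizes distinct change points. -/
def GoodOutput (S : StepModel m) (η : ℝ) (xhat : Fin N → ℝ) : Prop :=
  StrictMono xhat ∧ (∀ l, 0 ≤ xhat l ∧ xhat l ≤ 1) ∧ S.Localized η xhat

/-- Each point shares an interval with its change point and the intervals do not overlap. Sorting
the points therefore sorts the intervals and with them the change points, which are then distinct.
-/
lemma goodOutput_of_disj {η : ℝ} {Z : List (Dyadic × ℝ)} (hlen : Z.length = N)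
    (hcell : ∀ z ∈ Z, z.1.2 < 2 ^ z.1.1) (hdisj : Z.Pairwise fun z z' => z.1.Disj z'.1)
    (hZ : ∀ z ∈ Z, z.1.left < z.2 ∧ z.2 < z.1.right ∧ ∃ i, z.1.Mem (S.x i) ∧ |z.2 - S.x i| ≤ η) :
    GoodOutput S η fun v : Fin N => ((Z.map Prod.snd).insertionSort (· ≤ ·)).getD v 0 := by
  obtain ⟨Z', hperm, hmap⟩ := exists_sorted_of_map Z
  have hlen' : Z'.length = N := by rw [hperm.length_eq, hlen]
  have hmem : ∀ v : Fin N, Z'[v.val]'(by rw [hlen']; exact v.2) ∈ Z := fun v =>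
    hperm.subset (List.getElem_mem _)
  have hdisj' : Z'.Pairwise fun z z' => z.1.Disj z'.1 :=
    (hperm.pairwise_iff fun h => Or.symm h).2 hdisj
  have hsorted : Z'.Pairwise fun z z' => z.2 ≤ z'.2 := by
    rw [← List.pairwise_map (f := Prod.snd) (R := (· ≤ ·)), hmap]
    exact List.pairwise_insertionSort _ _
  have hval : ∀ v : Fin N, ((Z.map Prod.snd).insertionSort (· ≤ ·)).getD v 0 =
      (Z'[v.val]'(by rw [hlen']; exact v.2)).2 := by
    intro v
    rw [← hmap, List.getD_eq_getElem _ _ (by rw [List.length_map, hlen']; exact v.2)]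
    simp
  have hsep : ∀ v w : Fin N, v < w → (Z'[v.val]'(by rw [hlen']; exact v.2)).1.right ≤
      (Z'[w.val]'(by rw [hlen']; exact w.2)).1.left := by
    intro v w hvw
    have hv : v.val < Z'.length := by rw [hlen']; exact v.2
    have hw : w.val < Z'.length := by rw [hlen']; exact w.2
    have h1 := List.pairwise_iff_getElem.1 hdisj' v w hv hw hvw
    have h2 := List.pairwise_iff_getElem.1 hsorted v w hv hw hvw
    rcases h1 with h1 | h1
    · exact h1
    · linarith [(hZ _ (hmem v)).1, (hZ _ (hmem w)).2.1]
  simp only [hval]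
  choose i hi using fun v => (hZ _ (hmem v)).2.2
  refine ⟨fun v w hvw => ?_, fun v => ⟨?_, ?_⟩, i, fun v w hvw => ?_, fun v => (hi v).2⟩
  · simp only
    linarith [hsep v w hvw, (hZ _ (hmem v)).2.1, (hZ _ (hmem w)).1]
  · exact (Dyadic.left_nonneg _).trans (hZ _ (hmem v)).1.le
  · exact (hZ _ (hmem v)).2.1.le.trans (Dyadic.right_le_one (hcell _ (hmem v)))
  · rw [← S.x_strictMono.lt_iff_lt]
    linarith [hsep v w hvw, (hi v).1.2, (hi w).1.1]

lemma length_selectLargest {acc : List (Dyadic × ℝ)} (h : N ≤ acc.length) :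
    (selectLargest N acc).length = N := by
  simp [selectLargest, h]

lemma mem_of_mem_selectLargest {acc : List (Dyadic × ℝ)} {p : Dyadic × ℝ}
    (h : p ∈ selectLargest N acc) : p ∈ acc :=
  (List.perm_insertionSort _ _).subset (List.mem_of_mem_take h)

lemma pairwise_disj_selectLargest {L : List Dyadic} {acc : List (Dyadic × ℝ)} {rest : List Dyadic}
    (hL : L.Pairwise Dyadic.Disj) (hacc : (acc.map Prod.fst ++ rest).Perm L) :
    ((selectLargest N acc).map Prod.fst).Pairwise Dyadic.Disj := by
  have h1 : (acc.map Prod.fst).Pairwise Dyadic.Disj :=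
    (List.pairwise_append.1 ((hacc.pairwise_iff fun h => Or.symm h).2 hL)).1
  have h2 : ((acc.insertionSort fun p q => q.2 ≤ p.2).map Prod.fst).Pairwise Dyadic.Disj :=
    (((List.perm_insertionSort _ acc).map Prod.fst).pairwise_iff fun h => Or.symm h).2 h1
  exact h2.sublist ((List.take_sublist _ _).map _)

lemma goodOutput_of_forall₂ {η : ℝ} {L : List Dyadic} (hcell : ∀ J ∈ L, J.2 < 2 ^ J.1)
    (hL : L.Pairwise Dyadic.Disj) {acc : List (Dyadic × ℝ)} {rest : List Dyadic}
    (hacc : (acc.map Prod.fst ++ rest).Perm L) (hN : N ≤ acc.length) {res : List (ℝ × Bool)}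
    (hres : List.Forall₂ (fun (p : Dyadic × ℝ) (c : ℝ × Bool) =>
      (p.1.left < c.1 ∧ c.1 < p.1.right) ∧
        (c.2 = true → ∃ i, p.1.Mem (S.x i) ∧ |c.1 - S.x i| ≤ η)) (selectLargest N acc) res)
    {xhat : Fin N → ℝ} (h : stageOutput N res = some xhat) : GoodOutput S η xhat := by
  unfold stageOutput at h
  split_ifs at h with hall
  · rw [Option.some.injEq] at h
    subst h
    obtain ⟨Z, h1, h2, h3⟩ := exists_zip_of_forall₂ Prod.fst Prod.fst hres
    rw [← h2]
    refine goodOutput_of_disj ?_ ?_ ?_ ?_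
    · rw [← length_selectLargest hN, ← List.length_map (f := Prod.fst), h1, List.length_map]
    · intro z hz
      obtain ⟨p, hp, c, hc, hpc, rfl⟩ := h3 z hz
      have hmem : p.1 ∈ acc.map Prod.fst := List.mem_map_of_mem (mem_of_mem_selectLargest hp)
      exact hcell _ (hacc.subset (List.mem_append_left _ hmem))
    · rw [← List.pairwise_map (f := Prod.fst) (R := Dyadic.Disj), h1]
      exact pairwise_disj_selectLargest hL hacc
    · intro z hz
      obtain ⟨p, hp, c, hc, hpc, rfl⟩ := h3 z hz
      exact ⟨hpc.1.1, hpc.1.2, hpc.2 (List.all_eq_true.1 hall c hc)⟩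

variable {ν : Measure ℝ}

lemma stageDelta_pos {δ : ℝ} (hδ : 0 < δ) {k : ℕ} (hN : 1 ≤ N) (hk : 1 ≤ k) :
    0 < stageDelta N δ k := by
  have : (0 : ℝ) < N := by exact_mod_cast hN
  have : (0 : ℝ) < k := by exact_mod_cast hk
  have := Real.pi_pos
  unfold stageDelta
  positivity

lemma mul_stageDelta {δ : ℝ} {k : ℕ} (hN : 1 ≤ N) :
    N * stageDelta N δ k = 3 * δ / (2 * Real.pi ^ 2) * (1 / (k : ℝ) ^ 2) := by
  have : (0 : ℝ) < N := by exact_mod_cast hN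
  unfold stageDelta
  rw [div_mul_div_comm, mul_div_assoc']
  rw [show 2 * Real.pi ^ 2 * N * (k : ℝ) ^ 2 = N * (2 * Real.pi ^ 2 * (k : ℝ) ^ 2) by ring,
    mul_div_mul_left _ _ this.ne', mul_one]

lemma stageDelta_le_one {δ : ℝ} (hδ1 : δ ≤ 1) {k : ℕ} (hN : 1 ≤ N) (hk : 1 ≤ k) :
    stageDelta N δ k ≤ 1 := by
  have h1 : (1 : ℝ) ≤ N := by exact_mod_cast hN
  have h2 : (1 : ℝ) ≤ (k : ℝ) ^ 2 := one_le_pow₀ (by exact_mod_cast hk)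
  have h3 := pi_sq_gt_nine
  unfold stageDelta
  rw [div_le_one (by positivity)]
  calc 3 * δ ≤ 2 * Real.pi ^ 2 * 1 * 1 := by nlinarith
    _ ≤ 2 * Real.pi ^ 2 * N * k ^ 2 := by gcongr

/-- If no change point of the interval is within η of c, then f does not vary between the two test
points and the test is rarely positive. Nothing is assumed about how the interval or c was found,
except that c lies inside the interval. -/
lemma failLE_localizeStep_correct (hν : SubGaussianLaw ν) {δ η : ℝ} (hδ : 0 < δ) (hδ1 : δ ≤ 1)
    (hη : 0 < η) {k : ℕ} (hN : 1 ≤ N) (hk : 1 ≤ k) (W : ℝ) (p : Dyadic × ℝ) :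
    FailLE S.f ν (localizeStep N δ η k W p) (fun c => (p.1.left < c.1 ∧ c.1 < p.1.right) ∧
      (c.2 = true → ∃ i, p.1.Mem (S.x i) ∧ |c.1 - S.x i| ≤ η)) (stageDelta N δ k) := by
  have := hν.prob
  have hpos := stageDelta_pos hδ hN hk
  have h1 : ∀ c : ℝ, p.1.left < c ∧ c < p.1.right →
      FailLE S.f ν ((verifyCP (max p.1.left (c - η)) (min p.1.right (c + η)) (stageDelta N δ k)
        (max ⌊(p.2 ^ 2)⁻¹ / W * 2 ^ k⌋₊ 1)).bind fun ok => ret (c, ok))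
      (fun c => (p.1.left < c.1 ∧ c.1 < p.1.right) ∧
      (c.2 = true → ∃ i, p.1.Mem (S.x i) ∧ |c.1 - S.x i| ≤ η)) (stageDelta N δ k) := by
    intro c hc
    by_cases hex : ∃ i, p.1.Mem (S.x i) ∧ |c - S.x i| ≤ η
    · refine (Always.failLE ?_).mono (fun _ h => h) hpos.le
      exact always_bind.2 (always_of_forall fun ok => ⟨hc, fun _ => hex⟩)
    · have hf : S.f (min p.1.right (c + η)) = S.f (max p.1.left (c - η)) := by
        refine S.f_eq_of_forall ?_ fun i hi => hex ⟨i, ⟨?_, ?_⟩, ?_⟩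
        · exact max_le (le_min (hc.1.trans hc.2).le (by linarith [hc.1]))
            (le_min (by linarith [hc.2]) (by linarith))
        · exact (le_max_left _ _).trans_lt hi.1
        · exact hi.2.trans (min_le_left _ _)
        · have h1 := (le_max_right _ _).trans_lt hi.1
          have h2 := hi.2.trans (min_le_right _ _)
          exact abs_le.2 ⟨by linarith, by linarith⟩
      have h := (failLE_verifyCP_of_eq hν hf hpos (stageDelta_le_one hδ1 hN hk)
        (max ⌊(p.2 ^ 2)⁻¹ / W * 2 ^ k⌋₊ 1)).bind (q := fun ok => ret (c, ok)) (δ' := 0)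
        (Q := fun c => (p.1.left < c.1 ∧ c.1 < p.1.right) ∧
          (c.2 = true → ∃ i, p.1.Mem (S.x i) ∧ |c.1 - S.x i| ≤ η))
        (fun ok hok => failLE_ret ⟨hc, fun h => by simp [hok] at h⟩ _) hpos.le le_rfl
      exact h.mono (fun _ h => h) (by linarith)
  have h2 := (always_shb S.f p.1.left_lt_right (max ⌊(p.2 ^ 2)⁻¹ / W * 2 ^ k⌋₊ 1) η).failLE
    (ν := ν)
  have h3 := h2.bind (fun c hc => h1 c hc) le_rfl hpos.le
  rw [zero_add] at h3
  exact h3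

/-- A stage returns a wrong output with small probability. -/
lemma failLE_stage_correct (hν : SubGaussianLaw ν) {δ η : ℝ} (hδ : 0 < δ) (hδ1 : δ ≤ 1)
    (hη : 0 < η) (δexp : ℝ) {k : ℕ} (hN : 1 ≤ N) (hk : 1 ≤ k) :
    FailLE S.f ν (stage N δ η δexp k) (fun o => ∀ xhat, o = some xhat → GoodOutput S η xhat)
      (N * stageDelta N δ k) := by
  have := hν.prob
  have hpos := stageDelta_pos hδ hN hk
  have hpos' : 0 ≤ N * stageDelta N δ k := by positivity
  rw [stage_eq]
  have h1 := (always_detectIntervals S.f (δexp / 4) (2 ^ k)).failLE (ν := ν)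
  refine FailLE.mono (h1.bind (δ' := N * stageDelta N δ k) (fun L hL => ?_) le_rfl hpos')
    (fun _ h => h) (by rw [zero_add])
  split_ifs
  · have h2 := (always_estimateJumps S.f L (δexp / 4) (2 ^ k) N).failLE (ν := ν)
    refine FailLE.mono (h2.bind (δ' := N * stageDelta N δ k) (fun acc hacc => ?_) le_rfl hpos')
      (fun _ h => h) (by rw [zero_add])
    split_ifs with hN'
    · obtain ⟨rest, hrest⟩ := hacc
      have h3 := failLE_forEach (δ := fun _ => stageDelta N δ k) (fun _ => hpos.le)
        (selectLargest N acc) fun p _ => failLE_localizeStep_correct (S := S) hν hδ hδ1 hη hN hk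
          (totalWeight (selectLargest N acc)) p
      rw [List.map_const', List.sum_replicate, length_selectLargest hN', nsmul_eq_mul] at h3
      refine FailLE.mono (h3.bind (δ' := 0) (fun res hres => failLE_ret (fun xhat hx => ?_) _)
        hpos' le_rfl) (fun _ h => h) (by rw [add_zero])
      exact goodOutput_of_forall₂ hL.1 hL.2 hrest hN' hres hx
    · exact failLE_ret (by simp) _
  · exact failLE_ret (by simp) _

end output

/-! ### The weight of the selected intervals -/

section weight

variable {m : ℕ} {S : StepModel m} {N : ℕ}

lemma Isolates.gap_eq {J : Dyadic} {i : Fin m} (h : Isolates S J i) : J.gap S.f = |S.jump i| := by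
  rw [Dyadic.gap, S.f_sub_eq_jump J.left_lt_right.le i h]

lemma Hlocalize_eq (S : StepModel m) (h : N ≤ m) :
    S.Hlocalize N = ∑ l : Fin N, 1 / S.sortedJump (Fin.castLE h l) ^ 2 := by
  unfold StepModel.Hlocalize
  symm
  refine Finset.sum_bij (fun l _ => Fin.castLE h l) ?_ ?_ ?_ ?_
  · intro l _; simp
  · intro a _ b _ hab; exact Fin.castLE_injective h hab
  · intro b hb
    simp only [Finset.mem_filter, Finset.mem_univ, true_and] at hb
    exact ⟨⟨b.val, hb⟩, by simp, by ext; simp⟩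
  · intro _ _; rfl

/-- The selected intervals have the N smallest weights even among all candidates, once the
unaccepted ones are given the estimate θ. They are compared with the intervals of the N largest true
jumps, whose estimates are at least 2/3 of these jumps. -/
lemma totalWeight_selectLargest_le {I : Fin m → Dyadic} (hI : ∀ i, Isolates S (I i) i)
    {L : List Dyadic} (hL : L.Perm (List.ofFn I)) {acc : List (Dyadic × ℝ)}
    (hacc : GoodEstimates S.f L N acc) (hN : N ≤ m) :
    totalWeight (selectLargest N acc) ≤ 9 / 4 * S.Hlocalize N := by
  obtain ⟨rest, hrest, θ, hθ1, hθ2⟩ := hacc.rest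
  -- Unaccepted intervals receive the fictitious estimate θ: it is below all accepted estimates, and
  -- still at least 2/3 of their gaps.
  set F : List (Dyadic × ℝ) := acc ++ rest.map fun J => (J, θ) with hF
  have hFfst : F.map Prod.fst = acc.map Prod.fst ++ rest := by
    simp [hF, Function.comp_def]
  have hF2 : List.Forall₂ (fun (J : Dyadic) (p : Dyadic × ℝ) => p.1 = J) (F.map Prod.fst) F := by
    rw [List.forall₂_map_left_iff, List.forall₂_same]
    exact fun _ _ => rfl
  have hperm : (List.ofFn I).Perm (F.map Prod.fst) := by
    rw [hFfst]; exact (hrest.trans hL).symm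
  obtain ⟨w, hw1, hw2⟩ := List.perm_comp_forall₂ hperm hF2
  obtain ⟨hlen, hget⟩ := List.forall₂_iff_get.1 hw1
  rw [List.length_ofFn] at hlen
  set e : Fin m → Dyadic × ℝ := fun i => w.get (i.cast hlen) with he
  have he1 : ∀ i, (e i).1 = I i := by
    intro i
    have := hget i (by simp) (by rw [← hlen]; exact i.2)
    simpa [he] using this
  have hw : w = (List.finRange m).map e := by
    apply List.ext_getElem
    · simp [hlen]
    · intro i h1 h2; simp [he]
  have hposF : ∀ p ∈ F, 2 / 3 * p.1.gap S.f ≤ p.2 := by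
    intro p hp
    rcases List.mem_append.1 hp with hp | hp
    · exact (hacc.accurate p hp).1
    · obtain ⟨J, hJ, rfl⟩ := List.mem_map.1 hp
      have := hθ2 J hJ
      simp only
      linarith
  have hgapF : ∀ p ∈ F, 0 < p.1.gap S.f := by
    intro p hp
    have : p.1 ∈ List.ofFn I := hperm.symm.subset (List.mem_map_of_mem hp)
    rw [List.mem_ofFn'] at this
    obtain ⟨i, hi⟩ := this
    rw [← hi, (hI i).gap_eq]
    exact S.abs_jump_pos i
  set wt : Dyadic × ℝ → ℝ := fun p => (p.2 ^ 2)⁻¹ with hwt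
  set srt := acc.insertionSort fun p q => q.2 ≤ p.2 with hsrt
  have hsp : srt.Perm acc := List.perm_insertionSort _ _
  set a : List ℝ := (srt ++ rest.map fun J => (J, θ)).map wt with ha
  have hFa : (srt ++ rest.map fun J => (J, θ)).Perm F := hsp.append_right _
  have hsorted : a.Pairwise (· ≤ ·) := by
    rw [ha, List.pairwise_map]
    have h1 : (srt ++ rest.map fun J => (J, θ)).Pairwise fun p q => q.2 ≤ p.2 := by
      have : Std.Total fun p q : Dyadic × ℝ => q.2 ≤ p.2 := ⟨fun _ _ => le_total _ _⟩
      have : IsTrans (Dyadic × ℝ) fun p q => q.2 ≤ p.2 := ⟨fun _ _ _ h h' => h'.trans h⟩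
      refine List.pairwise_append.2 ⟨List.pairwise_insertionSort _ _, ?_, ?_⟩
      · rw [List.pairwise_map]
        exact List.pairwise_of_forall fun _ _ => le_rfl
      · intro p hp q hq
        obtain ⟨J, -, rfl⟩ := List.mem_map.1 hq
        exact hθ1 p (hsp.subset hp)
    refine h1.imp_of_mem fun {p q} _ hq hpq => ?_
    have hq' := hFa.subset hq
    have : 0 < q.2 := by linarith [hposF q hq', hgapF q hq']
    simp only [hwt]
    gcongr
  set σ := Tuple.sort fun i => -|S.jump i| with hσ
  -- The competitor: the weights of the N intervals with the largest true jumps.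
  set b : List ℝ := (List.ofFn fun l : Fin N => σ (Fin.castLE hN l)).map (wt ∘ e) with hb
  have hblen : b.length = N := by simp [hb]
  have hsub : List.Subperm b a := by
    have h1 : List.Subperm (List.ofFn fun l : Fin N => σ (Fin.castLE hN l)) (List.finRange m) := by
      refine List.subperm_of_subset ?_ fun i _ => List.mem_finRange i
      rw [List.nodup_ofFn]
      exact σ.injective.comp (Fin.castLE_injective hN)
    obtain ⟨c, hc1, hc2⟩ := h1
    have h2 : ((List.finRange m).map (wt ∘ e)).Perm a := by
      rw [← List.map_map, ← hw]
      exact (hw2.trans hFa.symm).map wt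
    exact List.Subperm.trans ⟨c.map (wt ∘ e), hc1.map _, hc2.map _⟩ h2.subperm
  obtain ⟨b', hb'1, hb'2⟩ := hsub
  have hfinal := sum_take_le_of_sublist hsorted hb'2
  rw [hb'1.length_eq, hblen, hb'1.sum_eq] at hfinal
  have htake : a.take N = (selectLargest N acc).map wt := by
    rw [ha, ← List.map_take, List.take_append_of_le_length (by rw [hsp.length_eq]; exact hacc.card)]
    rfl
  rw [htake] at hfinal
  refine hfinal.trans ?_
  rw [hb, List.map_ofFn, List.sum_ofFn, Hlocalize_eq S hN, Finset.mul_sum]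
  refine Finset.sum_le_sum fun l _ => ?_
  set i := σ (Fin.castLE hN l) with hi
  have heF : e i ∈ F := hw2.subset (List.get_mem _ _)
  have h1 := hposF _ heF
  rw [he1, (hI i).gap_eq] at h1
  have h2 := S.abs_jump_pos i
  have h3 : S.sortedJump (Fin.castLE hN l) = |S.jump i| := rfl
  rw [h3]
  simp only [Function.comp_apply, hwt, ← hi]
  calc ((e i).2 ^ 2)⁻¹ ≤ ((2 / 3 * |S.jump i|) ^ 2)⁻¹ := by gcongr
    _ = 9 / 4 * (1 / |S.jump i| ^ 2) := by rw [mul_pow]; field_simp; norm_num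

end weight

end ChangePoint

namespace ChangePoint

open Prog

/-! ### Relations between the complexity parameters -/

namespace StepModel

variable {m : ℕ} (S : StepModel m)

lemma sq_jump_pos (i : Fin m) : 0 < S.jump i ^ 2 := by
  have := S.jump_ne_zero i
  positivity

lemma sq_jump_le_one (i : Fin m) : S.jump i ^ 2 ≤ 1 := by
  rw [← sq_abs]
  exact pow_le_one₀ (abs_nonneg _) (S.abs_jump_le_one i)

lemma energySq_pos (i : Fin m) : 0 < S.energySq i := mul_pos (S.s_pos i) (S.sq_jump_pos i)

lemma energySq_le_s (i : Fin m) : S.energySq i ≤ S.s i :=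
  mul_le_of_le_one_right (S.s_pos i).le (S.sq_jump_le_one i)

lemma energySq_le_sq_jump (i : Fin m) : S.energySq i ≤ S.jump i ^ 2 :=
  mul_le_of_le_one_left (S.sq_jump_pos i).le (S.s_le_one i)

lemma inv_energySq_le_Hdetect (i : Fin m) : 1 / S.energySq i ≤ S.Hdetect :=
  le_ciSup (f := fun i => 1 / S.energySq i) (Set.finite_range _).bddAbove i

lemma inv_s_le_inv_energySq (i : Fin m) : 1 / S.s i ≤ 1 / S.energySq i :=
  one_div_le_one_div_of_le (S.energySq_pos i) (S.energySq_le_s i)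

lemma inv_s_le_Hdetect (i : Fin m) : 1 / S.s i ≤ S.Hdetect :=
  (S.inv_s_le_inv_energySq i).trans (S.inv_energySq_le_Hdetect i)

lemma one_le_inv_s (i : Fin m) : 1 ≤ 1 / S.s i := by
  rw [le_div_iff₀ (S.s_pos i), one_mul]
  exact S.s_le_one i

lemma one_le_Hdetect (hm : 0 < m) : 1 ≤ S.Hdetect :=
  (S.one_le_inv_s ⟨0, hm⟩).trans (S.inv_s_le_Hdetect _)

lemma omega1_nonneg (hm : 0 < m) : 0 ≤ S.omega1 := Real.log_nonneg (S.one_le_Hdetect hm)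

lemma le_omega2 (i : Fin m) :
    Real.log (max (Real.log (1 / S.energySq i)) (Real.exp 1)) + Real.log (1 / S.s i) ≤ S.omega2 :=
  le_ciSup (f := fun i => Real.log (max (Real.log (1 / S.energySq i)) (Real.exp 1)) +
    Real.log (1 / S.s i)) (Set.finite_range _).bddAbove i

lemma one_le_log_max_exp (y : ℝ) : 1 ≤ Real.log (max y (Real.exp 1)) := by
  rw [Real.le_log_iff_exp_le (by positivity)]
  exact le_max_right _ _

lemma log_inv_s_nonneg (i : Fin m) : 0 ≤ Real.log (1 / S.s i) := Real.log_nonneg (S.one_le_inv_s i)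

lemma log_inv_s_add_one_le (i : Fin m) : Real.log (1 / S.s i) + 1 ≤ S.omega2 := by
  linarith [S.le_omega2 i, one_le_log_max_exp (Real.log (1 / S.energySq i))]

lemma log_max_log_inv_energySq_le (i : Fin m) :
    Real.log (max (Real.log (1 / S.energySq i)) (Real.exp 1)) ≤ S.omega2 := by
  linarith [S.le_omega2 i, S.log_inv_s_nonneg i]

lemma one_le_omega2 (hm : 0 < m) : 1 ≤ S.omega2 := by
  linarith [S.log_inv_s_add_one_le ⟨0, hm⟩, S.log_inv_s_nonneg ⟨0, hm⟩]

/-- H_detect is attained at some i, and the iterated logarithm for this i already occurs in ω₂. -/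
lemma log_max_omega1_le (hm : 0 < m) :
    Real.log (max S.omega1 (Real.exp 1)) ≤ S.omega2 := by
  have : Nonempty (Fin m) := ⟨⟨0, hm⟩⟩
  obtain ⟨i, hi⟩ := exists_eq_ciSup_of_finite (f := fun i => 1 / S.energySq i)
  have h : S.omega1 = Real.log (1 / S.energySq i) := by
    unfold omega1 Hdetect
    rw [← hi]
  rw [h]
  exact S.log_max_log_inv_energySq_le i

lemma omega2_le (hm : 0 < m) : S.omega2 ≤ 1 + 2 * S.omega1 := by
  have : Nonempty (Fin m) := ⟨⟨0, hm⟩⟩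
  have h0 := S.omega1_nonneg hm
  refine ciSup_le fun i => ?_
  have hE : 0 < 1 / S.energySq i := one_div_pos.2 (S.energySq_pos i)
  have h1 : Real.log (1 / S.energySq i) ≤ S.omega1 :=
    Real.log_le_log hE (S.inv_energySq_le_Hdetect i)
  have h2 : Real.log (1 / S.s i) ≤ S.omega1 :=
    Real.log_le_log (one_div_pos.2 (S.s_pos i)) (S.inv_s_le_Hdetect i)
  have h3 : Real.log (max (Real.log (1 / S.energySq i)) (Real.exp 1)) ≤ 1 + S.omega1 := by
    rcases le_total (Real.log (1 / S.energySq i)) (Real.exp 1) with h | h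
    · rw [max_eq_right h, Real.log_exp]; linarith
    · rw [max_eq_left h]
      have := Real.log_le_self (x := Real.log (1 / S.energySq i))
        ((Real.exp_pos 1).le.trans h)
      linarith
  linarith

lemma log_one_add_omega1_le (hm : 0 < m) : Real.log (1 + S.omega1) ≤ 1 + S.omega2 := by
  have h0 := S.omega1_nonneg hm
  have he : 1 ≤ Real.exp 1 := Real.one_le_exp zero_le_one
  have h1 : 1 + S.omega1 ≤ 2 * max S.omega1 (Real.exp 1) := by
    linarith [le_max_left S.omega1 (Real.exp 1), le_max_right S.omega1 (Real.exp 1)]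
  calc Real.log (1 + S.omega1) ≤ Real.log (2 * max S.omega1 (Real.exp 1)) :=
        Real.log_le_log (by linarith) h1
    _ = Real.log 2 + Real.log (max S.omega1 (Real.exp 1)) :=
        Real.log_mul (by norm_num) (by positivity)
    _ ≤ 1 + S.omega2 := by linarith [S.log_max_omega1_le hm, Real.log_two_lt_d9]

lemma sum_s_le : ∑ i, S.s i ≤ 2 := by
  -- An artificial point at 2 follows the last change point, so that s_i ≤ 1 is also bounded by the
  -- gap there and the sum telescopes.
  set g : ℕ → ℝ := fun j => if h : j < m then S.x ⟨j, h⟩ else 2 with hg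
  have h1 : ∀ i : Fin m, S.s i ≤ g (i + 1) - g i := by
    intro i
    have hi : g i = S.x i := by simp [hg]
    rw [hi]
    by_cases h : (i : ℕ) + 1 < m
    · simp only [hg, h, dite_true]
      exact S.s_le_sub_of_lt (Fin.lt_def.2 (Nat.lt_succ_self _))
    · simp only [hg, h, dite_false]
      linarith [S.s_le_one i, S.x_lt_one i]
  calc ∑ i, S.s i ≤ ∑ i : Fin m, (g (i + 1) - g i) := Finset.sum_le_sum fun i _ => h1 i
    _ = ∑ i ∈ Finset.range m, (g (i + 1) - g i) :=
        Fin.sum_univ_eq_sum_range (fun i => g (i + 1) - g i) m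
    _ = g m - g 0 := Finset.sum_range_sub _ _
    _ ≤ 2 := by
      have h2 : g m = 2 := by simp [hg]
      have h3 : 0 ≤ g 0 := by
        simp only [hg]
        split_ifs with h
        · exact (S.x_pos _).le
        · norm_num
      linarith

/-- Since 1/Δ_i² = s_i/𝓔_i² ≤ s_i H_detect and ∑ s_i ≤ 2, estimating all jumps costs no more than
detecting the hardest one, up to constants. -/
lemma sum_inv_sq_jump_le : ∑ i, 1 / S.jump i ^ 2 ≤ 2 * S.Hdetect := by
  rcases Nat.eq_zero_or_pos m with rfl | hm
  · simp [Hdetect]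
  have h0 := S.one_le_Hdetect hm
  calc ∑ i, 1 / S.jump i ^ 2 ≤ ∑ i, S.s i * S.Hdetect := by
        refine Finset.sum_le_sum fun i _ => ?_
        have h1 := S.s_pos i
        have h2 := S.sq_jump_pos i
        calc 1 / S.jump i ^ 2 = S.s i * (1 / S.energySq i) := by unfold energySq; field_simp
          _ ≤ S.s i * S.Hdetect := by gcongr; exact S.inv_energySq_le_Hdetect i
    _ = (∑ i, S.s i) * S.Hdetect := by rw [Finset.sum_mul]
    _ ≤ 2 * S.Hdetect := by gcongr; exact S.sum_s_le

/-- The spacings sum to at most 2, so one is at most 2/m. This lets ω₂ absorb the union bound over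
all candidates. -/
lemma exists_card_le_two_mul_inv_s (hm : 0 < m) : ∃ i, (m : ℝ) ≤ 2 * (1 / S.s i) := by
  have hm' : (0 : ℝ) < m := by exact_mod_cast hm
  by_contra! h
  have : ∑ i : Fin m, 2 / (m : ℝ) < ∑ i, S.s i := by
    refine Finset.sum_lt_sum_of_nonempty ⟨⟨0, hm⟩, Finset.mem_univ _⟩ fun i _ => ?_
    rw [div_lt_iff₀ hm']
    have := h i
    have h1 := S.s_pos i
    rw [mul_one_div, div_lt_iff₀ h1] at this
    linarith
  rw [Finset.sum_const, Finset.card_univ, Fintype.card_fin, nsmul_eq_mul,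
    mul_div_cancel₀ _ hm'.ne'] at this
  linarith [S.sum_s_le]

lemma log_card_le_omega2 (hm : 0 < m) : Real.log m ≤ S.omega2 := by
  obtain ⟨i, hi⟩ := S.exists_card_le_two_mul_inv_s hm
  have h1 := Real.log_le_log (by exact_mod_cast hm) hi
  rw [Real.log_mul (by norm_num) (by have := S.s_pos i; positivity)] at h1
  linarith [S.log_inv_s_add_one_le i, Real.log_two_lt_d9]

lemma cast_le_Hlocalize {N : ℕ} (h : N ≤ m) : (N : ℝ) ≤ S.Hlocalize N := by
  rw [Hlocalize_eq S h]
  calc (N : ℝ) = ∑ _l : Fin N, (1 : ℝ) := by simp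
    _ ≤ _ := by
      refine Finset.sum_le_sum fun l _ => ?_
      unfold sortedJump
      rw [sq_abs, le_div_iff₀ (S.sq_jump_pos _), one_mul]
      exact S.sq_jump_le_one _

end StepModel

/-! ### Sufficient budgets -/

lemma log_inv_ge_log_four {δ : ℝ} (hδ : 0 < δ) (hδ1 : δ ≤ 1 / 4) : 1.38 ≤ Real.log (1 / δ) := by
  have h4 : Real.log 4 = 2 * Real.log 2 := by
    rw [show (4 : ℝ) = 2 ^ 2 by norm_num, Real.log_pow]; norm_num
  have : Real.log 4 ≤ Real.log (1 / δ) := by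
    refine Real.log_le_log (by norm_num) ?_
    rw [le_div_iff₀ hδ]; linarith
  linarith [Real.log_two_gt_d9]

lemma log_four_div {δ : ℝ} (hδ : 0 < δ) :
    Real.log (1 / (δ / 4)) = 2 * Real.log 2 + Real.log (1 / δ) := by
  rw [show 1 / (δ / 4) = 4 * (1 / δ) by field_simp,
    Real.log_mul (by norm_num) (by positivity), show (4 : ℝ) = 2 ^ 2 by norm_num, Real.log_pow]
  norm_num

section detection

variable {m : ℕ} {S : StepModel m} {δ b : ℝ} {T : ℕ}

/-- The maximal depth is logarithmic in T. Writing T as b⁴ times the critical budget, its logarithm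
is at most a multiple of b(1 + ω₁), because log(1 + ω₂) is itself controlled by ω₁. -/
lemma maxDepth_le (hm : 0 < m) (hδ : 0 < δ) (hδ1 : δ ≤ 1 / 4) (hb : 100 ≤ b)
    (hT : (T : ℝ) = b ^ 4 * ((1 + S.omega1) * S.Hdetect * (Real.log (1 / δ) + S.omega2))) :
    (maxDepth (δ / 4) T : ℝ) ≤ 7 * b * (1 + S.omega1) := by
  have hH := S.one_le_Hdetect hm
  have h1 := S.omega1_nonneg hm
  have h2 := S.one_le_omega2 hm
  have hℓ := log_inv_ge_log_four hδ hδ1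
  have h3 := S.omega2_le hm
  set ℓ := Real.log (1 / δ) with hℓ'
  have hL : Real.log (1 / (δ / 4)) = 2 * Real.log 2 + ℓ := log_four_div hδ
  have hlog2 := Real.log_two_gt_d9
  unfold maxDepth
  by_cases h0 : 0 ≤ Real.logb 2 (T / Real.log (1 / (δ / 4)))
  swap
  · rw [Nat.floor_of_nonpos (not_le.1 h0).le]
    push_cast; positivity
  refine (Nat.floor_le h0).trans ?_
  rw [Real.logb, div_le_iff₀ (by linarith), hL]
  have hx : (T : ℝ) / (2 * Real.log 2 + ℓ) ≤
      b ^ 4 * ((1 + S.omega1) * (S.Hdetect * (1 + S.omega2))) := by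
    rw [div_le_iff₀ (by linarith), hT]
    have : ℓ + S.omega2 ≤ (1 + S.omega2) * (2 * Real.log 2 + ℓ) := by nlinarith
    calc b ^ 4 * ((1 + S.omega1) * S.Hdetect * (ℓ + S.omega2))
        ≤ b ^ 4 * ((1 + S.omega1) * S.Hdetect * ((1 + S.omega2) * (2 * Real.log 2 + ℓ))) := by
          gcongr
      _ = _ := by ring
  have hTpos : 0 < (T : ℝ) := by rw [hT]; positivity
  refine (Real.log_le_log (by positivity) hx).trans ?_
  rw [Real.log_mul (by positivity) (by positivity), Real.log_mul (by positivity) (by positivity),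
    Real.log_mul (by positivity) (by positivity), Real.log_pow]
  have e1 : Real.log b ≤ b := Real.log_le_self (by linarith)
  have e2 : Real.log (1 + S.omega1) ≤ S.omega1 := by
    have := Real.log_le_sub_one_of_pos (x := 1 + S.omega1) (by linarith); linarith
  have e3 : Real.log (1 + S.omega2) ≤ S.omega2 := by
    have := Real.log_le_sub_one_of_pos (x := 1 + S.omega2) (by linarith); linarith
  have e4 : Real.log S.Hdetect = S.omega1 := rfl
  have e5 : 7 * b * (1 + S.omega1) * 0.69 ≤ 7 * b * (1 + S.omega1) * Real.log 2 := by
    gcongr; linarith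
  push_cast
  nlinarith [mul_nonneg (by linarith : 0 ≤ b - 100) h1]

/-- Of the factor b⁴, one power pays for the maximal depth and one for the logarithm in the
threshold, leaving b² ≥ 10⁴ for the constants. The detection condition thus persists at all larger
budgets, although depth and confidence terms grow with T. -/
lemma depthThreshold_lt (hm : 0 < m) (hδ : 0 < δ) (hδ1 : δ ≤ 1 / 4) (hb : 100 ≤ b)
    (hTb : (T : ℝ) = b ^ 4 * ((1 + S.omega1) * S.Hdetect * (Real.log (1 / δ) + S.omega2)))
    (hdm1 : 1 ≤ maxDepth (δ / 4) T) {i : Fin m} {d : ℕ} (hd : (2 : ℝ) ^ d ≤ 2 * (1 / S.s i)) :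
    0 < depthSamples T (maxDepth (δ / 4) T) d ∧
      2 * depthThreshold (δ / 4) T (maxDepth (δ / 4) T) d < |S.jump i| := by
  have hH := S.one_le_Hdetect hm
  have h1 := S.omega1_nonneg hm
  have h2 := S.one_le_omega2 hm
  have hℓ := log_inv_ge_log_four hδ hδ1
  have hlog2' := Real.log_two_lt_d9
  have hmax := maxDepth_le hm hδ hδ1 hb hTb
  set ℓ := Real.log (1 / δ) with hℓ'
  set g := ℓ + S.omega2 with hg
  have hg2 : 2 ≤ g := by linarith
  set dm := maxDepth (δ / 4) T with hdm
  have hdm1' : (1 : ℝ) ≤ dm := by exact_mod_cast hdm1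
  have hs := S.s_pos i
  have hsinv := S.one_le_inv_s i
  set σ := 1 / S.s i with hσ
  have hn : (2 : ℝ) ^ d + 1 ≤ 3 * σ := by linarith [hd]
  have hlog : Real.log (2 * dm * ((2 ^ d : ℕ) + 1) / (δ / 4)) ≤ b * g := by
    have e0 : 2 * (dm : ℝ) * ((2 ^ d : ℕ) + 1) / (δ / 4) ≤
        168 * b * ((1 + S.omega1) * (σ * (1 / δ))) := by
      push_cast
      rw [show 2 * (dm : ℝ) * (2 ^ d + 1) / (δ / 4) = 8 * dm * (2 ^ d + 1) * (1 / δ) by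
        field_simp; ring]
      calc 8 * (dm : ℝ) * (2 ^ d + 1) * (1 / δ)
          ≤ 8 * (7 * b * (1 + S.omega1)) * (3 * σ) * (1 / δ) := by gcongr
        _ = _ := by ring
    refine (Real.log_le_log (by positivity) e0).trans ?_
    rw [Real.log_mul (by positivity) (by positivity), Real.log_mul (by positivity) (by positivity),
      Real.log_mul (by positivity) (by positivity), Real.log_mul (by positivity) (by positivity)]
    have e1 : Real.log b ≤ b := Real.log_le_self (by linarith)
    have e2 := S.log_one_add_omega1_le hm
    have e3 := S.log_inv_s_add_one_le i
    have e4 : Real.log 168 ≤ 8 * Real.log 2 := by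
      rw [← Real.log_rpow (by norm_num)]
      exact Real.log_le_log (by norm_num) (by norm_num)
    rw [← hσ] at e3
    nlinarith [mul_nonneg (by linarith : 0 ≤ b - 100) (by linarith : 0 ≤ g - 2)]
  set Td := depthSamples T dm (d) with hTd
  have hTd1 : b ^ 3 * g * S.Hdetect * S.s i / 21 - 1 < Td := by
    have e1 : (T : ℝ) / (dm * (2 ^ d + 1) : ℕ) < Td + 1 := by
      rw [hTd, depthSamples]
      rw [← Nat.floor_div_eq_div (K := ℝ)]
      exact Nat.lt_floor_add_one _
    have e2 : b ^ 3 * g * S.Hdetect * S.s i / 21 ≤ (T : ℝ) / (dm * (2 ^ d + 1) : ℕ) := by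
      rw [le_div_iff₀ (by positivity), hTb]
      push_cast
      calc b ^ 3 * g * S.Hdetect * S.s i / 21 * (dm * (2 ^ d + 1))
          ≤ b ^ 3 * g * S.Hdetect * S.s i / 21 * ((7 * b * (1 + S.omega1)) * (3 * σ)) := by gcongr
        _ = b ^ 4 * ((1 + S.omega1) * S.Hdetect * g) * (S.s i * σ) := by ring
        _ = b ^ 4 * ((1 + S.omega1) * S.Hdetect * g) := by rw [hσ, mul_one_div_cancel hs.ne', mul_one]
    linarith
  have hΔ := S.sq_jump_pos i
  have hΔ1 := S.sq_jump_le_one i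
  have hHE : 1 ≤ S.Hdetect * S.s i * S.jump i ^ 2 := by
    have := S.inv_energySq_le_Hdetect i
    rw [div_le_iff₀ (S.energySq_pos i)] at this
    unfold StepModel.energySq at this
    linarith
  have hTdΔ : b ^ 3 * g / 21 - 1 < Td * S.jump i ^ 2 := by
    calc b ^ 3 * g / 21 - 1 ≤ b ^ 3 * g / 21 * (S.Hdetect * S.s i * S.jump i ^ 2)
          - S.jump i ^ 2 := by
          have : 0 ≤ b ^ 3 * g / 21 := by positivity
          nlinarith
      _ = (b ^ 3 * g * S.Hdetect * S.s i / 21 - 1) * S.jump i ^ 2 := by ring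
      _ < Td * S.jump i ^ 2 := by gcongr
  have hbig : 32 * (b * g) < Td * S.jump i ^ 2 := by
    have : 100 ^ 2 * (b * g) ≤ b ^ 3 * g := by
      rw [show b ^ 3 * g = b ^ 2 * (b * g) by ring]; gcongr
    have hbg : 200 ≤ b * g := by
      calc (200 : ℝ) = 100 * 2 := by norm_num
        _ ≤ b * g := mul_le_mul hb hg2 (by norm_num) (by linarith)
    linarith
  have hTdpos : 0 < (Td : ℝ) := by
    have : 0 < (Td : ℝ) * S.jump i ^ 2 := lt_of_le_of_lt (by positivity) hbig
    exact pos_of_mul_pos_left this hΔ.le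
  refine ⟨by exact_mod_cast hTdpos, ?_⟩
  rw [depthThreshold, ← hTd]
  refine lt_of_pow_lt_pow_left₀ 2 (abs_nonneg _) ?_
  have hnn : 0 ≤ Real.log (2 * dm * ((2 ^ d : ℕ) + 1) / (δ / 4)) := by
    refine Real.log_nonneg ?_
    rw [le_div_iff₀ (by positivity)]
    push_cast
    have : (1 : ℝ) ≤ 2 ^ d := one_le_pow₀ (by norm_num)
    nlinarith
  rw [mul_pow, Real.sq_sqrt (by positivity), sq_abs]
  rw [div_mul_eq_mul_div, mul_div_assoc', div_lt_iff₀ hTdpos]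
  linarith

/-- The detection routine isolates all change points once its budget is large enough. -/
lemma failLE_detectIntervals_of_budget {ν : Measure ℝ} (hν : SubGaussianLaw ν) (hm : 0 < m)
    (hδ : 0 < δ) (hδ1 : δ ≤ 1 / 4)
    (hT : 10 ^ 8 * ((1 + S.omega1) * S.Hdetect * (Real.log (1 / δ) + S.omega2)) ≤ T) :
    FailLE S.f ν (detectIntervals (δ / 4) T) (fun L => ∃ I : Fin m → Dyadic,
      (∀ i, Isolates S (I i) i) ∧ L.Perm (List.ofFn I)) (δ / 4) := by
  have hH := S.one_le_Hdetect hm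
  have h1 := S.omega1_nonneg hm
  have h2 := S.one_le_omega2 hm
  have hℓ := log_inv_ge_log_four hδ hδ1
  have hlog2 := Real.log_two_gt_d9
  have hlog2' := Real.log_two_lt_d9
  have hL := log_four_div hδ
  set ℓ := Real.log (1 / δ) with hℓ'
  set g := ℓ + S.omega2 with hg
  have hg2 : 2 ≤ g := by linarith
  set Φ := (1 + S.omega1) * S.Hdetect * g with hΦ
  have hΦpos : 0 < Φ := by positivity
  -- The fourth root of T/Φ, so that T ≥ 10⁸ Φ becomes b ≥ 100.
  set b : ℝ := √√(T / Φ) with hb'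
  have hb4 : b ^ 4 = T / Φ := by
    rw [show b ^ 4 = (b ^ 2) ^ 2 by ring, hb', Real.sq_sqrt (Real.sqrt_nonneg _),
      Real.sq_sqrt (by positivity)]
  have hb : 100 ≤ b := by
    refine le_of_pow_le_pow_left₀ (n := 4) (by norm_num) (Real.sqrt_nonneg _) ?_
    rw [hb4, le_div_iff₀ hΦpos]
    linarith
  have hTb : (T : ℝ) = b ^ 4 * Φ := by rw [hb4, div_mul_cancel₀ _ hΦpos.ne']
  -- Cells short enough to isolate x_i, but not much shorter, so that the number of endpoints stays
  -- of order 1/s_i.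
  have hex : ∀ i, ∃ d : ℕ, 1 ≤ d ∧ (1 : ℝ) / 2 ^ d ≤ S.s i ∧ (2 : ℝ) ^ d ≤ 2 * (1 / S.s i) := by
    intro i
    obtain ⟨n, hn1, hn2⟩ := exists_nat_pow_near (S.one_le_inv_s i) (one_lt_two (α := ℝ))
    refine ⟨n + 1, by omega, ?_, by rw [pow_succ]; linarith⟩
    rw [one_div_le (by positivity) (S.s_pos i)]
    exact hn2.le
  choose dep hdep1 hdep2 hdep3 using hex
  have hmax := maxDepth_le hm hδ hδ1 hb hTb
  have hle : ∀ i, dep i ≤ maxDepth (δ / 4) T := by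
    intro i
    refine Nat.le_floor ?_
    have hTpos : 0 < (T : ℝ) := by rw [hTb]; positivity
    rw [Real.le_logb_iff_rpow_le (by norm_num)
        (by rw [hL]; exact div_pos hTpos (by linarith)), Real.rpow_natCast,
      le_div_iff₀ (by rw [hL]; linarith), hL]
    have e1 : (2 : ℝ) ^ dep i ≤ 2 * S.Hdetect := (hdep3 i).trans (by
      have := S.inv_s_le_Hdetect i; linarith)
    calc (2 : ℝ) ^ dep i * (2 * Real.log 2 + ℓ) ≤ 2 * S.Hdetect * (3 * g) := by
          gcongr
          linarith
      _ ≤ 10 ^ 8 * (1 * S.Hdetect * g) := by nlinarith [mul_pos (by linarith : 0 < S.Hdetect) (by linarith : 0 < g)]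
      _ ≤ 10 ^ 8 * Φ := by rw [hΦ]; gcongr; linarith
      _ ≤ T := hT
  refine failLE_detectIntervals hm hν (by positivity) (by linarith) hdep2
    (fun i => ⟨hdep1 i, hle i⟩) fun i => ?_
  exact depthThreshold_lt hm hδ hδ1 hb hTb ((hdep1 i).trans (hle i)) (hdep3 i)

end detection

end ChangePoint

namespace ChangePoint

open Prog

/-! ### Sufficient budget for the estimation of the jumps -/

section estimation

variable {m : ℕ} {S : StepModel m} {δ : ℝ} {T N : ℕ}

/-- The round R is logarithmic, so log R enters only through an iterated logarithm of 1/𝓔_i², which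
ω₂ absorbs together with log m. The logarithm in the threshold is then at most 7g with g = log(1/δ)
+ ω₂, and (9/4)·32·7 = 504 < 512. -/
lemma estThreshold_le_gap (hm : 0 < m) (hδ : 0 < δ) (hδ1 : δ ≤ 1 / 4) (i : Fin m) {R : ℕ}
    (hR : 1 ≤ R) (hR1 : 512 * (Real.log (1 / δ) + S.omega2) / S.jump i ^ 2 ≤ 2 ^ R)
    (hR2 : (2 : ℝ) ^ R ≤ 1024 * (Real.log (1 / δ) + S.omega2) / S.jump i ^ 2) :
    3 / 2 * estThreshold (δ / 4) m R ≤ |S.jump i| := by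
  have h2 := S.one_le_omega2 hm
  have hℓ := log_inv_ge_log_four hδ hδ1
  have hlog2 := Real.log_two_gt_d9
  have hlog2' := Real.log_two_lt_d9
  have hE := S.energySq_pos i
  have hY := S.log_max_log_inv_energySq_le i
  have hcard := S.log_card_le_omega2 hm
  set ℓ := Real.log (1 / δ) with hℓ'
  set g := ℓ + S.omega2 with hg
  have hg2 : 2 ≤ g := by linarith
  have hJ := S.sq_jump_pos i
  have hR' : (1 : ℝ) ≤ R := by exact_mod_cast hR
  have hm' : (1 : ℝ) ≤ m := by exact_mod_cast hm
  set Y := max (Real.log (1 / S.energySq i)) (Real.exp 1) with hYdef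
  have hY2 : 2 ≤ Y := by
    have := Real.add_one_le_exp 1
    linarith [le_max_right (Real.log (1 / S.energySq i)) (Real.exp 1)]
  have hRlog : R * Real.log 2 ≤ 7 + g + Y := by
    have e1 : (2 : ℝ) ^ R ≤ 1024 * (g * (1 / S.energySq i)) := by
      refine hR2.trans ?_
      rw [mul_div_assoc, div_eq_mul_one_div g]
      gcongr
      exact S.energySq_le_sq_jump i
    have e2 := Real.log_le_log (by positivity) e1
    rw [Real.log_pow, Real.log_mul (by norm_num) (by positivity),
      Real.log_mul (by positivity) (by positivity), show (1024 : ℝ) = 2 ^ 10 by norm_num,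
      Real.log_pow] at e2
    have e3 := Real.log_le_self (x := g) (by linarith)
    have e4 := le_max_left (Real.log (1 / S.energySq i)) (Real.exp 1)
    push_cast at e2
    linarith
  have hR4 : (R : ℝ) ≤ 4 * (g * Y) := by
    have e1 : 7 + g + Y ≤ 2.76 * (g * Y) := by
      nlinarith [mul_nonneg (by linarith : 0 ≤ g - 2) (by linarith : 0 ≤ Y - 2)]
    have e2 : (R : ℝ) * 0.69 ≤ R * Real.log 2 := by gcongr; linarith
    linarith
  have hlogR : Real.log R ≤ 2 * Real.log 2 + (g - 1) + S.omega2 := by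
    refine (Real.log_le_log (by linarith) hR4).trans ?_
    rw [Real.log_mul (by norm_num) (by positivity), Real.log_mul (by positivity) (by positivity),
      show (4 : ℝ) = 2 ^ 2 by norm_num, Real.log_pow]
    have := Real.log_le_sub_one_of_pos (x := g) (by linarith)
    push_cast
    linarith
  have hlog : Real.log (Real.pi ^ 2 * m * R ^ 2 / (3 * (δ / 4))) ≤ 7 * g := by
    have e1 : Real.pi ^ 2 * m * R ^ 2 / (3 * (δ / 4)) ≤ 16 * (m * (R ^ 2 * (1 / δ))) := by
      have : Real.pi ^ 2 ≤ 12 := by nlinarith [Real.pi_lt_d2, Real.pi_pos]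
      rw [show Real.pi ^ 2 * m * R ^ 2 / (3 * (δ / 4)) =
        Real.pi ^ 2 * (4 / 3 * (m * (R ^ 2 * (1 / δ)))) by field_simp]
      have : 0 ≤ 4 / 3 * (m * ((R : ℝ) ^ 2 * (1 / δ))) := by positivity
      nlinarith
    refine (Real.log_le_log (by have := Real.pi_pos; positivity) e1).trans ?_
    rw [Real.log_mul (by positivity) (by positivity), Real.log_mul (by positivity) (by positivity),
      Real.log_mul (by positivity) (by positivity), Real.log_pow,
      show (16 : ℝ) = 2 ^ 4 by norm_num, Real.log_pow]
    push_cast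
    linarith
  refine le_of_sq_le_sq ?_ (abs_nonneg _)
  rw [mul_pow, estThreshold_sq (by positivity) (by linarith) hm hR, sq_abs]
  have hz : (2 : ℝ) ^ (-((R : ℤ) - 5)) = 32 / 2 ^ R := by
    rw [neg_sub, zpow_sub₀ (by norm_num), zpow_natCast]
    norm_num
  rw [hz]
  have hP : (0 : ℝ) < 2 ^ R := by positivity
  rw [div_le_iff₀ hJ] at hR1
  rw [div_mul_eq_mul_div, mul_div_assoc', div_le_iff₀ hP]
  linarith

/-- The estimation routine succeeds once its budget is large enough. -/
lemma failLE_estimateJumps_of_budget {ν : Measure ℝ} (hν : SubGaussianLaw ν) (hm : 0 < m)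
    (hN : N ≤ m) (hδ : 0 < δ) (hδ1 : δ ≤ 1 / 4)
    (hT : 10 ^ 8 * ((1 + S.omega1) * S.Hdetect * (Real.log (1 / δ) + S.omega2)) ≤ T)
    {I : Fin m → Dyadic} (hI : ∀ i, Isolates S (I i) i) {L : List Dyadic}
    (hL : L.Perm (List.ofFn I)) :
    FailLE S.f ν (estimateJumps L (δ / 4) T N) (GoodEstimates S.f L N) (δ / 4) := by
  have hH := S.one_le_Hdetect hm
  have h1 := S.omega1_nonneg hm
  have h2 := S.one_le_omega2 hm
  have hℓ := log_inv_ge_log_four hδ hδ1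
  have hlen : L.length = m := by rw [hL.length_eq, List.length_ofFn]
  set g := Real.log (1 / δ) + S.omega2 with hg
  have hex : ∀ i, ∃ r : ℕ, 1 ≤ r ∧ 512 * g / S.jump i ^ 2 ≤ 2 ^ r ∧
      (2 : ℝ) ^ r ≤ 1024 * g / S.jump i ^ 2 := by
    intro i
    have hJ := S.sq_jump_pos i
    have hJ1 := S.sq_jump_le_one i
    obtain ⟨n, hn1, hn2⟩ := exists_nat_pow_near (x := 512 * g / S.jump i ^ 2) (y := 2)
      (by rw [le_div_iff₀ hJ]; linarith) (by norm_num)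
    refine ⟨n + 1, by omega, hn2.le, ?_⟩
    rw [pow_succ, show 1024 * g / S.jump i ^ 2 = 512 * g / S.jump i ^ 2 * 2 by ring]
    gcongr
  choose r hr1 hr2 hr3 using hex
  have hIinj : Function.Injective I := by
    intro i j hij
    have h := (hI i i).2 rfl
    rw [hij] at h
    exact (hI j i).1 h
  have : Nonempty (Fin m) := ⟨⟨0, hm⟩⟩
  have hinv : ∀ i, Function.invFun I (I i) = i := Function.leftInverse_invFun hIinj
  -- The acceptance round is indexed by change points; inverting the injective map `I` makes it a
  -- function of intervals.
  refine failLE_estimateJumps (R := fun J => r (Function.invFun I J)) hν (by positivity)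
    (by linarith) (by omega) (by omega) (fun J hJ => ?_) ?_
  · have := hL.subset hJ
    rw [List.mem_ofFn'] at this
    obtain ⟨i, rfl⟩ := this
    rw [hinv, (hI i).gap_eq, hlen]
    exact ⟨hr1 i, estThreshold_le_gap hm hδ hδ1 i (hr1 i) (hr2 i) (hr3 i)⟩
  · rw [(hL.map _).sum_eq, List.map_ofFn, List.sum_ofFn]
    simp only [Function.comp_apply, hinv]
    have h3 : ∑ i, (2 : ℝ) ^ (r i + 1) ≤ T := by
      calc ∑ i, (2 : ℝ) ^ (r i + 1) ≤ ∑ i, 2048 * g * (1 / S.jump i ^ 2) := by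
            refine Finset.sum_le_sum fun i _ => ?_
            rw [pow_succ]
            have := hr3 i
            rw [show 2048 * g * (1 / S.jump i ^ 2) = 1024 * g / S.jump i ^ 2 * 2 by ring]
            gcongr
        _ = 2048 * g * ∑ i, 1 / S.jump i ^ 2 := by rw [Finset.mul_sum]
        _ ≤ 2048 * g * (2 * S.Hdetect) := by gcongr; exact S.sum_inv_sq_jump_le
        _ = 4096 * (1 * S.Hdetect * g) := by ring
        _ ≤ 10 ^ 8 * ((1 + S.omega1) * S.Hdetect * g) := by gcongr <;> linarith
        _ ≤ T := hT
    exact_mod_cast h3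

end estimation


/-! ### Sufficient budget for halving and verification -/

section localization

variable {m : ℕ} {S : StepModel m} {δ η : ℝ} {N : ℕ}

/-- Spreading the budget over n ≤ 7X rounds leaves n·τ·D of order b²X. The drift gain therefore
exceeds both the entropy term n·log 2 and the required confidence 2X. -/
lemma shbSamples_ge {b X D : ℝ} {Tv n : ℕ} (hb : 2000 ≤ b) (hX : 1 ≤ X) (hn : 1 ≤ n)
    (hnX : (n : ℝ) ≤ 7 * X) (hD1 : D ≤ 1) (hD : 0 ≤ D)
    (hTv : b ^ 2 * X / 10 ≤ Tv * D) :
    ∃ u : ℝ, 0 ≤ u ∧ 10 * Real.exp (-((Tv / (5 * n) : ℕ) * D / 512)) ≤ Real.exp (-(2 * u)) ∧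
      2 * X ≤ n * (3 / 5 * u - Real.log 2) := by
  have hn' : (1 : ℝ) ≤ n := by exact_mod_cast hn
  have hlog10 : Real.log 10 ≤ 4 * Real.log 2 := by
    rw [← Real.log_rpow (by norm_num)]
    exact Real.log_le_log (by norm_num) (by norm_num)
  have hlog2' := Real.log_two_lt_d9
  set τ := Tv / (5 * n) with hτ
  have h1 : (Tv : ℝ) / (5 * n) - 1 ≤ τ := by
    have : (Tv : ℝ) / (5 * n : ℕ) < τ + 1 := by
      rw [hτ, ← Nat.floor_div_eq_div (K := ℝ)]
      exact Nat.lt_floor_add_one _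
    push_cast at this
    linarith
  have h2 : b ^ 2 * X / 50 - n ≤ n * (τ * D) := by
    have h3 : (Tv : ℝ) - 5 * n ≤ τ * (5 * n) := by
      rw [sub_le_iff_le_add, div_le_iff₀ (by positivity)] at h1
      linarith
    have h4 : ((Tv : ℝ) - 5 * n) * D ≤ τ * (5 * n) * D := by gcongr
    nlinarith
  have hb2 : (4 * 10 ^ 6 : ℝ) ≤ b ^ 2 := by nlinarith
  have h5 : 4 * 10 ^ 6 * X ≤ b ^ 2 * X := by gcongr
  -- The value of u for which the condition on the failure probability is an equality.
  refine ⟨(τ * D / 512 - Real.log 10) / 2, ?_, ?_, ?_⟩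
  · have h6 : (n : ℝ) * 10000 ≤ n * (τ * D) := by nlinarith
    have h7 : 10000 ≤ τ * D := le_of_mul_le_mul_left h6 (by linarith)
    linarith
  · rw [mul_div_cancel₀ _ (two_ne_zero), neg_sub, Real.exp_sub, Real.exp_log (by norm_num),
      Real.exp_neg, ← div_eq_mul_inv]
  · have h8 : n * (3 / 5 * ((τ * D / 512 - Real.log 10) / 2) - Real.log 2) =
      3 / 5120 * (n * (τ * D)) - n * (3 / 10 * Real.log 10 + Real.log 2) := by ring
    rw [h8]
    have h9 : n * (3 / 10 * Real.log 10 + Real.log 2) ≤ 7 * X * 2 := by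
      have := Real.log_nonneg (x := 10) (by norm_num)
      have := Real.log_nonneg (x := 2) (by norm_num)
      gcongr
      linarith
    linarith

lemma Isolates.singleJump {J : Dyadic} {i : Fin m} (h : Isolates S J i) :
    SingleJump S.f J.left J.right (S.x i) (S.jump i) where
  left_lt := ((h i).2 rfl).1
  le_right := ((h i).2 rfl).2
  ne_zero := S.jump_ne_zero i
  eq_left z hz hzx := S.f_eq_of_forall hz fun j hj => by
    have hji := (h j).1 ⟨hj.1, (hj.2.trans_lt hzx).le.trans ((h i).2 rfl).2⟩
    subst hji
    exact absurd hj.2 (not_le.2 hzx)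
  eq_right z hxz hz := by
    have := S.f_sub_eq_jump (((h i).2 rfl).1.le.trans hxz) i fun j =>
      ⟨fun hj => (h j).1 ⟨hj.1, hj.2.trans hz⟩, fun hj => by
        subst hj; exact ⟨((h j).2 rfl).1, hxz⟩⟩
    linarith

lemma omega3_eq (h1 : 1 ≤ N) :
    S.omega3 N = Real.log N + Real.log (max (Real.log (S.Hlocalize N)) 1) := by
  have : (0 : ℝ) < N := by exact_mod_cast h1
  exact Real.log_mul this.ne' (by positivity)

lemma log_max_nonneg (y : ℝ) : 0 ≤ Real.log (max y 1) := Real.log_nonneg (le_max_right _ _)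

lemma log_inv_mul (hδ : 0 < δ) (hη : 0 < η) :
    Real.log (1 / (δ * η)) = Real.log (1 / δ) + Real.log (1 / η) := by
  rw [← one_div_mul_one_div, Real.log_mul (by positivity) (by positivity)]

/-- Since k is logarithmic in the budget, log k costs an iterated logarithm of H_localize, part of
ω₃, plus terms in b and X. The spare factor b covers budgets far beyond the critical one. -/
lemma log_stageDelta_le (h1 : 1 ≤ N) (hNm : N ≤ m) (hδ : 0 < δ) (hδ1 : δ ≤ 1 / 4) (hη : 0 < η)
    (hη1 : η ≤ 1 / 4) {b : ℝ} (hb : 2000 ≤ b) {k : ℕ} (hk : 1 ≤ k)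
    (hT : (2 : ℝ) ^ k = b ^ 2 * (S.Hlocalize N * (Real.log (1 / (δ * η)) + S.omega3 N))) :
    Real.log (2 / stageDelta N δ k) ≤ b * (Real.log (1 / (δ * η)) + S.omega3 N) := by
  have hN' : (1 : ℝ) ≤ N := by exact_mod_cast h1
  have hH : 1 ≤ S.Hlocalize N := hN'.trans (S.cast_le_Hlocalize hNm)
  have hk' : (1 : ℝ) ≤ k := by exact_mod_cast hk
  have hω := omega3_eq (S := S) h1
  have hsum := log_inv_mul hδ hη
  have hℓδ := log_inv_ge_log_four hδ hδ1
  have hℓη := log_inv_ge_log_four hη hη1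
  have hlogN := Real.log_nonneg hN'
  have hlogZ := log_max_nonneg (Real.log (S.Hlocalize N))
  have hlog2 := Real.log_two_gt_d9
  have hlog2' := Real.log_two_lt_d9
  set X := Real.log (1 / (δ * η)) + S.omega3 N with hX
  have hX2 : 2 ≤ X := by linarith
  set Z := max (Real.log (S.Hlocalize N)) 1 with hZ
  have hZ1 : 1 ≤ Z := le_max_right _ _
  have hkb : (k : ℝ) ≤ 3 * (b * (Z * X)) := by
    have e1 := congrArg Real.log hT
    rw [Real.log_pow, Real.log_mul (by positivity) (by positivity),
      Real.log_mul (by positivity) (by positivity), Real.log_pow] at e1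
    have e2 : Real.log b ≤ b := Real.log_le_self (by linarith)
    have e3 : Real.log X ≤ X := Real.log_le_self (by linarith)
    have e4 : Real.log (S.Hlocalize N) ≤ Z := le_max_left _ _
    have e5 : (k : ℝ) * 0.69 ≤ k * Real.log 2 := by gcongr; linarith
    have e6 : b ≤ b * (Z * X) * (1 / 2) := by
      have : 1 * 2 ≤ Z * X := by gcongr
      nlinarith
    have e7 : Z * 2000 ≤ b * (Z * X) * (1 / 2) := by
      have : 2000 * (Z * 2) ≤ b * (Z * X) := by gcongr
      linarith
    have e8 : X * 2000 ≤ b * (Z * X) := by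
      have : 2000 * (1 * X) ≤ b * (Z * X) := by gcongr
      linarith
    push_cast at e1
    linarith
  have hlogk : Real.log k ≤ 2 * Real.log 2 + b / 4 + 2 * X := by
    refine (Real.log_le_log (by linarith) hkb).trans ?_
    rw [Real.log_mul (by norm_num) (by positivity), Real.log_mul (by positivity) (by positivity),
      Real.log_mul (by positivity) (by positivity)]
    have e1 : Real.log 3 ≤ 2 * Real.log 2 := by
      rw [← Real.log_rpow (by norm_num)]
      exact Real.log_le_log (by norm_num) (by norm_num)
    have e2 : Real.log b ≤ b / 4 := by
      have := Real.log_le_sub_one_of_pos (x := b / 16) (by positivity)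
      rw [Real.log_div (by positivity) (by norm_num), show (16 : ℝ) = 2 ^ 4 by norm_num,
        Real.log_pow] at this
      push_cast at this
      linarith
    have e3 : Real.log X ≤ X := Real.log_le_self (by linarith)
    linarith
  have hfin : Real.log (2 / stageDelta N δ k) ≤ 4 * Real.log 2 + (Real.log N +
      (2 * Real.log k + Real.log (1 / δ))) := by
    have e1 : 2 / stageDelta N δ k ≤ 16 * (N * ((k : ℝ) ^ 2 * (1 / δ))) := by
      have : Real.pi ^ 2 ≤ 12 := by nlinarith [Real.pi_lt_d2, Real.pi_pos]
      have e : 2 / stageDelta N δ k = Real.pi ^ 2 * (4 / 3 * (N * ((k : ℝ) ^ 2 * (1 / δ)))) := by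
        unfold stageDelta
        field_simp
        norm_num
      rw [e]
      have : 0 ≤ 4 / 3 * (N * ((k : ℝ) ^ 2 * (1 / δ))) := by positivity
      nlinarith
    have := stageDelta_pos (N := N) hδ h1 hk
    refine (Real.log_le_log (by positivity) e1).trans ?_
    rw [Real.log_mul (by norm_num) (by positivity), Real.log_mul (by positivity) (by positivity),
      Real.log_mul (by positivity) (by positivity), Real.log_pow,
      show (16 : ℝ) = 2 ^ 4 by norm_num, Real.log_pow]
    push_cast
    linarith
  have hbX : b * 2 ≤ b * X := by gcongr
  have hbX' : 2000 * X ≤ b * X := by gcongr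
  linarith

/-- The share of the interval is at least 1/(4Δ²) divided by (9/4)H_localize, that is 1/(9Δ²
H_localize). Lowering 1/9 to 1/10 pays for the rounding. -/
lemma localizeSamples_ge (hH : 0 < S.Hlocalize N) {b X W θ : ℝ} (hb : 2000 ≤ b) (hX : 1 ≤ X)
    {k : ℕ} (hT : (2 : ℝ) ^ k = b ^ 2 * (S.Hlocalize N * X)) (hW : 0 < W)
    (hW1 : W ≤ 9 / 4 * S.Hlocalize N) (hθ : 0 < θ) {i : Fin m} (hθ1 : θ ≤ 2 * |S.jump i|) :
    b ^ 2 * X / 10 ≤ (max ⌊(θ ^ 2)⁻¹ / W * 2 ^ k⌋₊ 1 : ℕ) * S.jump i ^ 2 := by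
  have hJ := S.sq_jump_pos i
  have hJ1 := S.sq_jump_le_one i
  have h1 : b ^ 2 * X / (9 * S.jump i ^ 2) ≤ (θ ^ 2)⁻¹ / W * 2 ^ k := by
    have h2 : θ ^ 2 ≤ 4 * S.jump i ^ 2 := by
      have : θ ^ 2 ≤ (2 * |S.jump i|) ^ 2 := by gcongr
      rwa [mul_pow, sq_abs, show (2 : ℝ) ^ 2 = 4 by norm_num] at this
    calc b ^ 2 * X / (9 * S.jump i ^ 2)
        = (4 * S.jump i ^ 2)⁻¹ / (9 / 4 * S.Hlocalize N) * 2 ^ k := by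
          rw [hT]; field_simp
      _ ≤ (θ ^ 2)⁻¹ / W * 2 ^ k := by gcongr
  have h3 : (θ ^ 2)⁻¹ / W * 2 ^ k - 1 ≤ (max ⌊(θ ^ 2)⁻¹ / W * 2 ^ k⌋₊ 1 : ℕ) := by
    have := Nat.lt_floor_add_one ((θ ^ 2)⁻¹ / W * 2 ^ k)
    push_cast
    linarith [le_max_left (⌊(θ ^ 2)⁻¹ / W * 2 ^ k⌋₊ : ℝ) 1]
  have h4 : (b ^ 2 * X / (9 * S.jump i ^ 2) - 1) * S.jump i ^ 2 ≤
      (max ⌊(θ ^ 2)⁻¹ / W * 2 ^ k⌋₊ 1 : ℕ) * S.jump i ^ 2 := by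
    gcongr
    linarith
  rw [sub_mul, div_mul_eq_mul_div, mul_div_mul_right _ _ hJ.ne'] at h4
  have hb2 : 4 * 10 ^ 6 * 1 ≤ b ^ 2 * X := by
    gcongr
    nlinarith
  linarith

/-- Halving brings c within η of the jump. The verification points then straddle x_i and no other
change point, so f differs between them by the full jump, and T_v Δ² exceeds what the test requires.
-/
lemma failLE_localizeStep_succeeds {ν : Measure ℝ} (hν : SubGaussianLaw ν) (h1 : 1 ≤ N)
    (hNm : N ≤ m) (hδ : 0 < δ) (hδ1 : δ ≤ 1 / 4) (hη : 0 < η) (hη1 : η ≤ 1 / 4) {k : ℕ}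
    (hk : 1 ≤ k)
    (hT : 10 ^ 8 * (S.Hlocalize N * (Real.log (1 / (δ * η)) + S.omega3 N)) ≤ 2 ^ k) {W : ℝ}
    (hW : 0 < W) (hW1 : W ≤ 9 / 4 * S.Hlocalize N) {p : Dyadic × ℝ} {i : Fin m}
    (hcell : p.1.2 < 2 ^ p.1.1) (hp : Isolates S p.1 i) (hp0 : 0 < p.2)
    (hp2 : p.2 ≤ 2 * |S.jump i|) :
    FailLE S.f ν (localizeStep N δ η k W p) (fun c => c.2 = true)
      (δ / (12 * N) + stageDelta N δ k) := by
  have := hν.prob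
  have hN' : (1 : ℝ) ≤ N := by exact_mod_cast h1
  have hH : 1 ≤ S.Hlocalize N := hN'.trans (S.cast_le_Hlocalize hNm)
  have hω := omega3_eq (S := S) h1
  have hsum := log_inv_mul hδ hη
  have hℓδ := log_inv_ge_log_four hδ hδ1
  have hℓη := log_inv_ge_log_four hη hη1
  have hlogN := Real.log_nonneg hN'
  have hlogZ := log_max_nonneg (Real.log (S.Hlocalize N))
  have hlog2 := Real.log_two_gt_d9
  have hlog2' := Real.log_two_lt_d9
  have hsd := stageDelta_pos (N := N) hδ h1 hk
  have hsd1 := stageDelta_le_one (N := N) (δ := δ) (by linarith) h1 hk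
  set X := Real.log (1 / (δ * η)) + S.omega3 N with hX
  have hX2 : 2 ≤ X := by linarith
  set b : ℝ := √(2 ^ k / (S.Hlocalize N * X)) with hb'
  have hHX : 0 < S.Hlocalize N * X := by positivity
  have hb2 : b ^ 2 = 2 ^ k / (S.Hlocalize N * X) := Real.sq_sqrt (by positivity)
  have hTb : (2 : ℝ) ^ k = b ^ 2 * (S.Hlocalize N * X) := by
    rw [hb2, div_mul_cancel₀ _ hHX.ne']
  have hb : 2000 ≤ b := by
    refine le_of_sq_le_sq ?_ (Real.sqrt_nonneg _)
    rw [hb2, le_div_iff₀ hHX]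
    linarith
  have hlogδ := log_stageDelta_le h1 hNm hδ hδ1 hη hη1 hb hk hTb
  rw [← hX] at hlogδ
  have hTv := localizeSamples_ge (by linarith) hb (by linarith) hTb hW hW1 hp0 hp2
  have hJ1 := S.sq_jump_le_one i
  have hJ := S.sq_jump_pos i
  unfold localizeStep
  set Tv := max ⌊(p.2 ^ 2)⁻¹ / W * 2 ^ k⌋₊ 1 with hTvdef
  have hbX : 2000 * (b * X) ≤ b ^ 2 * X := by
    rw [show b ^ 2 * X = b * (b * X) by ring]; gcongr
  have hbX2 : 2000 * 2 ≤ b * X := by gcongr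
  have hTv2 : (2 : ℝ) ≤ Tv := by
    have : (Tv : ℝ) * S.jump i ^ 2 ≤ Tv := mul_le_of_le_one_right (by positivity) hJ1
    linarith
  have hshb : FailLE S.f ν (shb p.1.left p.1.right Tv η)
      (fun c => c - η < S.x i ∧ S.x i ≤ c + η) (δ / (12 * N)) := by
    refine failLE_shb hν hp.singleJump Tv hη fun hlr => ?_
    have hρ : 2 < (p.1.right - p.1.left) / η := by rw [lt_div_iff₀ hη]; exact hlr
    have hρ1 : (p.1.right - p.1.left) / η ≤ 1 / η := by
      gcongr
      linarith [p.1.left_nonneg, Dyadic.right_le_one hcell]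
    set n := ⌈6 * Real.log ((p.1.right - p.1.left) / η)⌉₊ with hn
    have hlogρ : 0 < Real.log ((p.1.right - p.1.left) / η) := Real.log_pos (by linarith)
    have hn1 : 1 ≤ n := Nat.one_le_iff_ne_zero.2 (Nat.ceil_pos.2 (by linarith)).ne'
    have hn7 : (n : ℝ) ≤ 7 * X := by
      have e1 : (n : ℝ) < 6 * Real.log ((p.1.right - p.1.left) / η) + 1 :=
        Nat.ceil_lt_add_one (by linarith)
      have e2 := Real.log_le_log (by linarith) hρ1
      linarith
    obtain ⟨u, hu, hu1, hu2⟩ := shbSamples_ge hb (by linarith) hn1 hn7 hJ1 hJ.le hTv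
    refine ⟨u, hu, hu1, ?_⟩
    rw [← Real.le_log_iff_exp_le (by positivity)]
    have e1 : Real.log (δ / (12 * N)) = -(Real.log 12 + Real.log N + Real.log (1 / δ)) := by
      rw [Real.log_div (by positivity) (by positivity), Real.log_mul (by norm_num) (by positivity),
        Real.log_div one_ne_zero hδ.ne', Real.log_one]
      ring
    have e2 : Real.log 12 ≤ 4 * Real.log 2 := by
      rw [← Real.log_rpow (by norm_num)]
      exact Real.log_le_log (by norm_num) (by norm_num)
    rw [e1]
    linarith
  refine (hshb.and_always (always_shb S.f p.1.left_lt_right Tv η)).bind (fun c hc => ?_)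
    (by positivity) hsd.le
  obtain ⟨⟨hc1, hc2⟩, hc3, hc4⟩ := hc
  have hmem := (hp i).2 rfl
  have hjump : S.f (min p.1.right (c + η)) - S.f (max p.1.left (c - η)) = S.jump i := by
    have e1 : max p.1.left (c - η) < S.x i := max_lt hmem.1 hc1
    have e2 : S.x i ≤ min p.1.right (c + η) := le_min hmem.2 hc2
    refine S.f_sub_eq_jump (e1.le.trans e2) i fun j => ⟨fun hj => (hp j).1
      ⟨(le_max_left _ _).trans_lt hj.1, hj.2.trans (min_le_left _ _)⟩, fun hj => ?_⟩
    subst hj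
    exact ⟨e1, e2⟩
  have hver : FailLE S.f ν (verifyCP (max p.1.left (c - η)) (min p.1.right (c + η))
      (stageDelta N δ k) Tv) (fun ok => ok = true) (stageDelta N δ k) := by
    refine failLE_verifyCP_of_gap hν hsd hsd1 (by exact_mod_cast hTv2) ?_
    rw [hjump]
    refine lt_of_pow_lt_pow_left₀ 2 (abs_nonneg _) ?_
    have hnn : 0 ≤ Real.log (2 / stageDelta N δ k) := by
      refine Real.log_nonneg ?_
      rw [le_div_iff₀ hsd]
      linarith
    rw [verifyThreshold, mul_pow, Real.sq_sqrt (by positivity), sq_abs, div_mul_eq_mul_div,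
      mul_div_assoc', div_lt_iff₀ (by linarith)]
    linarith
  have h := hver.bind (q := fun ok => ret (c, ok)) (δ' := 0) (Q := fun c : ℝ × Bool => c.2 = true)
    (fun ok hok => failLE_ret (by simp [hok]) _) hsd.le le_rfl
  rw [add_zero] at h
  exact h

/-- A stage with a large budget is likely to succeed. -/
lemma failLE_stage_succeeds {ν : Measure ℝ} (hν : SubGaussianLaw ν) (h1 : 1 ≤ N)
    (hNm : N ≤ m) (hδ : 0 < δ) (hδ1 : δ ≤ 1 / 4) (hη : 0 < η) (hη1 : η ≤ 1 / 4) {δexp : ℝ}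
    (hexp : 0 < δexp) (hexp1 : δexp ≤ 1 / 4) {k : ℕ}
    (hT : 10 ^ 8 * ((1 + S.omega1) * S.Hdetect * (Real.log (1 / δexp) + S.omega2) +
      S.Hlocalize N * (Real.log (1 / (δ * η)) + S.omega3 N)) ≤ 2 ^ k) :
    FailLE S.f ν (stage N δ η δexp k) (fun o => o ≠ none) (δexp / 2 + δ / 4) := by
  have := hν.prob
  have hm : 0 < m := by omega
  have hN' : (1 : ℝ) ≤ N := by exact_mod_cast h1
  have hHd := S.one_le_Hdetect hm
  have hH : 1 ≤ S.Hlocalize N := hN'.trans (S.cast_le_Hlocalize hNm)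
  have hω1 := S.omega1_nonneg hm
  have hω2 := S.one_le_omega2 hm
  have hω := omega3_eq (S := S) h1
  have hsum := log_inv_mul hδ hη
  have hℓδ := log_inv_ge_log_four hδ hδ1
  have hℓη := log_inv_ge_log_four hη hη1
  have hℓexp := log_inv_ge_log_four hexp hexp1
  have hlogN := Real.log_nonneg hN'
  have hlogZ := log_max_nonneg (Real.log (S.Hlocalize N))
  have hΦ1 : 0 < (1 + S.omega1) * S.Hdetect * (Real.log (1 / δexp) + S.omega2) := by positivity
  have hΦ2 : 1 * 2 ≤ S.Hlocalize N * (Real.log (1 / (δ * η)) + S.omega3 N) := by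
    gcongr
    linarith
  have hk : 1 ≤ k := by
    by_contra h
    rw [Nat.lt_one_iff.1 (not_le.1 h), pow_zero] at hT
    linarith
  have hT1 : 10 ^ 8 * ((1 + S.omega1) * S.Hdetect * (Real.log (1 / δexp) + S.omega2)) ≤
      ((2 ^ k : ℕ) : ℝ) := by push_cast; linarith
  have hT2 : 10 ^ 8 * (S.Hlocalize N * (Real.log (1 / (δ * η)) + S.omega3 N)) ≤ 2 ^ k := by
    linarith
  have hsd := stageDelta_pos (N := N) hδ h1 hk
  -- By π² > 9 the two contributions are at most δ/12 and 3δ/18, with sum δ/4.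
  have hq : N * (δ / (12 * N) + stageDelta N δ k) ≤ δ / 4 := by
    rw [mul_add, mul_stageDelta h1]
    have e1 : N * (δ / (12 * N)) = δ / 12 := by field_simp
    have hk' : (1 : ℝ) ≤ (k : ℝ) ^ 2 := one_le_pow₀ (by exact_mod_cast hk)
    have e2 : 3 * δ / (2 * Real.pi ^ 2) * (1 / (k : ℝ) ^ 2) ≤ 3 * δ / (2 * 9) * 1 := by
      gcongr
      · exact pi_sq_gt_nine.le
      · rw [div_le_one (by positivity)]; exact hk'
    rw [e1]
    linarith
  have hq0 : 0 ≤ δ / (12 * N) + stageDelta N δ k := by positivity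
  rw [stage_eq]
  refine FailLE.mono (((failLE_detectIntervals_of_budget hν hm hexp hexp1 hT1).and_always
    (always_detectIntervals S.f (δexp / 4) (2 ^ k))).bind (δ' := δexp / 4 + δ / 4)
    (fun L hL => ?_) (by positivity) (by positivity)) (fun _ h => h) (by linarith)
  obtain ⟨⟨I, hI, hperm⟩, hcell, -⟩ := hL
  have hlen : L.length = m := by rw [hperm.length_eq, List.length_ofFn]
  rw [if_pos (by omega)]
  refine (failLE_estimateJumps_of_budget hν hm hNm hexp hexp1 hT1 hI hperm).bind
    (fun acc hacc => ?_) (by positivity) (by positivity)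
  rw [if_pos hacc.card]
  set J := selectLargest N acc with hJ
  have hJlen : J.length = N := length_selectLargest hacc.card
  obtain ⟨rest, hrest, -⟩ := hacc.rest
  have hmem : ∀ p ∈ J, p.1 ∈ L ∧ ∃ i, Isolates S p.1 i ∧ 0 < p.2 ∧ p.2 ≤ 2 * |S.jump i| := by
    intro p hp
    have hp' := mem_of_mem_selectLargest hp
    have hpL : p.1 ∈ L := hrest.subset (List.mem_append_left _ (List.mem_map_of_mem hp'))
    have hpI := hperm.subset hpL
    rw [List.mem_ofFn'] at hpI
    obtain ⟨i, hi⟩ := hpI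
    have hiso : Isolates S p.1 i := by rw [← hi]; exact hI i
    have hgap := hacc.accurate p hp'
    rw [hiso.gap_eq] at hgap
    exact ⟨hpL, i, hiso, by linarith [S.abs_jump_pos i], hgap.2⟩
  have hW : 0 < totalWeight J := by
    unfold totalWeight
    refine List.sum_pos _ ?_ ?_
    · intro w hw
      obtain ⟨p, hp, rfl⟩ := List.mem_map.1 hw
      obtain ⟨-, -, -, hp0, -⟩ := hmem p hp
      positivity
    · rw [Ne, List.map_eq_nil_iff, ← List.length_eq_zero_iff]
      omega
  have hW1 := totalWeight_selectLargest_le hI hperm hacc hNm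
  have hloc := failLE_forEach (f := S.f) (ν := ν)
    (δ := fun _ : Dyadic × ℝ => δ / (12 * N) + stageDelta N δ k) (fun _ => hq0) J fun p hp => by
      obtain ⟨hpL, i, hiso, hp0, hp2⟩ := hmem p hp
      exact failLE_localizeStep_succeeds hν h1 hNm hδ hδ1 hη hη1 hk hT2 hW hW1 (hcell _ hpL) hiso
        hp0 hp2
  rw [List.map_const', List.sum_replicate, hJlen, nsmul_eq_mul] at hloc
  refine FailLE.mono (hloc.bind (δ' := 0) (Q := fun o => o ≠ none) (fun res hres =>
    failLE_ret ?_ _) (by positivity) le_rfl) (fun _ h => h) (by linarith)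
  have hall : res.all Prod.snd = true := by
    rw [List.all_eq_true]
    intro c hc
    obtain ⟨-, -, h⟩ := exists_of_forall₂_mem_right hres hc
    exact h
  simp [stageOutput, hall]

end localization

end ChangePoint

namespace ChangePoint

open Prog

/-! ### The loop over the stages -/

section loop

variable {N : ℕ} {δ η δexp : ℝ} {f : ℝ → ℝ}

/-- One pass of the loop, idle after termination. -/
noncomputable def loopStep (N : ℕ) (δ η δexp : ℝ) :
    ℕ ⊕ (Fin N → ℝ) → Prog (ℕ ⊕ (Fin N → ℝ))
  | Sum.inl k => (stage N δ η δexp k).bind fun o => ret (o.elim (Sum.inl (k + 1)) Sum.inr)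
  | Sum.inr a => ret (Sum.inr a)

/-- The first `n` passes of the loop. -/
noncomputable def loopIter (N : ℕ) (δ η δexp : ℝ) : ℕ → Prog (ℕ ⊕ (Fin N → ℝ))
  | 0 => ret (Sum.inl (Nat.clog 2 (2 * N)))
  | n + 1 => (loopIter N δ η δexp n).bind (loopStep N δ η δexp)

lemma after_eq_run_loopIter (ε : ℕ → ℝ) (n : ℕ) :
    (localizeChangePoints N δ η δexp).after f ε n = run f ε (loopIter N δ η δexp n) 0 := by
  induction n with
  | zero => rfl
  | succ n ih =>
    rw [loopIter, run_bind, ← ih, Algorithm.after]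
    rcases (localizeChangePoints N δ η δexp).after f ε n with ⟨k | a, t⟩
    · have h : (localizeChangePoints N δ η δexp).body k = loopStep N δ η δexp (Sum.inl k) := by
        simp only [localizeChangePoints, loopStep, bind_def]
        congr 1
        funext o
        cases o <;> rfl
      simp only [h]
      rfl
    · rfl

lemma meas_loopStep (hf : Measurable f) : Meas f (loopStep N δ η δexp) := by
  intro t
  have h1 : Measurable fun z : ℕ × (ℕ → ℝ) => run f z.2 (loopStep N δ η δexp (Sum.inl z.1)) t := by
    refine measurable_from_prod_countable_right fun k => ?_
    have h : Meas f fun _ : Unit => loopStep N δ η δexp (Sum.inl k) :=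
      (meas_stage hf N δ η δexp k).bind
        (meas_ret ((measurable_optionElim measurable_inr).comp measurable_snd))
    exact (h t).comp (measurable_const (a := ()) |>.prodMk measurable_id)
  have h2 : Measurable fun z : (Fin N → ℝ) × (ℕ → ℝ) =>
      run f z.2 (loopStep N δ η δexp (Sum.inr z.1)) t :=
    (measurable_inr.comp measurable_fst).prodMk measurable_const
  have h3 := (Measurable.sumElim h1 h2).comp
    (MeasurableEquiv.sumProdDistrib ℕ (Fin N → ℝ) (ℕ → ℝ)).measurable
  convert h3 using 1
  funext ⟨z, e⟩
  cases z <;> rfl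

lemma meas_loopIter (hf : Measurable f) (n : ℕ) : Meas f fun _ : Unit => loopIter N δ η δexp n := by
  induction n with
  | zero => exact meas_ret measurable_const
  | succ n ih => exact ih.bind ((meas_loopStep hf).comp measurable_snd)

/-- While the loop runs, the stage index is deterministic. This ties each pass to its cost and its
confidence level. -/
lemma always_loopIter (n : ℕ) : Always f (loopIter N δ η δexp n) fun z =>
    ∀ k, z = Sum.inl k → k = Nat.clog 2 (2 * N) + n := by
  induction n with
  | zero =>
    intro k hk
    simpa using (Sum.inl.inj hk).symm
  | succ n ih =>
    refine always_bind.2 (ih.mono fun z hz => ?_)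
    rcases z with k | a
    · refine always_bind.2 (always_of_forall fun o j hj => ?_)
      cases o with
      | none =>
        have := hz k rfl
        have := Sum.inl.inj hj
        omega
      | some a => exact absurd hj (by simp)
    · intro k hk
      exact absurd hk (by simp)

variable {m : ℕ} {S : StepModel m} {ν : Measure ℝ}

lemma one_le_clog (hN : 1 ≤ N) : 1 ≤ Nat.clog 2 (2 * N) := Nat.clog_pos (by norm_num) (by omega)

lemma le_two_pow_clog (N n : ℕ) : N ≤ 2 ^ (Nat.clog 2 (2 * N) + n) := by
  have h1 := Nat.le_pow_clog (b := 2) (by norm_num) (2 * N)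
  have h2 : 2 ^ Nat.clog 2 (2 * N) ≤ 2 ^ (Nat.clog 2 (2 * N) + n) :=
    Nat.pow_le_pow_right (by norm_num) (by omega)
  omega

/-- The loop terminates with a wrong output with small probability. -/
lemma failLE_loopIter_correct (hν : SubGaussianLaw ν) (hδ : 0 < δ) (hδ1 : δ ≤ 1) (hη : 0 < η)
    (hN : 1 ≤ N) (n : ℕ) :
    FailLE S.f ν (loopIter N δ η δexp n) (fun z => ∀ a, z = Sum.inr a → GoodOutput S η a)
      (δ / 4) := by
  have := hν.prob
  have hk0 := one_le_clog hN
  set w : ℕ → ℝ := fun j => N * stageDelta N δ (Nat.clog 2 (2 * N) + j) with hw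
  have hw0 : ∀ j, 0 ≤ w j := fun j => by
    have := stageDelta_pos (N := N) hδ hN (k := Nat.clog 2 (2 * N) + j) (by omega)
    simp only [hw]
    positivity
  have h : FailLE S.f ν (loopIter N δ η δexp n) (fun z => ∀ a, z = Sum.inr a → GoodOutput S η a)
      (∑ j ∈ Finset.range n, w j) := by
    induction n with
    | zero => exact failLE_ret (fun a ha => absurd ha (by simp)) _
    | succ n ih =>
      rw [Finset.sum_range_succ]
      refine (ih.and_always (always_loopIter n)).bind (fun z hz => ?_)
        (Finset.sum_nonneg fun j _ => hw0 j) (hw0 n)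
      rcases z with k | a
      · have hk := hz.2 k rfl
        subst hk
        have h1 := (failLE_stage_correct (S := S) hν hδ hδ1 hη δexp hN
          (k := Nat.clog 2 (2 * N) + n) (by omega)).bind (δ' := 0)
          (q := fun o => ret (o.elim (Sum.inl (Nat.clog 2 (2 * N) + n + 1)) Sum.inr))
          (Q := fun z : ℕ ⊕ (Fin N → ℝ) => ∀ a, z = Sum.inr a → GoodOutput S η a)
          (fun o ho => failLE_ret (fun a ha => by
            cases o with
            | none => exact absurd ha (by simp)
            | some b => exact ho a (congrArg some (Sum.inr.inj ha))) _) (hw0 n) le_rfl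
        rw [add_zero] at h1
        exact h1
      · exact failLE_ret (fun b hb => hz.1 b hb) _
  refine h.mono (fun _ h => h) ?_
  have hpi := Real.pi_pos
  calc ∑ j ∈ Finset.range n, w j
      -- The first stage index is at least 1, so the stage with number j has index at least 1 + j.
      ≤ ∑ j ∈ Finset.range n, 3 * δ / (2 * Real.pi ^ 2) * (1 / ((1 + j : ℕ) : ℝ) ^ 2) := by
        refine Finset.sum_le_sum fun j _ => ?_
        simp only [hw]
        rw [mul_stageDelta hN]
        gcongr
    _ = 3 * δ / (2 * Real.pi ^ 2) * ∑ j ∈ Finset.range n, 1 / ((1 + j : ℕ) : ℝ) ^ 2 := by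
        rw [Finset.mul_sum]
    _ ≤ 3 * δ / (2 * Real.pi ^ 2) * (Real.pi ^ 2 / 6) := by
        gcongr
        exact sum_one_div_sq_le n
    _ = δ / 4 := by field_simp; norm_num

/-- Probability that the loop is still running. -/
lemma wp_loopIter_isLeft_le [IsProbabilityMeasure ν] {q : ℝ} {n₀ : ℕ}
    (h : ∀ k, Nat.clog 2 (2 * N) + n₀ ≤ k →
      FailLE f ν (stage N δ η δexp k) (fun o => o ≠ none) q) (n : ℕ) :
    wp f ν (loopIter N δ η δexp (n₀ + n)) ({z | z.isLeft = true}.indicator 1) ≤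
      ENNReal.ofReal q ^ n := by
  classical
  induction n with
  | zero =>
    rw [pow_zero]
    refine (wp_mono (ψ := fun _ => 1) fun z => Set.indicator_le_self _ _ z).trans ?_
    rw [wp_const]
  | succ n ih =>
    rw [← add_assoc, loopIter, wp_bind, pow_succ']
    refine le_trans ?_ (mul_le_mul_right ih (ENNReal.ofReal q))
    refine le_trans (wp_mono_of_always ((always_loopIter (n₀ + n)).mono fun z hz => ?_))
      (wp_const_mul_le _ ENNReal.ofReal_ne_top _)
    rcases z with k | a
    · have hk := hz k rfl
      have h1 := h k (by omega)
      simp only [loopStep, wp_bind]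
      rw [Set.indicator_of_mem (by simp), Pi.one_apply, mul_one]
      refine le_trans (wp_mono fun o => ?_) h1
      cases o with
      | none => exact (Set.indicator_le_self _ _ _).trans (by simp)
      | some a => simp [wp]
    · simp [loopStep, wp]

end loop

end ChangePoint

namespace ChangePoint

open Prog

/-! ### Pathwise monotonicity and cost of the loop -/

section paths

variable {N : ℕ} {δ η δexp : ℝ} {f : ℝ → ℝ}

lemma loopIter_eq_inr_of_le {e : ℕ → ℝ} {n n' : ℕ} (hn : n ≤ n') {a : Fin N → ℝ}
    (h : (run f e (loopIter N δ η δexp n) 0).1 = Sum.inr a) :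
    (run f e (loopIter N δ η δexp n') 0).1 = Sum.inr a := by
  induction n', hn using Nat.le_induction with
  | base => exact h
  | succ n' _ ih => rw [loopIter, run_bind, ih]; rfl

lemma isLeft_of_le {e : ℕ → ℝ} {n n' : ℕ} (hn : n ≤ n')
    (h : (run f e (loopIter N δ η δexp n') 0).1.isLeft = true) :
    (run f e (loopIter N δ η δexp n) 0).1.isLeft = true := by
  rcases hz : (run f e (loopIter N δ η δexp n) 0).1 with k | a
  · rfl
  · rw [loopIter_eq_inr_of_le hn hz] at h
    simp at h

lemma run_loopIter_cost_le (e : ℕ → ℝ) (n : ℕ) :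
    (run f e (loopIter N δ η δexp n) 0).2 ≤ ∑ j ∈ Finset.range n,
      if (run f e (loopIter N δ η δexp j) 0).1.isLeft = true then
        6 * 2 ^ (Nat.clog 2 (2 * N) + j) else 0 := by
  induction n with
  | zero => simp [loopIter, run]
  | succ n ih =>
    rw [Finset.sum_range_succ, loopIter, run_bind]
    rcases hz : run f e (loopIter N δ η δexp n) 0 with ⟨k | a, t⟩
    · rw [hz] at ih
      have hk := (always_loopIter (f := f) (N := N) (δ := δ) (η := η) (δexp := δexp) n).run e 0 k
        (by rw [hz])
      have h1 : CostLE f (loopStep N δ η δexp (Sum.inl k)) (6 * 2 ^ k + 0) :=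
        (costLE_stage N δ η δexp (by rw [hk]; exact le_two_pow_clog N n)).bind
          fun o => costLE_ret _ _ _
      have h2 := h1 e t
      simp only [Sum.isLeft_inl, if_true]
      rw [← hk]
      omega
    · rw [hz] at ih
      simpa [loopStep, run] using ih

end paths

/-! ### Events of failure and the law of the budget -/

section probability

variable {N m : ℕ} {S : StepModel m} {δ η δexp : ℝ} {Ω : Type u} {ε : ℕ → Ω → ℝ}

/-- The algorithm is still running after `n` stages. -/
def running (S : StepModel m) (ε : ℕ → Ω → ℝ) (N : ℕ) (δ η δexp : ℝ) (n : ℕ) : Set Ω :=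
  {ω | (run S.f (fun t => ε t ω) (loopIter N δ η δexp n) 0).1.isLeft = true}

/-- The algorithm has stopped with a wrong output after at most `n` stages. -/
def wrong (S : StepModel m) (ε : ℕ → Ω → ℝ) (N : ℕ) (δ η δexp : ℝ) (n : ℕ) : Set Ω :=
  {ω | ∃ a, (run S.f (fun t => ε t ω) (loopIter N δ η δexp n) 0).1 = Sum.inr a ∧
    ¬ GoodOutput S η a}

lemma exists_goodOutput {ω : Ω} {n : ℕ} (h1 : ω ∉ ⋃ n, wrong S ε N δ η δexp n)
    (h2 : ω ∉ running S ε N δ η δexp n) : ∃ xhat : Fin N → ℝ,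
      (localizeChangePoints N δ η δexp).Returns S.f (fun t => ε t ω) xhat ∧
        GoodOutput S η xhat := by
  rcases hz : (run S.f (fun t => ε t ω) (loopIter N δ η δexp n) 0).1 with k | a
  · exact absurd (by simp [running, hz]) h2
  · refine ⟨a, ⟨n, ?_⟩, ?_⟩
    · rw [after_eq_run_loopIter]; exact hz
    · by_contra h
      exact h1 (Set.mem_iUnion.2 ⟨n, a, hz, h⟩)

lemma budget_le_of_notMem_running {ω : Ω} {n : ℕ} (h : ω ∉ running S ε N δ η δexp (n + 1)) :
    (localizeChangePoints N δ η δexp).budget S.f (fun t => ε t ω) ≤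
      12 * 2 ^ (Nat.clog 2 (2 * N) + n) := by
  refine iSup_le fun n' => ?_
  rw [after_eq_run_loopIter]
  have h1 := run_loopIter_cost_le (f := S.f) (N := N) (δ := δ) (η := η) (δexp := δexp)
    (fun t => ε t ω) n'
  have h2 : (run S.f (fun t => ε t ω) (loopIter N δ η δexp n') 0).2 ≤
      12 * 2 ^ (Nat.clog 2 (2 * N) + n) := by
    refine h1.trans ?_
    calc _ ≤ ∑ j ∈ Finset.range (n + 1), 6 * 2 ^ (Nat.clog 2 (2 * N) + j) := by
          rw [← Finset.sum_filter]
          refine Finset.sum_le_sum_of_subset fun j hj => ?_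
          rw [Finset.mem_filter] at hj
          rw [Finset.mem_range]
          by_contra hj'
          exact h (isLeft_of_le (not_lt.1 hj') hj.2)
      _ = 6 * 2 ^ Nat.clog 2 (2 * N) * ∑ j ∈ Finset.range (n + 1), 2 ^ j := by
          rw [Finset.mul_sum]
          exact Finset.sum_congr rfl fun j _ => by rw [pow_add]; ring
      _ ≤ 6 * 2 ^ Nat.clog 2 (2 * N) * 2 ^ (n + 1) := by
          gcongr
          exact (Nat.geomSum_lt (m := 2) le_rfl fun k hk => by simpa using hk).le
      _ = _ := by rw [pow_add, pow_succ]; ring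
  exact_mod_cast h2

lemma budget_le_tsum (ω : Ω) :
    (localizeChangePoints N δ η δexp).budget S.f (fun t => ε t ω) ≤
      ∑' j, (running S ε N δ η δexp j).indicator
        (fun _ => 6 * 2 ^ (Nat.clog 2 (2 * N) + j)) ω := by
  refine iSup_le fun n => ?_
  rw [after_eq_run_loopIter]
  refine le_trans ?_ (ENNReal.sum_le_tsum (Finset.range n))
  have h1 := run_loopIter_cost_le (f := S.f) (N := N) (δ := δ) (η := η) (δexp := δexp)
    (fun t => ε t ω) n
  have h2 : ((run S.f (fun t => ε t ω) (loopIter N δ η δexp n) 0).2 : ℝ≥0∞) ≤ _ :=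
    Nat.cast_le.2 h1
  refine h2.trans (le_of_eq ?_)
  rw [Nat.cast_sum]
  refine Finset.sum_congr rfl fun j _ => ?_
  by_cases hj : ω ∈ running S ε N δ η δexp j
  · rw [Set.indicator_of_mem hj, if_pos (by exact hj)]; push_cast; rfl
  · rw [Set.indicator_of_notMem hj, if_neg (by exact hj)]; simp

variable [MeasurableSpace Ω] {P : Measure Ω}

lemma measurable_run_loopIter (hε : IsNoise ε P) (n : ℕ) :
    Measurable fun ω => run S.f (fun t => ε t ω) (loopIter N δ η δexp n) 0 :=
  (meas_loopIter S.measurable_f n 0).comp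
    (measurable_const (a := ()) |>.prodMk (measurable_pi_lambda _ hε.measurable))

lemma measurableSet_isLeft {α β : Type} [MeasurableSpace α] [MeasurableSpace β] :
    MeasurableSet {z : α ⊕ β | z.isLeft = true} := by
  have : Measurable (Sum.isLeft : α ⊕ β → Bool) := by
    convert Measurable.sumElim (measurable_const (a := true) : Measurable fun _ : α => true)
      (measurable_const (a := false) : Measurable fun _ : β => false) using 1
    funext z
    cases z <;> rfl
  exact this (measurableSet_singleton true)

lemma measurableSet_goodOutput (S : StepModel m) (η : ℝ) :
    MeasurableSet {x : Fin N → ℝ | GoodOutput S η x} := by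
  have h1 : MeasurableSet {x : Fin N → ℝ | StrictMono x} := by
    simp only [StrictMono, Set.ofPred_forall]
    exact MeasurableSet.iInter fun a => MeasurableSet.iInter fun b => MeasurableSet.iInter fun _ =>
      measurableSet_lt (measurable_pi_apply a) (measurable_pi_apply b)
  have h2 : MeasurableSet {x : Fin N → ℝ | ∀ l, 0 ≤ x l ∧ x l ≤ 1} := by
    simp only [Set.ofPred_forall]
    exact MeasurableSet.iInter fun l => (measurableSet_le measurable_const
      (measurable_pi_apply l)).inter (measurableSet_le (measurable_pi_apply l) measurable_const)
  have h3 : MeasurableSet {x : Fin N → ℝ | S.Localized η x} := by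
    simp only [StepModel.Localized, Set.ofPred_exists]
    have h4 : ∀ i : Fin N → Fin m, MeasurableSet {x : Fin N → ℝ | ∀ l, |x l - S.x (i l)| ≤ η} := by
      intro i
      simp only [Set.ofPred_forall]
      exact MeasurableSet.iInter fun l => measurableSet_le
        ((measurable_pi_apply l).sub measurable_const).abs measurable_const
    exact MeasurableSet.iUnion fun i => (MeasurableSet.const _).inter (h4 i)
  exact h1.inter (h2.inter h3)

lemma measurableSet_wrongOutput (S : StepModel m) (η : ℝ) :
    MeasurableSet {z : ℕ ⊕ (Fin N → ℝ) | ∃ a, z = Sum.inr a ∧ ¬ GoodOutput S η a} := by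
  convert (measurableSet_goodOutput (N := N) S η).compl.inr_image (α := ℕ) using 1
  ext z
  simp only [Set.mem_ofPred_eq, Set.mem_image, Set.mem_compl_iff]
  exact ⟨fun ⟨a, h1, h2⟩ => ⟨a, h2, h1.symm⟩, fun ⟨a, h1, h2⟩ => ⟨a, h2.symm, h1⟩⟩

lemma measurableSet_running (hε : IsNoise ε P) (n : ℕ) :
    MeasurableSet (running S ε N δ η δexp n) :=
  (measurable_run_loopIter hε n).fst measurableSet_isLeft

lemma measurableSet_wrong (hε : IsNoise ε P) (n : ℕ) : MeasurableSet (wrong S ε N δ η δexp n) :=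
  (measurable_run_loopIter hε n).fst (measurableSet_wrongOutput S η)

lemma measurable_budget (hε : IsNoise ε P) : Measurable fun ω =>
    (localizeChangePoints N δ η δexp).budget S.f (fun t => ε t ω) := by
  unfold Algorithm.budget
  simp only [after_eq_run_loopIter]
  refine Measurable.iSup fun n => ?_
  exact (measurable_from_nat (f := fun n : ℕ => (n : ℝ≥0∞))).comp
    (measurable_run_loopIter hε n).snd

variable [IsProbabilityMeasure P]

/-- A returned output never changes, so the events increase with n and the uniform bound passes to
their union. -/
lemma measure_wrong_le (hε : IsNoise ε P) (hN : 1 ≤ N) (hδ : 0 < δ) (hδ1 : δ ≤ 1) (hη : 0 < η) :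
    P (⋃ n, wrong S ε N δ η δexp n) ≤ ENNReal.ofReal (δ / 4) := by
  have hmono : Monotone (wrong S ε N δ η δexp) := fun n n' hn ω ⟨a, h1, h2⟩ =>
    ⟨a, loopIter_eq_inr_of_le hn h1, h2⟩
  rw [hmono.measure_iUnion]
  refine iSup_le fun n => ?_
  refine (hε.run_le_wp (meas_loopIter S.measurable_f n) (measurableSet_wrongOutput S η)).trans ?_
  refine (wp_mono fun z => ?_).trans
    (failLE_loopIter_correct (S := S) (δexp := δexp) hε.subGaussianLaw hδ hδ1 hη hN n)
  by_cases h : z ∈ {z : ℕ ⊕ (Fin N → ℝ) | ∃ a, z = Sum.inr a ∧ ¬ GoodOutput S η a}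
  · rw [Set.indicator_of_mem h, if_neg]
    · simp
    · obtain ⟨a, h1, h2⟩ := h
      exact fun h => h2 (h a h1)
  · rw [Set.indicator_of_notMem h]
    exact zero_le

lemma measure_running_le (hε : IsNoise ε P) {q : ℝ} {n₀ : ℕ}
    (h : ∀ k, Nat.clog 2 (2 * N) + n₀ ≤ k →
      FailLE S.f (P.map (ε 0)) (stage N δ η δexp k) (fun o => o ≠ none) q) (n : ℕ) :
    P (running S ε N δ η δexp (n₀ + n)) ≤ ENNReal.ofReal q ^ n := by
  have := hε.subGaussianLaw.prob
  exact (hε.run_le_wp (meas_loopIter S.measurable_f _) measurableSet_isLeft).trans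
    (wp_loopIter_isLeft_le h n)

/-- Stages before n₀ cost at most 6·2^(k₀+n₀) altogether. Afterwards costs double while survival
shrinks by at least four, and the geometric series of ratio 1/2 adds 12·2^(k₀+n₀). -/
lemma lintegral_budget_le (hε : IsNoise ε P) {q : ℝ} (hq : q ≤ 1 / 4) {n₀ : ℕ}
    (h : ∀ k, Nat.clog 2 (2 * N) + n₀ ≤ k →
      FailLE S.f (P.map (ε 0)) (stage N δ η δexp k) (fun o => o ≠ none) q) :
    ∫⁻ ω, (localizeChangePoints N δ η δexp).budget S.f (fun t => ε t ω) ∂P ≤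
      18 * 2 ^ (Nat.clog 2 (2 * N) + n₀) := by
  refine (lintegral_mono budget_le_tsum).trans ?_
  rw [lintegral_tsum fun j =>
    (measurable_const.indicator (measurableSet_running hε j)).aemeasurable]
  simp only [lintegral_indicator_const (measurableSet_running hε _)]
  rw [← (ENNReal.summable).sum_add_tsum_nat_add' (k := n₀)]
  have h1 : ∑ j ∈ Finset.range n₀, 6 * 2 ^ (Nat.clog 2 (2 * N) + j) *
      P (running S ε N δ η δexp j) ≤ 6 * 2 ^ (Nat.clog 2 (2 * N) + n₀) := by
    calc _ ≤ ∑ j ∈ Finset.range n₀, (6 : ℝ≥0∞) * 2 ^ (Nat.clog 2 (2 * N) + j) :=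
          Finset.sum_le_sum fun j _ => mul_le_of_le_one_right' prob_le_one
      _ = 6 * 2 ^ Nat.clog 2 (2 * N) * ((∑ j ∈ Finset.range n₀, 2 ^ j : ℕ) : ℝ≥0∞) := by
          push_cast
          rw [Finset.mul_sum]
          exact Finset.sum_congr rfl fun j _ => by rw [pow_add]; ring
      _ ≤ 6 * 2 ^ Nat.clog 2 (2 * N) * ((2 ^ n₀ : ℕ) : ℝ≥0∞) := by
          gcongr
          exact (Nat.geomSum_lt (m := 2) le_rfl fun k hk => by simpa using hk).le
      _ = _ := by push_cast; rw [pow_add]; ring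
  have h2 : ∑' j, 6 * 2 ^ (Nat.clog 2 (2 * N) + (j + n₀)) *
      P (running S ε N δ η δexp (j + n₀)) ≤ 12 * 2 ^ (Nat.clog 2 (2 * N) + n₀) := by
    calc _ ≤ ∑' j : ℕ, 6 * 2 ^ (Nat.clog 2 (2 * N) + n₀) * (2⁻¹ : ℝ≥0∞) ^ j := by
          refine ENNReal.tsum_le_tsum fun j => ?_
          have h3 := measure_running_le hε h j
          rw [add_comm n₀ j] at h3
          have h4 : ENNReal.ofReal q ≤ 2⁻¹ * 2⁻¹ := by
            rw [← ENNReal.ofReal_ofNat 2, ← ENNReal.ofReal_inv_of_pos (by norm_num),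
              ← ENNReal.ofReal_mul (by norm_num)]
            exact ENNReal.ofReal_le_ofReal (by norm_num; linarith)
          calc (6 : ℝ≥0∞) * 2 ^ (Nat.clog 2 (2 * N) + (j + n₀)) *
                P (running S ε N δ η δexp (j + n₀))
              ≤ 6 * 2 ^ (Nat.clog 2 (2 * N) + (j + n₀)) * (2⁻¹ * 2⁻¹) ^ j := by
                gcongr
                exact h3.trans (by gcongr)
            _ = 6 * 2 ^ (Nat.clog 2 (2 * N) + n₀) * ((2 * 2⁻¹) ^ j * 2⁻¹ ^ j) := by
                rw [mul_pow, mul_pow, show Nat.clog 2 (2 * N) + (j + n₀) =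
                  Nat.clog 2 (2 * N) + n₀ + j by ring, pow_add _ _ j]
                ring
            _ = _ := by
                rw [ENNReal.mul_inv_cancel (by norm_num) (by norm_num), one_pow, one_mul]
      _ = 6 * 2 ^ (Nat.clog 2 (2 * N) + n₀) * 2 := by
          rw [ENNReal.tsum_mul_left, ENNReal.tsum_geometric, ENNReal.one_sub_inv_two, inv_inv]
      _ = _ := by ring
  calc _ ≤ (6 : ℝ≥0∞) * 2 ^ (Nat.clog 2 (2 * N) + n₀) + 12 * 2 ^ (Nat.clog 2 (2 * N) + n₀) :=
        add_le_add h1 h2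
    _ = _ := by ring

end probability

end ChangePoint

namespace ChangePoint

open Prog

/-! ### The critical budget and the three bounds -/

section main

variable {N m : ℕ} {S : StepModel m} {δ η δexp : ℝ}

/-- The budget from which the stages are likely to succeed, up to a constant. -/
noncomputable def explorationBudget (S : StepModel m) (N : ℕ) (δ η δexp : ℝ) : ℝ :=
  (1 + S.omega1) * S.Hdetect * (Real.log (1 / δexp) + S.omega2) +
    S.Hlocalize N * (Real.log (1 / (δ * η)) + S.omega3 N)

lemma log_add_omega3_ge (hN : 1 ≤ N) (hδ : 0 < δ) (hη : 0 < η) (hη1 : η ≤ 1 / 4) :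
    Real.log (1 / δ) + 1.38 ≤ Real.log (1 / (δ * η)) + S.omega3 N := by
  have h1 := log_inv_ge_log_four hη hη1
  have h2 := Real.log_nonneg (x := N) (by exact_mod_cast hN)
  have h3 := log_max_nonneg (Real.log (S.Hlocalize N))
  rw [log_inv_mul hδ hη, omega3_eq hN]
  linarith

lemma cast_le_explorationBudget (hN : 1 ≤ N) (hNm : N ≤ m) (hδ : 0 < δ) (hδ1 : δ ≤ 1 / 4)
    (hη : 0 < η) (hη1 : η ≤ 1 / 4) (hexp : 0 < δexp) (hexp1 : δexp ≤ 1 / 4) :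
    (N : ℝ) ≤ explorationBudget S N δ η δexp := by
  have hm : 0 < m := by omega
  have h1 := log_add_omega3_ge (S := S) hN hδ hη hη1
  have h2 := log_inv_ge_log_four hδ hδ1
  have h3 := log_inv_ge_log_four hexp hexp1
  have h4 := S.omega1_nonneg hm
  have h5 := S.one_le_omega2 hm
  have h6 := S.one_le_Hdetect hm
  have h7 := S.cast_le_Hlocalize hNm
  have h8 : (0 : ℝ) ≤ N := by positivity
  have h9 : 0 ≤ (1 + S.omega1) * S.Hdetect * (Real.log (1 / δexp) + S.omega2) := by positivity
  have h10 : (N : ℝ) * 1 ≤ S.Hlocalize N * (Real.log (1 / (δ * η)) + S.omega3 N) := by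
    gcongr <;> linarith
  unfold explorationBudget
  linarith

/-- Some power of two lies between Φ and 2Φ; the lower bound on Φ ensures that the loop has not
already started beyond it. -/
lemma exists_stage_index {Φ : ℝ} (hN : 1 ≤ N) (hΦ : 4 * N ≤ Φ) :
    ∃ n₀, Φ ≤ 2 ^ (Nat.clog 2 (2 * N) + n₀) ∧ (2 : ℝ) ^ (Nat.clog 2 (2 * N) + n₀) ≤ 2 * Φ := by
  have hN' : (1 : ℝ) ≤ N := by exact_mod_cast hN
  obtain ⟨k, hk1, hk2⟩ := exists_nat_pow_near (x := Φ) (y := 2) (by linarith) (by norm_num)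
  have h1 : Nat.clog 2 (2 * N) ≤ k + 1 := by
    have h2 := Nat.pow_pred_clog_lt_self (b := 2) (by norm_num) (x := 2 * N) (by omega)
    have h3 : (2 : ℝ) ^ (Nat.clog 2 (2 * N)).pred < 2 ^ (k + 1) := by
      have : (2 : ℝ) ^ (Nat.clog 2 (2 * N)).pred < 2 * N := by exact_mod_cast h2
      linarith
    have h4 := (pow_lt_pow_iff_right₀ (by norm_num : (1 : ℝ) < 2)).1 h3
    have h5 := one_le_clog hN
    rw [Nat.pred_eq_sub_one] at h4
    omega
  refine ⟨k + 1 - Nat.clog 2 (2 * N), ?_, ?_⟩ <;> rw [Nat.add_sub_of_le h1]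
  · exact hk2.le
  · rw [pow_succ]; linarith

/-- From some stage on, all stages are likely to succeed. -/
lemma exists_stage_succeeds (hN : 1 ≤ N) (hNm : N ≤ m) (hδ : 0 < δ) (hδ1 : δ ≤ 1 / 4)
    (hη : 0 < η) (hη1 : η ≤ 1 / 4) (hexp : 0 < δexp) (hexp1 : δexp ≤ 1 / 4) :
    ∃ n₀, (2 : ℝ) ^ (Nat.clog 2 (2 * N) + n₀) ≤ 2 * (10 ^ 8 * explorationBudget S N δ η δexp) ∧
      ∀ ν : Measure ℝ, SubGaussianLaw ν → ∀ k, Nat.clog 2 (2 * N) + n₀ ≤ k →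
        FailLE S.f ν (stage N δ η δexp k) (fun o => o ≠ none) (δexp / 2 + δ / 4) := by
  have h1 := cast_le_explorationBudget (S := S) hN hNm hδ hδ1 hη hη1 hexp hexp1
  have hN' : (1 : ℝ) ≤ N := by exact_mod_cast hN
  obtain ⟨n₀, h2, h3⟩ := exists_stage_index (Φ := 10 ^ 8 * explorationBudget S N δ η δexp) hN
    (by linarith)
  refine ⟨n₀, h3, fun ν hν k hk => failLE_stage_succeeds hν hN hNm hδ hδ1 hη hη1 hexp hexp1 ?_⟩
  exact h2.trans (pow_le_pow_right₀ (by norm_num) hk)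

/-- The analysis uses 1 + ω₁ but the theorem has ω₁, which may be tiny. If H_detect ≥ 2, then 1 + ω₁
≤ 3ω₁. Otherwise H_detect and ω₂ are bounded, and the excess 2y is absorbed by the localization
term. -/
lemma one_add_omega1_mul_le (hm : 0 < m) {y : ℝ} (hy : 0 ≤ y) :
    (1 + S.omega1) * S.Hdetect * y ≤ 3 * (S.omega1 * S.Hdetect * y) ∨
      S.omega2 ≤ 2.4 ∧ (1 + S.omega1) * S.Hdetect * y ≤ S.omega1 * S.Hdetect * y + 2 * y := by
  have h6 := S.one_le_Hdetect hm
  have hlog2 := Real.log_two_gt_d9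
  have hlog2' := Real.log_two_lt_d9
  rcases le_total 2 S.Hdetect with h | h
  · left
    have h1 : Real.log 2 ≤ S.omega1 := Real.log_le_log (by norm_num) h
    calc (1 + S.omega1) * S.Hdetect * y ≤ (3 * S.omega1) * S.Hdetect * y := by
          gcongr; linarith
      _ = _ := by ring
  · right
    have h1 : S.omega1 ≤ Real.log 2 := Real.log_le_log (by linarith) h
    refine ⟨by linarith [S.omega2_le hm], ?_⟩
    have h2 : S.Hdetect * y ≤ 2 * y := by gcongr
    linarith

lemma explorationBudget_self_le (hN : 1 ≤ N) (hNm : N ≤ m) (hδ : 0 < δ) (hδ1 : δ ≤ 1 / 4)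
    (hη : 0 < η) (hη1 : η ≤ 1 / 4) :
    explorationBudget S N δ η δ ≤
      10 * (S.omega1 * S.Hdetect * (Real.log (1 / δ) + S.omega2) +
        S.Hlocalize N * (Real.log (1 / (δ * η)) + S.omega3 N)) := by
  have hm : 0 < m := by omega
  have hN' : (1 : ℝ) ≤ N := by exact_mod_cast hN
  have h1 := log_add_omega3_ge (S := S) hN hδ hη hη1
  have h2 := log_inv_ge_log_four hδ hδ1
  have h4 := S.omega1_nonneg hm
  have h5 := S.one_le_omega2 hm
  have h6 := S.one_le_Hdetect hm
  have h7 := S.cast_le_Hlocalize hNm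
  have h8 : 1 * (Real.log (1 / (δ * η)) + S.omega3 N) ≤
      S.Hlocalize N * (Real.log (1 / (δ * η)) + S.omega3 N) := by
    gcongr <;> linarith
  have h9 : 0 ≤ S.omega1 * S.Hdetect * (Real.log (1 / δ) + S.omega2) := by positivity
  unfold explorationBudget
  rcases one_add_omega1_mul_le (S := S) hm (y := Real.log (1 / δ) + S.omega2) (by linarith) with
    h | ⟨h, h'⟩ <;> linarith

lemma explorationBudget_quarter_le (hN : 1 ≤ N) (hNm : N ≤ m) (hδ : 0 < δ) (hδ1 : δ ≤ 1 / 4)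
    (hη : 0 < η) (hη1 : η ≤ 1 / 4) :
    explorationBudget S N δ η (1 / 4) ≤
      10 * (S.omega1 * S.Hdetect * S.omega2 +
        S.Hlocalize N * (Real.log (1 / (δ * η)) + S.omega3 N)) := by
  have hm : 0 < m := by omega
  have hN' : (1 : ℝ) ≤ N := by exact_mod_cast hN
  have h1 := log_add_omega3_ge (S := S) hN hδ hη hη1
  have h2 := log_inv_ge_log_four hδ hδ1
  have h4 := S.omega1_nonneg hm
  have h5 := S.one_le_omega2 hm
  have h6 := S.one_le_Hdetect hm
  have h7 := S.cast_le_Hlocalize hNm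
  have h8 : 1 * (Real.log (1 / (δ * η)) + S.omega3 N) ≤
      S.Hlocalize N * (Real.log (1 / (δ * η)) + S.omega3 N) := by
    gcongr <;> linarith
  have h9 : 0 ≤ S.omega1 * S.Hdetect * S.omega2 := by positivity
  have h10 : Real.log (1 / (1 / 4)) ≤ 1.4 := by
    have := log_four_div (δ := 1) (by norm_num)
    rw [div_one, Real.log_one] at this
    linarith [Real.log_two_lt_d9]
  have h11 : (1 + S.omega1) * S.Hdetect * (Real.log (1 / (1 / 4)) + S.omega2) ≤
      (1 + S.omega1) * S.Hdetect * (2.4 * S.omega2) := by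
    gcongr
    linarith
  unfold explorationBudget
  rcases one_add_omega1_mul_le (S := S) hm (y := S.omega2) (by linarith) with
    h | ⟨h, h'⟩ <;> linarith

variable {Ω : Type u} [MeasurableSpace Ω] {P : Measure Ω} [IsProbabilityMeasure P]
  {ε : ℕ → Ω → ℝ}

lemma one_sub_le_measureReal_compl {A B : Set Ω} (hA : MeasurableSet A) (hB : MeasurableSet B)
    {a b d : ℝ} (ha : 0 ≤ a) (hb : 0 ≤ b) (hPA : P A ≤ ENNReal.ofReal a)
    (hPB : P B ≤ ENNReal.ofReal b) (hd : a + b ≤ d) : 1 - d ≤ P.real (A ∪ B)ᶜ := by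
  rw [probReal_compl_eq_one_sub (hA.union hB)]
  have h1 := measureReal_union_le (μ := P) A B
  have h2 : P.real A ≤ a := ENNReal.toReal_le_of_le_ofReal ha hPA
  have h3 : P.real B ≤ b := ENNReal.toReal_le_of_le_ofReal hb hPB
  linarith

/-- Almost surely, the loop stops. -/
lemma measure_iInter_running (hε : IsNoise ε P) (hN : 1 ≤ N) (hNm : N ≤ m) (hδ : 0 < δ)
    (hδ1 : δ ≤ 1 / 4) (hη : 0 < η) (hη1 : η ≤ 1 / 4) (hexp : 0 < δexp) (hexp1 : δexp ≤ 1 / 4) :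
    P (⋂ n, running S ε N δ η δexp n) = 0 := by
  obtain ⟨n₀, -, h⟩ := exists_stage_succeeds (S := S) hN hNm hδ hδ1 hη hη1 hexp hexp1
  have h1 := measure_running_le hε (h _ hε.subGaussianLaw)
  have h2 : ENNReal.ofReal (δexp / 2 + δ / 4) < 1 := ENNReal.ofReal_lt_one.2 (by linarith)
  exact le_antisymm (ge_of_tendsto' (ENNReal.tendsto_pow_atTop_nhds_zero_of_lt_one h2) fun n =>
    (measure_mono (Set.iInter_subset _ (n₀ + n))).trans (h1 n)) zero_le

lemma exists_event_correct (hε : IsNoise ε P) (hN : 1 ≤ N) (hNm : N ≤ m) (hδ : 0 < δ)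
    (hδ1 : δ ≤ 1 / 4) (hη : 0 < η) (hη1 : η ≤ 1 / 4) (hexp : 0 < δexp) (hexp1 : δexp ≤ 1 / 4) :
    ∃ ξ : Set Ω, MeasurableSet ξ ∧ 1 - δ ≤ P.real ξ ∧ ∀ ω ∈ ξ, ∃ xhat : Fin N → ℝ,
      (localizeChangePoints N δ η δexp).Returns S.f (fun t => ε t ω) xhat ∧
        GoodOutput S η xhat := by
  have hA : MeasurableSet (⋃ n, wrong S ε N δ η δexp n) :=
    MeasurableSet.iUnion fun n => measurableSet_wrong hε n
  have hB : MeasurableSet (⋂ n, running S ε N δ η δexp n) :=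
    MeasurableSet.iInter fun n => measurableSet_running hε n
  refine ⟨_, (hA.union hB).compl, one_sub_le_measureReal_compl hA hB (a := δ / 4) (b := 0)
    (by positivity) le_rfl (measure_wrong_le hε hN hδ (by linarith) hη) ?_ (by linarith),
    fun ω hω => ?_⟩
  · rw [measure_iInter_running hε hN hNm hδ hδ1 hη hη1 hexp hexp1]
    exact zero_le
  · rw [Set.compl_union] at hω
    have h2 := hω.2
    rw [Set.mem_compl_iff, Set.mem_iInter, not_forall] at h2
    obtain ⟨n, hn⟩ := h2
    exact exists_goodOutput hω.1 hn

/-- The exceptional event is a wrong output (δ/4) or failure of the first stage past the threshold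
(δ/2 + δ/4). Off it, the costs of the stages form a geometric sum up to that stage. -/
lemma exists_event_budget (hε : IsNoise ε P) (hN : 1 ≤ N) (hNm : N ≤ m) (hδ : 0 < δ)
    (hδ1 : δ ≤ 1 / 4) (hη : 0 < η) (hη1 : η ≤ 1 / 4) :
    ∃ ξ : Set Ω, MeasurableSet ξ ∧ 1 - δ ≤ P.real ξ ∧ ∀ ω ∈ ξ,
      (∃ xhat : Fin N → ℝ, (localizeChangePoints N δ η δ).Returns S.f (fun t => ε t ω) xhat ∧
        GoodOutput S η xhat) ∧
      (localizeChangePoints N δ η δ).budget S.f (fun t => ε t ω) ≤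
        ENNReal.ofReal (36 * 10 ^ 9 * (S.omega1 * S.Hdetect * (Real.log (1 / δ) + S.omega2) +
          S.Hlocalize N * (Real.log (1 / (δ * η)) + S.omega3 N))) := by
  obtain ⟨n₀, h1, h2⟩ := exists_stage_succeeds (S := S) hN hNm hδ hδ1 hη hη1 hδ hδ1
  have hA : MeasurableSet (⋃ n, wrong S ε N δ η δ n) :=
    MeasurableSet.iUnion fun n => measurableSet_wrong hε n
  have hB := measurableSet_running (S := S) (N := N) (δ := δ) (η := η) (δexp := δ) hε (n₀ + 1)
  have hPB := measure_running_le hε (h2 _ hε.subGaussianLaw) 1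
  rw [pow_one] at hPB
  refine ⟨_, (hA.union hB).compl, one_sub_le_measureReal_compl hA hB (a := δ / 4)
    (by positivity) (by positivity) (measure_wrong_le hε hN hδ (by linarith) hη) hPB
    (by linarith), fun ω hω => ?_⟩
  rw [Set.compl_union] at hω
  refine ⟨exists_goodOutput hω.1 hω.2, (budget_le_of_notMem_running hω.2).trans ?_⟩
  have h3 : (12 * 2 ^ (Nat.clog 2 (2 * N) + n₀) : ℝ≥0∞) =
      ENNReal.ofReal (12 * 2 ^ (Nat.clog 2 (2 * N) + n₀)) := by
    rw [ENNReal.ofReal_mul (by norm_num), ENNReal.ofReal_pow (by norm_num)]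
    simp
  rw [h3]
  refine ENNReal.ofReal_le_ofReal ?_
  have h4 := explorationBudget_self_le (S := S) hN hNm hδ hδ1 hη hη1
  have h5 := cast_le_explorationBudget (S := S) hN hNm hδ hδ1 hη hη1 hδ hδ1
  have hN' : (1 : ℝ) ≤ N := by exact_mod_cast hN
  linarith

lemma lintegral_budget_quarter_le (hε : IsNoise ε P) (hN : 1 ≤ N) (hNm : N ≤ m) (hδ : 0 < δ)
    (hδ1 : δ ≤ 1 / 4) (hη : 0 < η) (hη1 : η ≤ 1 / 4) :
    ∫⁻ ω, (localizeChangePoints N δ η (1 / 4)).budget S.f (fun t => ε t ω) ∂P ≤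
      ENNReal.ofReal (36 * 10 ^ 9 * (S.omega1 * S.Hdetect * S.omega2 +
        S.Hlocalize N * (Real.log (1 / (δ * η)) + S.omega3 N))) := by
  obtain ⟨n₀, h1, h2⟩ := exists_stage_succeeds (S := S) (δexp := 1 / 4) hN hNm hδ hδ1 hη hη1
    (by norm_num) le_rfl
  refine (lintegral_budget_le hε (by linarith) (h2 _ hε.subGaussianLaw)).trans ?_
  have h3 : (18 * 2 ^ (Nat.clog 2 (2 * N) + n₀) : ℝ≥0∞) =
      ENNReal.ofReal (18 * 2 ^ (Nat.clog 2 (2 * N) + n₀)) := by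
    rw [ENNReal.ofReal_mul (by norm_num), ENNReal.ofReal_pow (by norm_num)]
    simp
  rw [h3]
  refine ENNReal.ofReal_le_ofReal ?_
  have h4 := explorationBudget_quarter_le (S := S) hN hNm hδ hδ1 hη hη1
  linarith

end main

end ChangePoint

open ChangePoint in
theorem theorem1 :
    ∃ c : ℝ, 0 < c ∧ ∀ (N : ℕ) (δ η : ℝ), 1 ≤ N → 0 < δ → δ < 1 / 4 → 0 < η → η < 1 / 4 →
      -- correctness, for every admissible exploration parameter
      (∀ δexp : ℝ, 0 < δexp → δexp ≤ 1 / 4 →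
        IsCorrect.{u} δ η N (localizeChangePoints N δ η δexp) ∧
        ∀ (m : ℕ) (S : StepModel m), N ≤ m →
        ∀ (Ω : Type u) [MeasurableSpace Ω] (P : Measure Ω) [IsProbabilityMeasure P]
          (ε : ℕ → Ω → ℝ), IsNoise ε P →
          ∃ ξ : Set Ω, MeasurableSet ξ ∧ 1 - δ ≤ P.real ξ ∧ ∀ ω ∈ ξ,
            ∃ xhat : Fin N → ℝ,
              (localizeChangePoints N δ η δexp).Returns S.f (fun t => ε t ω) xhat ∧
              StrictMono xhat ∧ (∀ l, 0 ≤ xhat l ∧ xhat l ≤ 1) ∧ S.Localized η xhat) ∧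
      ∀ (m : ℕ) (S : StepModel m), N ≤ m →
      ∀ (Ω : Type u) [MeasurableSpace Ω] (P : Measure Ω) [IsProbabilityMeasure P]
        (ε : ℕ → Ω → ℝ), IsNoise ε P →
        -- bound in probability, with exploration parameter `δ`
        (∃ ξ : Set Ω, MeasurableSet ξ ∧ 1 - δ ≤ P.real ξ ∧ ∀ ω ∈ ξ,
          (∃ xhat : Fin N → ℝ,
            (localizeChangePoints N δ η δ).Returns S.f (fun t => ε t ω) xhat ∧
            S.Localized η xhat) ∧
          (localizeChangePoints N δ η δ).budget S.f (fun t => ε t ω) ≤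
            ENNReal.ofReal (c * (S.omega1 * S.Hdetect * (Real.log (1 / δ) + S.omega2) +
              S.Hlocalize N * (Real.log (1 / (δ * η)) + S.omega3 N)))) ∧
        -- bound in expectation, with exploration parameter `1 / 4`
        (Measurable fun ω => (localizeChangePoints N δ η (1 / 4)).budget S.f (fun t => ε t ω)) ∧
        ∫⁻ ω, (localizeChangePoints N δ η (1 / 4)).budget S.f (fun t => ε t ω) ∂P ≤
          ENNReal.ofReal (c * (S.omega1 * S.Hdetect * S.omega2 +
            S.Hlocalize N * (Real.log (1 / (δ * η)) + S.omega3 N))) := by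
  -- The constant is 18·2·10⁸·10: the geometric sum in the expectation, rounding to a power of two,
  -- the threshold of the stages, and the replacement of 1 + ω₁ by ω₁.
  refine ⟨36 * 10 ^ 9, by norm_num, fun N δ η hN hδ hδ1 hη hη1 => ⟨fun δexp hexp hexp1 =>
    ⟨fun m S hNm Ω _ P _ ε hε => ?_, fun m S hNm Ω _ P _ ε hε =>
      exists_event_correct hε hN hNm hδ hδ1.le hη hη1.le hexp hexp1⟩,
    fun m S hNm Ω _ P _ ε hε => ⟨?_, measurable_budget hε,
      lintegral_budget_quarter_le hε hN hNm hδ hδ1.le hη hη1.le⟩⟩⟩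
  · obtain ⟨ξ, -, h1, h2⟩ :=
      exists_event_correct (S := S) hε hN hNm hδ hδ1.le hη hη1.le hexp hexp1
    refine h1.trans (measureReal_mono fun ω hω => ?_)
    obtain ⟨xhat, h3, -, -, h4⟩ := h2 ω hω
    exact ⟨xhat, h3, h4⟩
  · obtain ⟨ξ, h0, h1, h2⟩ := exists_event_budget (S := S) hε hN hNm hδ hδ1.le hη hη1.le
    refine ⟨ξ, h0, h1, fun ω hω => ?_⟩
    obtain ⟨⟨xhat, h3, -, -, h4⟩, h5⟩ := h2 ω hω
    exact ⟨⟨xhat, h3, h4⟩, h5⟩
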